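/- **Language.** Fix a two-sorted schematic first-order language $L$ with sorts $\omega$ (numbers) and $\iota$ (individuals). It has the constant function symbols $0,s$ of sort $\omega$, constant function symbols with values in $\iota$ (arguments of either sort), constant predicate symbols, and defined function and predicate symbols whose first argument is of sort $\omega$. A set $\mathcal E$ of rewrite rules defines every defined symbol by primitive recursion from smaller symbols with respect to a well-founded order: $\hat f(0,\bar x)\to u$, $\hat f(s(y),\bar x)\to v[\hat f(y,\bar x)]$, and in the same way for predicates, with formulas on the right-hand side. There are second-order variables $x$, denoting sequences of individuals; the individual variables are the terms $x(t)$ with $t$ of sort $\omega$. Abstractions $\lambda k.t$ ($k$ of sort $\omega$) are admitted as values of second-order variables. Quantifiers range over $\iota$ only. Write $e{\downarrow}$ for the normal form of $e$ under $\mathcal E$ and $\beta$-reduction (expressions without defined symbols and abstractions), and $e{\downarrow}_\alpha$ for the normal form after $n:=\alpha$. "Ground" means free of individual and second-order variables. **Calculus.** Sequents and clauses are pairs of multisets, of formulas and of atoms with constant predicate symbols respectively. $\Gamma\vdash\Delta\circ\Gamma'\vdash\Delta'$ is $\Gamma,\Gamma'\vdash\Delta,\Delta'$. $\mathbf{LKS}_{\mathcal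 E}$ is multiplicative $\mathbf{LK}$ with axioms $A\vdash A$ ($A$ an atom with a constant predicate symbol), the eigenvariables of the strong quantifier rules being individual variables $x(t)$, plus the rule that replaces formulas by formulas equal modulo $\mathcal E$, plus proof links $(\psi_j(a,\bar t))$ as additional leaves, which stand for proofs of $S_j(a,\bar t)$. A proof schema $\Psi$ consists of proof symbols $\psi_0,\dots,\psi_m$ with end-sequents $S_j(n,\bar x)$ and, for each $j$, of $\mathbf{LKS}_{\mathcal E}$-proofs $\pi_j$ of $S_j(0,\bar x)$ and $\nu_j(k)$ of $S_j(k+1,\bar x)$. A link in either may go to $\psi_{j'}$ with $j'>j$ and an arithmetic argument that contains no second-order variable and no variable other than $k$ (in $\pi_j$: no variable), and $\nu_j(k)$ may in addition contain links $\psi_j(k,\bar t)$. The end-sequent of $\Psi$ is $S(n)=S_0(n)$, where $\psi_0$ has no argument besides $n$. **Characteristic clause set and projections.** A configuration $\Omega$ for $\psi_j$ is a set of formula occurrences in its end-sequent. In a proof $\pi\in\{\pi_j,\nu_j(k)\}$ call an occurrence *marked* if it is an ancestor of an occurrence in $\Omega$ or of a cut formula. * The term $\Theta(\pi,\Omega)$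 is, for an axiom, the clause of its marked occurrences; for a link to $\psi_{j'}(a,\bar t)$, the symbol $\mathrm{cl}^{\psi_{j'},\Omega'}(a,\bar t)$ with $\Omega'$ the marked occurrences; it is unchanged by unary rules; for a binary rule it is $\Theta\oplus\Theta'$ if the auxiliary formulas are marked, and $\Theta\otimes\Theta'$ otherwise. With the rules $\mathrm{cl}^{\psi_j,\Omega}(0,\bar x)\to\Theta(\pi_j,\Omega)$ and $\mathrm{cl}^{\psi_j,\Omega}(k+1,\bar x)\to\Theta(\nu_j(k),\Omega)$, $\mathrm{CL}(\Psi){\downarrow}_\alpha$ is the clause set obtained from the normal form of $\mathrm{cl}^{\psi_0,\emptyset}(\alpha)$ by reading $\oplus$ as union and $\otimes$ as $\{C\circ D\}$. * The projection term $\Xi(\pi,\Omega)$ keeps axioms, turns links into symbols $\mathrm{pr}^{\psi_{j'},\Omega'}(a,\bar t)$, skips unary rules with marked principal formula and equality rules, keeps the other unary rules, keeps binary rules with unmarked auxiliary formulas, and for a binary rule with marked auxiliary formulas is the union of the two terms of the premises, each weakened by the unmarked occurrences of the other premise. With the analogous rewrite rules, $\mathrm{PR}(\Psi){\downarrow}_\alpha$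 is the finite set of proofs obtained from the normal form of $\mathrm{pr}^{\psi_0,\emptyset}(\alpha)$ (a union of two terms being read as set union, a binary rule as its application to all pairs). **Resolution.** Clause schemata are built from clauses, clause variables, $\circ$, and clause symbols with definitions $c(0,\bar x,\bar X)\to C_0$, $c(k+1,\bar x,\bar X)\to c(k,\bar x,\bar X)\circ D$ with $D$ a clause. Resolution terms are built from clause schemata by $r(t_1;t_2;P)$, $P$ an atom with a constant predicate symbol; the end-clause of a resolution deduction $r(t_1;t_2;P)$ without schematic symbols is $\Gamma,\Pi'\vdash\Delta',\Lambda$, where $\Gamma\vdash\Delta$ and $\Pi\vdash\Lambda$ are the end-clauses of $t_1$, $t_2$, and $\Delta',\Pi'$ arise by deleting all occurrences of $P$. A resolution proof schema $\varrho_1,\dots,\varrho_\beta$ has rules $\varrho_i(0,\bar x,\bar X)\to s_i$, $\varrho_i(k+1,\bar x,\bar X)\to t_i$, with resolution terms that call only $\varrho_j$ with $j>i$ and, in $t_i$, also $\varrho_i(k,\dots)$. Given a substitution $\lambda$ of clause schemata without clause variables for the clause variables $\bar X$, and a substitution $\theta$ of terms $\lambda k.t$ for the second-order variables, it is a *resolution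 refutation schema of* $\mathrm{CL}(\Psi)$ if for each $\alpha\in\mathbb N$ the normal form $\varrho_1(n,\bar x,\bar X)\lambda\theta{\downarrow}_\alpha$ exists and is a ground resolution deduction of the empty clause from ground instances of clauses of $\mathrm{CL}(\Psi){\downarrow}_\alpha$. **Evaluation phase** (for given $\alpha$). Transform $\varrho_1(n,\bar x,\bar X)\lambda\theta{\downarrow}_\alpha$ into an $\mathbf{LKS}_{\mathcal E}$-derivation: each leaf $C\sigma$ ($C\in\mathrm{CL}(\Psi){\downarrow}_\alpha$, $\sigma$ ground) is replaced by $\varphi\sigma$ for some $\varphi\in\mathrm{PR}(\Psi){\downarrow}_\alpha$ with end-sequent $S(\alpha){\downarrow}\circ C$; each step $r(t_1;t_2;P)$ becomes contractions of the resolved occurrences of $P$ (a weakening if there are none) followed by a cut on $P$, the copies of $S(\alpha){\downarrow}$ being passed down; finally the copies of $S(\alpha){\downarrow}$ are contracted to one. Any proof $\pi$ so obtained is called an output at $\alpha$. **Theorem.** There is a polynomial $p$ such that the following holds. Let $\Psi$ be a proof schema with end-sequent $S(n)$, where $S(n)$ contains no free variable besides $n$ and is skolemized, i.e. $S(\alpha){\downarrow}$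 contains no strong quantifier for any $\alpha$. Let a resolution refutation schema $\varrho_1,\dots,\varrho_\beta$ of $\mathrm{CL}(\Psi)$ with substitutions $\lambda,\theta$ be given. Then for every $\alpha\in\mathbb N$ the evaluation phase has an output, and every output $\pi$ is a ground $\mathbf{LKS}_{\mathcal E}$-proof without proof links of $S(\alpha){\downarrow}$ (hence, after one application of the equality rule, of $S(\alpha)$), all of whose cuts are atomic, and $$|\pi|\le p\bigl(|\varrho_1(n,\bar x,\bar X)\lambda\theta{\downarrow}_\alpha|\cdot|\mathrm{PR}(\Psi){\downarrow}_\alpha|\bigr),$$ where $|\cdot|$ is the number of inferences (axioms included) of a proof, the number of nodes of a resolution deduction, and the total number of inferences of the elements of a set of proofs. Moreover, for every language $L$ there is a polynomial $q$ such that, for all $\mathcal E$, $\Psi$, resolution refutation schemata and $\alpha$ as above, some output $\pi$ satisfies the same bound, with $q$ in place of $p$, when $|\cdot|$ is the number of symbols. -/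

import Mathlib

namespace Ceres

/-! ## Schematic first-order language -/

/-- The sorts: `o` (natural numbers) and `i` (individuals). -/
inductive Srt
  | o
  | i

/-- Types of arguments: the two sorts, and `seq`, the type of second-order (schematic) variables,
i.e. sequences of individuals indexed by natural numbers. -/
inductive Ty
  | base (s : Srt)
  | seq

abbrev Ty.nat : Ty := Ty.base Srt.o
abbrev Ty.ind : Ty := Ty.base Srt.i

/-- Typed de Bruijn variables. -/
inductive Var : List Ty → Ty → Type
  | zero {Γ : List Ty} {τ : Ty} : Var (τ :: Γ) τ
  | succ {Γ : List Ty} {τ υ : Ty} : Var Γ τ → Var (υ :: Γ) τ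

/-- The symbols of a schematic language.  Constant function symbols have individuals as values
(the constant symbols `0` and `s` of sort `o` are built into the terms); a defined function or
predicate symbol has a recursion argument of sort `o` in front of the listed arguments; `V` is the
set of variable function symbols (names of second-order variables). -/
structure Lang where
  F : Type
  fargs : F → List Srt
  P : Type
  pargs : P → List Srt
  D : Type
  dargs : D → List Ty
  dres : D → Srt
  Q : Type
  qargs : Q → List Ty
  V : Type

/-- Terms whose free (first-order or argument) variables are those of the context `Γ`.
`app u t` is the individual variable `u(t)` when `u` is a second-order variable, and `lam` is the
abstraction `λ k. t` over a variable of sort `o`. -/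
inductive Tm (L : Lang) : List Ty → Ty → Type
  | var {Γ : List Ty} {τ : Ty} (v : Var Γ τ) : Tm L Γ τ
  | v2 {Γ : List Ty} (x : L.V) : Tm L Γ Ty.seq
  | app {Γ : List Ty} (u : Tm L Γ Ty.seq) (t : Tm L Γ Ty.nat) : Tm L Γ Ty.ind
  | lam {Γ : List Ty} (t : Tm L (Ty.nat :: Γ) Ty.ind) : Tm L Γ Ty.seq
  | zero {Γ : List Ty} : Tm L Γ Ty.nat
  | succ {Γ : List Ty} (t : Tm L Γ Ty.nat) : Tm L Γ Ty.nat
  | con {Γ : List Ty} (f : L.F) (as : ∀ τ, Var ((L.fargs f).map Ty.base) τ → Tm L Γ τ) :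
      Tm L Γ Ty.ind
  | dfn {Γ : List Ty} (d : L.D) (t : Tm L Γ Ty.nat)
      (as : ∀ τ, Var (L.dargs d) τ → Tm L Γ τ) : Tm L Γ (Ty.base (L.dres d))

/-- Renamings and substitutions; a substitution also serves as a tuple of arguments. -/
abbrev Ren (Γ Δ : List Ty) : Type := ∀ τ, Var Γ τ → Var Δ τ
abbrev Sub (L : Lang) (Γ Δ : List Ty) : Type := ∀ τ, Var Γ τ → Tm L Δ τ

def Ren.lift {Γ Δ : List Ty} (υ : Ty) (r : Ren Γ Δ) : Ren (υ :: Γ) (υ :: Δ)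
  | _, Var.zero => Var.zero
  | _, Var.succ v => Var.succ (r _ v)

def Tm.ren {L : Lang} : ∀ {Γ Δ : List Ty} {τ : Ty}, Ren Γ Δ → Tm L Γ τ → Tm L Δ τ
  | _, _, _, r, .var v => .var (r _ v)
  | _, _, _, _, .v2 x => .v2 x
  | _, _, _, r, .app u t => .app (u.ren r) (t.ren r)
  | _, _, _, r, .lam t => .lam (t.ren (r.lift _))
  | _, _, _, _, .zero => .zero
  | _, _, _, r, .succ t => .succ (t.ren r)
  | _, _, _, r, .con f as => .con f fun τ v => (as τ v).ren r
  | _, _, _, r, .dfn d t as => .dfn d (t.ren r) fun τ v => (as τ v).ren r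

def Tm.weaken {L : Lang} {Γ : List Ty} {τ : Ty} (υ : Ty) (t : Tm L Γ τ) : Tm L (υ :: Γ) τ :=
  t.ren fun _ v => Var.succ v

/-- The renaming out of the empty context. -/
def Ren.empty {Γ : List Ty} : Ren [] Γ := fun _ v => nomatch v

def Sub.id {L : Lang} {Γ : List Ty} : Sub L Γ Γ := fun _ v => .var v

def Sub.cons {L : Lang} {Γ Δ : List Ty} {υ : Ty} (t : Tm L Δ υ) (σ : Sub L Γ Δ) :
    Sub L (υ :: Γ) Δ
  | _, Var.zero => t
  | _, Var.succ v => σ _ v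

def Sub.lift {L : Lang} {Γ Δ : List Ty} (υ : Ty) (σ : Sub L Γ Δ) : Sub L (υ :: Γ) (υ :: Δ) :=
  Sub.cons (.var Var.zero) fun τ v => (σ τ v).weaken υ

def Tm.sub {L : Lang} : ∀ {Γ Δ : List Ty} {τ : Ty}, Sub L Γ Δ → Tm L Γ τ → Tm L Δ τ
  | _, _, _, σ, .var v => σ _ v
  | _, _, _, _, .v2 x => .v2 x
  | _, _, _, σ, .app u t => .app (u.sub σ) (t.sub σ)
  | _, _, _, σ, .lam t => .lam (t.sub (σ.lift _))
  | _, _, _, _, .zero => .zero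
  | _, _, _, σ, .succ t => .succ (t.sub σ)
  | _, _, _, σ, .con f as => .con f fun τ v => (as τ v).sub σ
  | _, _, _, σ, .dfn d t as => .dfn d (t.sub σ) fun τ v => (as τ v).sub σ

/-- The numeral `s(...s(0))`. -/
def Tm.num {L : Lang} {Γ : List Ty} : ℕ → Tm L Γ Ty.nat
  | 0 => .zero
  | n + 1 => .succ (Tm.num n)

/-- No second-order variable occurs in the term. -/
def Tm.V2Free {L : Lang} : ∀ {Γ : List Ty} {τ : Ty}, Tm L Γ τ → Prop
  | _, _, .var _ => True
  | _, _, .v2 _ => False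
  | _, _, .app u t => u.V2Free ∧ t.V2Free
  | _, _, .lam t => t.V2Free
  | _, _, .zero => True
  | _, _, .succ t => t.V2Free
  | _, _, .con _ as => ∀ τ v, (as τ v).V2Free
  | _, _, .dfn _ t as => t.V2Free ∧ ∀ τ v, (as τ v).V2Free

/-- Every defined function symbol of the term satisfies `p`. -/
def Tm.DAll {L : Lang} (p : L.D → Prop) : ∀ {Γ : List Ty} {τ : Ty}, Tm L Γ τ → Prop
  | _, _, .var _ => True
  | _, _, .v2 _ => True
  | _, _, .app u t => u.DAll p ∧ t.DAll p
  | _, _, .lam t => t.DAll p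
  | _, _, .zero => True
  | _, _, .succ t => t.DAll p
  | _, _, .con _ as => ∀ τ v, (as τ v).DAll p
  | _, _, .dfn d t as => p d ∧ t.DAll p ∧ ∀ τ v, (as τ v).DAll p

/-- Normal terms: no defined symbols and no abstractions. -/
def Tm.Normal {L : Lang} : ∀ {Γ : List Ty} {τ : Ty}, Tm L Γ τ → Prop
  | _, _, .var _ => True
  | _, _, .v2 _ => True
  | _, _, .app u t => u.Normal ∧ t.Normal
  | _, _, .lam _ => False
  | _, _, .zero => True
  | _, _, .succ t => t.Normal
  | _, _, .con _ as => ∀ τ v, (as τ v).Normal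
  | _, _, .dfn _ _ _ => False

/-- Formulas.  Quantifiers range over individuals; `pr` is a constant predicate symbol and `dpr` a
defined predicate symbol. -/
inductive Fm (L : Lang) : List Ty → Type
  | pr {Γ : List Ty} (p : L.P) (as : Sub L ((L.pargs p).map Ty.base) Γ) : Fm L Γ
  | dpr {Γ : List Ty} (q : L.Q) (t : Tm L Γ Ty.nat) (as : Sub L (L.qargs q) Γ) : Fm L Γ
  | neg {Γ : List Ty} (A : Fm L Γ) : Fm L Γ
  | and {Γ : List Ty} (A B : Fm L Γ) : Fm L Γ
  | or {Γ : List Ty} (A B : Fm L Γ) : Fm L Γ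
  | imp {Γ : List Ty} (A B : Fm L Γ) : Fm L Γ
  | all {Γ : List Ty} (A : Fm L (Ty.ind :: Γ)) : Fm L Γ
  | ex {Γ : List Ty} (A : Fm L (Ty.ind :: Γ)) : Fm L Γ

def Fm.sub {L : Lang} : ∀ {Γ Δ : List Ty}, Sub L Γ Δ → Fm L Γ → Fm L Δ
  | _, _, σ, .pr p as => .pr p fun τ v => (as τ v).sub σ
  | _, _, σ, .dpr q t as => .dpr q (t.sub σ) fun τ v => (as τ v).sub σ
  | _, _, σ, .neg A => .neg (A.sub σ)
  | _, _, σ, .and A B => .and (A.sub σ) (B.sub σ)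
  | _, _, σ, .or A B => .or (A.sub σ) (B.sub σ)
  | _, _, σ, .imp A B => .imp (A.sub σ) (B.sub σ)
  | _, _, σ, .all A => .all (A.sub (σ.lift _))
  | _, _, σ, .ex A => .ex (A.sub (σ.lift _))

/-- `A(t)`. -/
def Fm.inst {L : Lang} {Γ : List Ty} (A : Fm L (Ty.ind :: Γ)) (t : Tm L Γ Ty.ind) : Fm L Γ :=
  A.sub (Sub.cons t Sub.id)

def Fm.V2Free {L : Lang} : ∀ {Γ : List Ty}, Fm L Γ → Prop
  | _, .pr _ as => ∀ τ v, (as τ v).V2Free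
  | _, .dpr _ t as => t.V2Free ∧ ∀ τ v, (as τ v).V2Free
  | _, .neg A => A.V2Free
  | _, .and A B => A.V2Free ∧ B.V2Free
  | _, .or A B => A.V2Free ∧ B.V2Free
  | _, .imp A B => A.V2Free ∧ B.V2Free
  | _, .all A => A.V2Free
  | _, .ex A => A.V2Free

def Fm.Normal {L : Lang} : ∀ {Γ : List Ty}, Fm L Γ → Prop
  | _, .pr _ as => ∀ τ v, (as τ v).Normal
  | _, .dpr _ _ _ => False
  | _, .neg A => A.Normal
  | _, .and A B => A.Normal ∧ B.Normal
  | _, .or A B => A.Normal ∧ B.Normal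
  | _, .imp A B => A.Normal ∧ B.Normal
  | _, .all A => A.Normal
  | _, .ex A => A.Normal

/-- Every defined predicate symbol of the formula satisfies `lt`, except that the recursive call
`q(y, xs)`, with exactly these arguments, is allowed as well if `rec` holds. -/
def Fm.QAll {L : Lang} (lt : L.Q → Prop) (rec : Prop) (q : L.Q) :
    ∀ {Γ : List Ty}, Tm L Γ Ty.nat → Sub L (L.qargs q) Γ → Fm L Γ → Prop
  | _, _, _, .pr _ _ => True
  | _, y, xs, .dpr q' t as => lt q' ∨ (rec ∧ Fm.dpr q' t as = Fm.dpr q y xs)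
  | _, y, xs, .neg A => A.QAll lt rec q y xs
  | _, y, xs, .and A B => A.QAll lt rec q y xs ∧ B.QAll lt rec q y xs
  | _, y, xs, .or A B => A.QAll lt rec q y xs ∧ B.QAll lt rec q y xs
  | _, y, xs, .imp A B => A.QAll lt rec q y xs ∧ B.QAll lt rec q y xs
  | _, y, xs, .all A => A.QAll lt rec q (y.weaken _) fun τ v => (xs τ v).weaken _
  | _, y, xs, .ex A => A.QAll lt rec q (y.weaken _) fun τ v => (xs τ v).weaken _

/-- The primitive recursive definitions of the defined symbols:
`d(0, xs) → dbase`, `d(s(y), xs) → dstep[d(y, xs)]`, where in `dstep` the variable number `0`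
is the hole for the recursive call, number `1` is `y`, and the rest are `xs`; and
`q(0, xs) → qbase`, `q(s(y), xs) → qstep`, where `q` occurs in `qstep` only as `q(y, xs)`. -/
structure Rules (L : Lang) where
  dlt : L.D → L.D → Prop
  dlt_wf : WellFounded dlt
  dbase : ∀ d, Tm L (L.dargs d) (Ty.base (L.dres d))
  dstep : ∀ d, Tm L (Ty.base (L.dres d) :: Ty.nat :: L.dargs d) (Ty.base (L.dres d))
  dbase_lt : ∀ d, (dbase d).DAll fun d' => dlt d' d
  dstep_lt : ∀ d, (dstep d).DAll fun d' => dlt d' d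
  dbase_v2 : ∀ d, (dbase d).V2Free
  dstep_v2 : ∀ d, (dstep d).V2Free
  qlt : L.Q → L.Q → Prop
  qlt_wf : WellFounded qlt
  qbase : ∀ q, Fm L (L.qargs q)
  qstep : ∀ q, Fm L (Ty.nat :: L.qargs q)
  qbase_lt : ∀ q, (qbase q).QAll (fun q' => qlt q' q) False q .zero Sub.id
  qstep_lt : ∀ q, (qstep q).QAll (fun q' => qlt q' q) True q (.var Var.zero)
    fun _ v => .var (Var.succ v)
  qbase_v2 : ∀ q, (qbase q).V2Free
  qstep_v2 : ∀ q, (qstep q).V2Free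

/-- Rewriting of terms in arbitrarily many steps, at arbitrary positions. -/
inductive Tm.Red {L : Lang} (E : Rules L) : ∀ {Γ : List Ty} {τ : Ty}, Tm L Γ τ → Tm L Γ τ → Prop
  | refl {Γ : List Ty} {τ : Ty} (t : Tm L Γ τ) : Red E t t
  | trans {Γ : List Ty} {τ : Ty} {t u w : Tm L Γ τ} : Red E t u → Red E u w → Red E t w
  | app {Γ : List Ty} {u u' : Tm L Γ Ty.seq} {t t' : Tm L Γ Ty.nat} :
      Red E u u' → Red E t t' → Red E (.app u t) (.app u' t')
  | lam {Γ : List Ty} {t t' : Tm L (Ty.nat :: Γ) Ty.ind} : Red E t t' → Red E (.lam t) (.lam t')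
  | succ {Γ : List Ty} {t t' : Tm L Γ Ty.nat} : Red E t t' → Red E (.succ t) (.succ t')
  | con {Γ : List Ty} (f : L.F) {as bs : Sub L ((L.fargs f).map Ty.base) Γ} :
      (∀ τ v, Red E (as τ v) (bs τ v)) → Red E (.con f as) (.con f bs)
  | dfn {Γ : List Ty} (d : L.D) {t t' : Tm L Γ Ty.nat} {as bs : Sub L (L.dargs d) Γ} :
      Red E t t' → (∀ τ v, Red E (as τ v) (bs τ v)) → Red E (.dfn d t as) (.dfn d t' bs)
  | beta {Γ : List Ty} (t : Tm L (Ty.nat :: Γ) Ty.ind) (s : Tm L Γ Ty.nat) :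
      Red E (.app (.lam t) s) (t.sub (Sub.cons s Sub.id))
  | dzero {Γ : List Ty} (d : L.D) (as : Sub L (L.dargs d) Γ) :
      Red E (.dfn d .zero as) ((E.dbase d).sub as)
  | dsucc {Γ : List Ty} (d : L.D) (t : Tm L Γ Ty.nat) (as : Sub L (L.dargs d) Γ) :
      Red E (.dfn d (.succ t) as) ((E.dstep d).sub (Sub.cons (.dfn d t as) (Sub.cons t as)))

/-- Rewriting of formulas in arbitrarily many steps. -/
inductive Fm.Red {L : Lang} (E : Rules L) : ∀ {Γ : List Ty}, Fm L Γ → Fm L Γ → Prop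
  | refl {Γ : List Ty} (A : Fm L Γ) : Red E A A
  | trans {Γ : List Ty} {A B C : Fm L Γ} : Red E A B → Red E B C → Red E A C
  | pr {Γ : List Ty} (p : L.P) {as bs : Sub L ((L.pargs p).map Ty.base) Γ} :
      (∀ τ v, (as τ v).Red E (bs τ v)) → Red E (.pr p as) (.pr p bs)
  | dpr {Γ : List Ty} (q : L.Q) {t t' : Tm L Γ Ty.nat} {as bs : Sub L (L.qargs q) Γ} :
      t.Red E t' → (∀ τ v, (as τ v).Red E (bs τ v)) → Red E (.dpr q t as) (.dpr q t' bs)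
  | neg {Γ : List Ty} {A A' : Fm L Γ} : Red E A A' → Red E (.neg A) (.neg A')
  | and {Γ : List Ty} {A A' B B' : Fm L Γ} :
      Red E A A' → Red E B B' → Red E (.and A B) (.and A' B')
  | or {Γ : List Ty} {A A' B B' : Fm L Γ} :
      Red E A A' → Red E B B' → Red E (.or A B) (.or A' B')
  | imp {Γ : List Ty} {A A' B B' : Fm L Γ} :
      Red E A A' → Red E B B' → Red E (.imp A B) (.imp A' B')
  | all {Γ : List Ty} {A A' : Fm L (Ty.ind :: Γ)} : Red E A A' → Red E (.all A) (.all A')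
  | ex {Γ : List Ty} {A A' : Fm L (Ty.ind :: Γ)} : Red E A A' → Red E (.ex A) (.ex A')
  | qzero {Γ : List Ty} (q : L.Q) (as : Sub L (L.qargs q) Γ) :
      Red E (.dpr q .zero as) ((E.qbase q).sub as)
  | qsucc {Γ : List Ty} (q : L.Q) (t : Tm L Γ Ty.nat) (as : Sub L (L.qargs q) Γ) :
      Red E (.dpr q (.succ t) as) ((E.qstep q).sub (Sub.cons t as))

/-- Equality modulo the rewrite rules read as equations. -/
def Tm.EqE {L : Lang} (E : Rules L) {Γ : List Ty} {τ : Ty} : Tm L Γ τ → Tm L Γ τ → Prop :=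
  Relation.EqvGen (Tm.Red E)

def Fm.EqE {L : Lang} (E : Rules L) {Γ : List Ty} : Fm L Γ → Fm L Γ → Prop :=
  Relation.EqvGen (Fm.Red E)

open Classical in
/-- The normal form `t↓`. -/
noncomputable def Tm.nf {L : Lang} (E : Rules L) {Γ : List Ty} {τ : Ty} (t : Tm L Γ τ) :
    Tm L Γ τ :=
  if h : ∃ t', t.Red E t' ∧ t'.Normal then h.choose else t

open Classical in
/-- The normal form `A↓`. -/
noncomputable def Fm.nf {L : Lang} (E : Rules L) {Γ : List Ty} (A : Fm L Γ) : Fm L Γ :=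
  if h : ∃ A', A.Red E A' ∧ A'.Normal then h.choose else A

/-- The individual variable `x(s)` occurs: as `x(s')` with `s'` equal to `s` modulo the rules, or
through an occurrence of the whole sequence `x` as an argument. -/
def Tm.Occ {L : Lang} (E : Rules L) (x : L.V) :
    ∀ {Γ : List Ty} {τ : Ty}, Tm L Γ Ty.nat → Tm L Γ τ → Prop
  | _, _, _, .var _ => False
  | _, _, _, .v2 y => y = x
  | _, _, s, .app u t =>
      (u = .v2 x ∧ Tm.EqE E s t) ∨ (u ≠ .v2 x ∧ Tm.Occ E x s u) ∨ Tm.Occ E x s t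
  | _, _, s, .lam t => Tm.Occ E x (s.weaken _) t
  | _, _, _, .zero => False
  | _, _, s, .succ t => Tm.Occ E x s t
  | _, _, s, .con _ as => ∃ τ v, Tm.Occ E x s (as τ v)
  | _, _, s, .dfn _ t as => Tm.Occ E x s t ∨ ∃ τ v, Tm.Occ E x s (as τ v)

def Fm.Occ {L : Lang} (E : Rules L) (x : L.V) :
    ∀ {Γ : List Ty}, Tm L Γ Ty.nat → Fm L Γ → Prop
  | _, s, .pr _ as => ∃ τ v, Tm.Occ E x s (as τ v)
  | _, s, .dpr _ t as => Tm.Occ E x s t ∨ ∃ τ v, Tm.Occ E x s (as τ v)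
  | _, s, .neg A => A.Occ E x s
  | _, s, .and A B => A.Occ E x s ∨ B.Occ E x s
  | _, s, .or A B => A.Occ E x s ∨ B.Occ E x s
  | _, s, .imp A B => A.Occ E x s ∨ B.Occ E x s
  | _, s, .all A => A.Occ E x (s.weaken _)
  | _, s, .ex A => A.Occ E x (s.weaken _)

/-- `A.NoStrong pos`: the formula, at positive (`pos = true`, e.g. in the succedent) or negative
polarity, contains no strong quantifier. -/
def Fm.NoStrong {L : Lang} : ∀ {Γ : List Ty}, Fm L Γ → Bool → Prop
  | _, .pr _ _, _ => True
  | _, .dpr _ _ _, _ => True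
  | _, .neg A, b => A.NoStrong (!b)
  | _, .and A B, b => A.NoStrong b ∧ B.NoStrong b
  | _, .or A B, b => A.NoStrong b ∧ B.NoStrong b
  | _, .imp A B, b => A.NoStrong (!b) ∧ B.NoStrong b
  | _, .all A, b => b = false ∧ A.NoStrong b
  | _, .ex A, b => b = true ∧ A.NoStrong b

/-- Substitution of sequences for the second-order variables. -/
def Tm.vsub {L : Lang} : ∀ {Γ : List Ty} {τ : Ty}, (L.V → Tm L Γ Ty.seq) → Tm L Γ τ → Tm L Γ τ
  | _, _, _, .var v => .var v
  | _, _, θ, .v2 x => θ x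
  | _, _, θ, .app u t => .app (u.vsub θ) (t.vsub θ)
  | _, _, θ, .lam t => .lam (t.vsub fun x => (θ x).weaken _)
  | _, _, _, .zero => .zero
  | _, _, θ, .succ t => .succ (t.vsub θ)
  | _, _, θ, .con f as => .con f fun τ v => (as τ v).vsub θ
  | _, _, θ, .dfn d t as => .dfn d (t.vsub θ) fun τ v => (as τ v).vsub θ

/-- A substitution for the individual variables `x(0), x(1), ...`. -/
abbrev PSub (L : Lang) : Type := L.V → ℕ → Tm L [] Ty.ind

def Tm.num? {L : Lang} : ∀ {Γ : List Ty} {τ : Ty}, Tm L Γ τ → Option ℕ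
  | _, _, .zero => some 0
  | _, _, .succ t => t.num?.map (· + 1)
  | _, _, _ => none

def Tm.name? {L : Lang} : ∀ {Γ : List Ty} {τ : Ty}, Tm L Γ τ → Option L.V
  | _, _, .v2 x => some x
  | _, _, _ => none

/-- Replace each `x(n)`, `n` a numeral, by `σ x n`. -/
def Tm.psub {L : Lang} (σ : PSub L) : ∀ {Γ : List Ty} {τ : Ty}, Tm L Γ τ → Tm L Γ τ
  | _, _, .var v => .var v
  | _, _, .v2 x => .v2 x
  | _, _, .app u t =>
      match u.name?, t.num? with
      | some x, some n => (σ x n).ren Ren.empty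
      | _, _ => .app (u.psub σ) (t.psub σ)
  | _, _, .lam t => .lam (t.psub σ)
  | _, _, .zero => .zero
  | _, _, .succ t => .succ (t.psub σ)
  | _, _, .con f as => .con f fun τ v => (as τ v).psub σ
  | _, _, .dfn d t as => .dfn d (t.psub σ) fun τ v => (as τ v).psub σ

def Fm.psub {L : Lang} (σ : PSub L) : ∀ {Γ : List Ty}, Fm L Γ → Fm L Γ
  | _, .pr p as => .pr p fun τ v => (as τ v).psub σ
  | _, .dpr q t as => .dpr q (t.psub σ) fun τ v => (as τ v).psub σ
  | _, .neg A => .neg (A.psub σ)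
  | _, .and A B => .and (A.psub σ) (B.psub σ)
  | _, .or A B => .or (A.psub σ) (B.psub σ)
  | _, .imp A B => .imp (A.psub σ) (B.psub σ)
  | _, .all A => .all (A.psub σ)
  | _, .ex A => .ex (A.psub σ)

/-- `σ` maps all individual variables to ground (closed, variable-free) normal terms. -/
def PSub.Ground {L : Lang} (σ : PSub L) : Prop :=
  ∀ x n, (σ x n).V2Free ∧ (σ x n).Normal

/-- A uniform operation on terms and formulas. -/
structure Tr (L : Lang) (Γ Δ : List Ty) where
  tm : ∀ {τ : Ty}, Tm L Γ τ → Tm L Δ τ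
  fm : Fm L Γ → Fm L Δ
  fmI : Fm L (Ty.ind :: Γ) → Fm L (Ty.ind :: Δ)

def Tr.sub {L : Lang} {Γ Δ : List Ty} (σ : Sub L Γ Δ) : Tr L Γ Δ :=
  ⟨fun t => t.sub σ, fun A => A.sub σ, fun A => A.sub (σ.lift _)⟩

noncomputable def Tr.nf {L : Lang} (E : Rules L) {Γ : List Ty} : Tr L Γ Γ :=
  ⟨fun t => t.nf E, fun A => A.nf E, fun A => A.nf E⟩

def Tr.psub {L : Lang} (σ : PSub L) {Γ : List Ty} : Tr L Γ Γ :=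
  ⟨fun t => t.psub σ, fun A => A.psub σ, fun A => A.psub σ⟩

/-! ## Atoms, clauses and sequents -/

/-- Atomic formulas (of constant predicate symbols). -/
structure Atm (L : Lang) (Γ : List Ty) where
  p : L.P
  as : Sub L ((L.pargs p).map Ty.base) Γ

def Atm.toFm {L : Lang} {Γ : List Ty} (A : Atm L Γ) : Fm L Γ := .pr A.p A.as

def Atm.map {L : Lang} {Γ Δ : List Ty} (f : ∀ {τ : Ty}, Tm L Γ τ → Tm L Δ τ) (A : Atm L Γ) :
    Atm L Δ := ⟨A.p, fun τ v => f (A.as τ v)⟩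

def Atm.V2Free {L : Lang} {Γ : List Ty} (A : Atm L Γ) : Prop := ∀ τ v, (A.as τ v).V2Free

structure Clause (L : Lang) (Γ : List Ty) where
  ant : List (Atm L Γ)
  suc : List (Atm L Γ)

def Clause.map {L : Lang} {Γ Δ : List Ty} (f : ∀ {τ : Ty}, Tm L Γ τ → Tm L Δ τ)
    (C : Clause L Γ) : Clause L Δ := ⟨C.ant.map (Atm.map f), C.suc.map (Atm.map f)⟩

/-- The merge `C ∘ D`. -/
def Clause.comp {L : Lang} {Γ : List Ty} (C D : Clause L Γ) : Clause L Γ :=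
  ⟨C.ant ++ D.ant, C.suc ++ D.suc⟩

/-- Equality of clauses as pairs of multisets. -/
def Clause.Same {L : Lang} {Γ : List Ty} (C D : Clause L Γ) : Prop :=
  C.ant.Perm D.ant ∧ C.suc.Perm D.suc

def Clause.V2Free {L : Lang} {Γ : List Ty} (C : Clause L Γ) : Prop :=
  (∀ A ∈ C.ant, A.V2Free) ∧ (∀ A ∈ C.suc, A.V2Free)

/-- Sequents.  The positions in the two lists are the formula occurrences; sequents count as pairs
of multisets, so the order is changed freely by the exchange moves `frontL`, `frontR` below. -/
structure Seq (L : Lang) (Γ : List Ty) where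
  ant : List (Fm L Γ)
  suc : List (Fm L Γ)

def Seq.map {L : Lang} {Γ Δ : List Ty} (T : Tr L Γ Δ) (s : Seq L Γ) : Seq L Δ :=
  ⟨s.ant.map T.fm, s.suc.map T.fm⟩

def Seq.comp {L : Lang} {Γ : List Ty} (s s' : Seq L Γ) : Seq L Γ :=
  ⟨s.ant ++ s'.ant, s.suc ++ s'.suc⟩

/-- Equality of sequents as pairs of multisets. -/
def Seq.Same {L : Lang} {Γ : List Ty} (s s' : Seq L Γ) : Prop :=
  s.ant.Perm s'.ant ∧ s.suc.Perm s'.suc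

def Seq.V2Free {L : Lang} {Γ : List Ty} (s : Seq L Γ) : Prop :=
  (∀ A ∈ s.ant, A.V2Free) ∧ (∀ A ∈ s.suc, A.V2Free)

def Seq.NoStrong {L : Lang} {Γ : List Ty} (s : Seq L Γ) : Prop :=
  (∀ A ∈ s.ant, A.NoStrong false) ∧ (∀ A ∈ s.suc, A.NoStrong true)

def Clause.toSeq {L : Lang} {Γ : List Ty} (C : Clause L Γ) : Seq L Γ :=
  ⟨C.ant.map Atm.toFm, C.suc.map Atm.toFm⟩

/-! ## The calculus -/

/-- Unary rules.  Auxiliary and principal formulas stand at the front of their side. In `allR` and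
`exL` the eigenvariable is `x(t)`; `eqv s` is the equality rule with conclusion `s`; `frontL i` and
`frontR i` are the exchange moves that bring the occurrence at position `i` to the front. -/
inductive URule (L : Lang) (Γ : List Ty)
  | negL (A : Fm L Γ)
  | negR (A : Fm L Γ)
  | andL1 (A B : Fm L Γ)
  | andL2 (A B : Fm L Γ)
  | orR1 (A B : Fm L Γ)
  | orR2 (A B : Fm L Γ)
  | impR (A B : Fm L Γ)
  | allL (A : Fm L (Ty.ind :: Γ)) (t : Tm L Γ Ty.ind)
  | allR (A : Fm L (Ty.ind :: Γ)) (x : L.V) (t : Tm L Γ Ty.nat)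
  | exL (A : Fm L (Ty.ind :: Γ)) (x : L.V) (t : Tm L Γ Ty.nat)
  | exR (A : Fm L (Ty.ind :: Γ)) (t : Tm L Γ Ty.ind)
  | wL (A : Fm L Γ)
  | wR (A : Fm L Γ)
  | cL (A : Fm L Γ)
  | cR (A : Fm L Γ)
  | eqv (s : Seq L Γ)
  | frontL (i : ℕ)
  | frontR (i : ℕ)

inductive BRule (L : Lang) (Γ : List Ty)
  | andR (A B : Fm L Γ)
  | orL (A B : Fm L Γ)
  | impL (A B : Fm L Γ)
  | cut (A : Fm L Γ)

def toFront {α : Type} (i : ℕ) (l : List α) : List α := (l[i]?).toList ++ l.eraseIdx i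

/-- The inverse of `toFront i`. -/
def fromFront {α : Type} (i : ℕ) (l : List α) : List α :=
  match l with
  | [] => []
  | a :: l => l.insertIdx i a

/-- The conclusion of a unary rule, given the premise. -/
def URule.concl {L : Lang} {Γ : List Ty} : URule L Γ → Seq L Γ → Seq L Γ
  | .negL A, s => ⟨.neg A :: s.ant, s.suc.tail⟩
  | .negR A, s => ⟨s.ant.tail, .neg A :: s.suc⟩
  | .andL1 A B, s => ⟨.and A B :: s.ant.tail, s.suc⟩
  | .andL2 A B, s => ⟨.and A B :: s.ant.tail, s.suc⟩
  | .orR1 A B, s => ⟨s.ant, .or A B :: s.suc.tail⟩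
  | .orR2 A B, s => ⟨s.ant, .or A B :: s.suc.tail⟩
  | .impR A B, s => ⟨s.ant.tail, .imp A B :: s.suc.tail⟩
  | .allL A _, s => ⟨.all A :: s.ant.tail, s.suc⟩
  | .allR A _ _, s => ⟨s.ant, .all A :: s.suc.tail⟩
  | .exL A _ _, s => ⟨.ex A :: s.ant.tail, s.suc⟩
  | .exR A _, s => ⟨s.ant, .ex A :: s.suc.tail⟩
  | .wL A, s => ⟨A :: s.ant, s.suc⟩
  | .wR A, s => ⟨s.ant, A :: s.suc⟩
  | .cL _, s => ⟨s.ant.tail, s.suc⟩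
  | .cR _, s => ⟨s.ant, s.suc.tail⟩
  | .eqv s', _ => s'
  | .frontL i, s => ⟨toFront i s.ant, s.suc⟩
  | .frontR i, s => ⟨s.ant, toFront i s.suc⟩

/-- The rule is applicable to the premise. -/
def URule.OK {L : Lang} (E : Rules L) {Γ : List Ty} : URule L Γ → Seq L Γ → Prop
  | .negL A, s => ∃ l, s.suc = A :: l
  | .negR A, s => ∃ l, s.ant = A :: l
  | .andL1 A _, s => ∃ l, s.ant = A :: l
  | .andL2 _ B, s => ∃ l, s.ant = B :: l
  | .orR1 A _, s => ∃ l, s.suc = A :: l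
  | .orR2 _ B, s => ∃ l, s.suc = B :: l
  | .impR A B, s => (∃ l, s.ant = A :: l) ∧ ∃ l, s.suc = B :: l
  | .allL A t, s => ∃ l, s.ant = A.inst t :: l
  | .allR A x t, s => ∃ l, s.suc = A.inst (.app (.v2 x) t) :: l ∧
      ¬ A.Occ E x (t.weaken _) ∧ (∀ B ∈ s.ant, ¬ B.Occ E x t) ∧ ∀ B ∈ l, ¬ B.Occ E x t
  | .exL A x t, s => ∃ l, s.ant = A.inst (.app (.v2 x) t) :: l ∧
      ¬ A.Occ E x (t.weaken _) ∧ (∀ B ∈ l, ¬ B.Occ E x t) ∧ ∀ B ∈ s.suc, ¬ B.Occ E x t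
  | .exR A t, s => ∃ l, s.suc = A.inst t :: l
  | .wL _, _ => True
  | .wR _, _ => True
  | .cL A, s => ∃ l, s.ant = A :: A :: l
  | .cR A, s => ∃ l, s.suc = A :: A :: l
  | .eqv s', s => List.Forall₂ (Fm.EqE E) s.ant s'.ant ∧ List.Forall₂ (Fm.EqE E) s.suc s'.suc
  | .frontL i, s => i < s.ant.length
  | .frontR i, s => i < s.suc.length

def BRule.concl {L : Lang} {Γ : List Ty} : BRule L Γ → Seq L Γ → Seq L Γ → Seq L Γ
  | .andR A B, s, s' => ⟨s.ant ++ s'.ant, .and A B :: (s.suc.tail ++ s'.suc.tail)⟩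
  | .orL A B, s, s' => ⟨.or A B :: (s.ant.tail ++ s'.ant.tail), s.suc ++ s'.suc⟩
  | .impL A B, s, s' => ⟨.imp A B :: (s.ant ++ s'.ant.tail), s.suc.tail ++ s'.suc⟩
  | .cut _, s, s' => ⟨s.ant ++ s'.ant.tail, s.suc.tail ++ s'.suc⟩

def BRule.OK {L : Lang} {Γ : List Ty} : BRule L Γ → Seq L Γ → Seq L Γ → Prop
  | .andR A B, s, s' => (∃ l, s.suc = A :: l) ∧ ∃ l, s'.suc = B :: l
  | .orL A B, s, s' => (∃ l, s.ant = A :: l) ∧ ∃ l, s'.ant = B :: l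
  | .impL A B, s, s' => (∃ l, s.suc = A :: l) ∧ ∃ l, s'.ant = B :: l
  | .cut A, s, s' => (∃ l, s.suc = A :: l) ∧ ∃ l, s'.ant = A :: l

def URule.map {L : Lang} {Γ Δ : List Ty} (T : Tr L Γ Δ) : URule L Γ → URule L Δ
  | .negL A => .negL (T.fm A)
  | .negR A => .negR (T.fm A)
  | .andL1 A B => .andL1 (T.fm A) (T.fm B)
  | .andL2 A B => .andL2 (T.fm A) (T.fm B)
  | .orR1 A B => .orR1 (T.fm A) (T.fm B)
  | .orR2 A B => .orR2 (T.fm A) (T.fm B)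
  | .impR A B => .impR (T.fm A) (T.fm B)
  | .allL A t => .allL (T.fmI A) (T.tm t)
  | .allR A x t => .allR (T.fmI A) x (T.tm t)
  | .exL A x t => .exL (T.fmI A) x (T.tm t)
  | .exR A t => .exR (T.fmI A) (T.tm t)
  | .wL A => .wL (T.fm A)
  | .wR A => .wR (T.fm A)
  | .cL A => .cL (T.fm A)
  | .cR A => .cR (T.fm A)
  | .eqv s => .eqv (s.map T)
  | .frontL i => .frontL i
  | .frontR i => .frontR i

def BRule.map {L : Lang} {Γ Δ : List Ty} (T : Tr L Γ Δ) : BRule L Γ → BRule L Δ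
  | .andR A B => .andR (T.fm A) (T.fm B)
  | .orL A B => .orL (T.fm A) (T.fm B)
  | .impL A B => .impL (T.fm A) (T.fm B)
  | .cut A => .cut (T.fm A)

/-- The rule data contain no second-order variable. -/
def URule.V2Free {L : Lang} {Γ : List Ty} : URule L Γ → Prop
  | .negL A => A.V2Free
  | .negR A => A.V2Free
  | .andL1 A B => A.V2Free ∧ B.V2Free
  | .andL2 A B => A.V2Free ∧ B.V2Free
  | .orR1 A B => A.V2Free ∧ B.V2Free
  | .orR2 A B => A.V2Free ∧ B.V2Free
  | .impR A B => A.V2Free ∧ B.V2Free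
  | .allL A t => A.V2Free ∧ t.V2Free
  | .allR _ _ _ => False
  | .exL _ _ _ => False
  | .exR A t => A.V2Free ∧ t.V2Free
  | .wL A => A.V2Free
  | .wR A => A.V2Free
  | .cL A => A.V2Free
  | .cR A => A.V2Free
  | .eqv s => s.V2Free
  | .frontL _ => True
  | .frontR _ => True

def BRule.V2Free {L : Lang} {Γ : List Ty} : BRule L Γ → Prop
  | .andR A B => A.V2Free ∧ B.V2Free
  | .orL A B => A.V2Free ∧ B.V2Free
  | .impL A B => A.V2Free ∧ B.V2Free
  | .cut A => A.V2Free

/-- Proof symbols `0, ..., m` with their argument types and end-sequents `S(n, xs)`; in the context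
of an end-sequent the variable number `0` is `n`. -/
structure ProofSyms (L : Lang) where
  m : ℕ
  params : Fin (m + 1) → List Ty
  endSeq : ∀ j, Seq L (Ty.nat :: params j)

/-- Derivations with axioms `A ⊢ A` (`A` atomic) and proof links at the leaves. -/
inductive Pf (L : Lang) (K : ProofSyms L) (Γ : List Ty)
  | ax (A : Atm L Γ)
  | link (j : Fin (K.m + 1)) (a : Tm L Γ Ty.nat) (as : Sub L (K.params j) Γ)
  | un (r : URule L Γ) (π : Pf L K Γ)
  | bin (r : BRule L Γ) (π₁ π₂ : Pf L K Γ)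

/-- The end-sequent. -/
def Pf.concl {L : Lang} {K : ProofSyms L} {Γ : List Ty} : Pf L K Γ → Seq L Γ
  | .ax A => ⟨[A.toFm], [A.toFm]⟩
  | .link j a as => (K.endSeq j).map (Tr.sub (Sub.cons a as))
  | .un r π => r.concl π.concl
  | .bin r π₁ π₂ => r.concl π₁.concl π₂.concl

/-- All inferences are correct, i.e. the tree is a proof (possibly with proof links). -/
def Pf.Valid {L : Lang} (E : Rules L) {K : ProofSyms L} {Γ : List Ty} : Pf L K Γ → Prop
  | .ax _ => True
  | .link _ _ _ => True
  | .un r π => π.Valid E ∧ r.OK E π.concl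
  | .bin r π₁ π₂ => π₁.Valid E ∧ π₂.Valid E ∧ r.OK π₁.concl π₂.concl

/-- All proof links `(ψ_j(a, ...))` satisfy `p j a`. -/
def Pf.Links {L : Lang} {K : ProofSyms L} {Γ : List Ty}
    (p : Fin (K.m + 1) → Tm L Γ Ty.nat → Prop) : Pf L K Γ → Prop
  | .ax _ => True
  | .link j a _ => p j a
  | .un _ π => π.Links p
  | .bin _ π₁ π₂ => π₁.Links p ∧ π₂.Links p

/-- No variables occur (used for closed contexts) and there are no proof links. -/
def Pf.Ground {L : Lang} {K : ProofSyms L} : Pf L K [] → Prop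
  | .ax A => A.V2Free
  | .link _ _ _ => False
  | .un r π => r.V2Free ∧ π.Ground
  | .bin r π₁ π₂ => r.V2Free ∧ π₁.Ground ∧ π₂.Ground

/-- All cut formulas are atomic. -/
def Pf.AtomicCuts {L : Lang} {K : ProofSyms L} {Γ : List Ty} : Pf L K Γ → Prop
  | .ax _ => True
  | .link _ _ _ => True
  | .un _ π => π.AtomicCuts
  | .bin r π₁ π₂ =>
      (∀ A, r = .cut A → ∃ P : Atm L Γ, A = P.toFm) ∧ π₁.AtomicCuts ∧ π₂.AtomicCuts

def URule.cost {L : Lang} {Γ : List Ty} : URule L Γ → ℕ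
  | .frontL _ => 0
  | .frontR _ => 0
  | _ => 1

/-- The number of inferences (axioms included); exchange moves are not inferences. -/
def Pf.size {L : Lang} {K : ProofSyms L} {Γ : List Ty} : Pf L K Γ → ℕ
  | .ax _ => 1
  | .link _ _ _ => 1
  | .un r π => π.size + r.cost
  | .bin _ π₁ π₂ => π₁.size + π₂.size + 1

def Pf.map {L : Lang} {K : ProofSyms L} {Γ Δ : List Ty} (T : Tr L Γ Δ) : Pf L K Γ → Pf L K Δ
  | .ax A => .ax (A.map T.tm)
  | .link j a as => .link j (T.tm a) fun τ v => T.tm (as τ v)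
  | .un r π => .un (r.map T) (π.map T)
  | .bin r π₁ π₂ => .bin (r.map T) (π₁.map T) (π₂.map T)

/-! ## Proof schemata -/

/-- Proof schemata.  In `step j` the variable number `0` is `k`.  The occurrences in the
end-sequents of `base j` and `step j` are identified by their positions. -/
structure ProofSchema (L : Lang) (E : Rules L) where
  K : ProofSyms L
  base : ∀ j, Pf L K (K.params j)
  step : ∀ j, Pf L K (Ty.nat :: K.params j)
  base_valid : ∀ j, (base j).Valid E
  step_valid : ∀ j, (step j).Valid E
  base_concl : ∀ j, (base j).concl = (K.endSeq j).map (Tr.sub (Sub.cons .zero Sub.id))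
  step_concl : ∀ j, (step j).concl = (K.endSeq j).map
    (Tr.sub (Sub.cons (.succ (.var Var.zero)) fun _ v => .var (Var.succ v)))
  base_links : ∀ j, (base j).Links fun j' a =>
    j < j' ∧ ∃ a₀ : Tm L [] Ty.nat, a₀.V2Free ∧ a = a₀.ren Ren.empty
  step_links : ∀ j, (step j).Links fun j' a =>
    (j' = j ∧ a = .var Var.zero) ∨
    (j < j' ∧ ∃ a₀ : Tm L [Ty.nat] Ty.nat, a₀.V2Free ∧ a = a₀.ren (Ren.lift _ Ren.empty))

/-- The empty tuple of arguments. -/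
def noArgs {L : Lang} {Γ Δ : List Ty} (h : Γ = []) : Sub L Γ Δ :=
  fun _ v => by subst h; exact nomatch v

/-- `S(α)`, where `S(n)` is the end-sequent of the schema (no further parameters). -/
def ProofSchema.seqAt {L : Lang} {E : Rules L} (Ψ : ProofSchema L E) (h : Ψ.K.params 0 = [])
    (α : ℕ) : Seq L [] :=
  (Ψ.K.endSeq 0).map (Tr.sub (Sub.cons (Tm.num α) (noArgs h)))

/-! ## Characteristic terms and projection terms -/

/-- A set of formula occurrences of a sequent, as a pair of characteristic lists. Used for
configurations, and inside a proof for the set of all configuration- or cut-ancestors. -/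
structure Config where
  ant : List Bool
  suc : List Bool

/-- The marked occurrences of the premise, given those of the conclusion. -/
def URule.up {L : Lang} {Γ : List Ty} : URule L Γ → Config → Config
  | .negL _, c => ⟨c.ant.tail, c.ant.headD false :: c.suc⟩
  | .negR _, c => ⟨c.suc.headD false :: c.ant, c.suc.tail⟩
  | .impR _ _, c => ⟨c.suc.headD false :: c.ant, c.suc⟩
  | .wL _, c => ⟨c.ant.tail, c.suc⟩
  | .wR _, c => ⟨c.ant, c.suc.tail⟩
  | .cL _, c => ⟨c.ant.headD false :: c.ant, c.suc⟩
  | .cR _, c => ⟨c.ant, c.suc.headD false :: c.suc⟩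
  | .frontL i, c => ⟨fromFront i c.ant, c.suc⟩
  | .frontR i, c => ⟨c.ant, fromFront i c.suc⟩
  | _, c => c

/-- Is the rule omitted in projections?  So are the equality rule, exchange moves, and all rules
whose principal formula is marked. -/
def URule.skip {L : Lang} {Γ : List Ty} : URule L Γ → Config → Bool
  | .negL _, c => c.ant.headD false
  | .negR _, c => c.suc.headD false
  | .andL1 _ _, c => c.ant.headD false
  | .andL2 _ _, c => c.ant.headD false
  | .orR1 _ _, c => c.suc.headD false
  | .orR2 _ _, c => c.suc.headD false
  | .impR _ _, c => c.suc.headD false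
  | .allL _ _, c => c.ant.headD false
  | .allR _ _ _, c => c.suc.headD false
  | .exL _ _ _, c => c.ant.headD false
  | .exR _ _, c => c.suc.headD false
  | .wL _, c => c.ant.headD false
  | .wR _, c => c.suc.headD false
  | .cL _, c => c.ant.headD false
  | .cR _, c => c.suc.headD false
  | .eqv _, _ => true
  | .frontL _, _ => true
  | .frontR _, _ => true

/-- The mark of the auxiliary formulas of a binary rule; cut formulas are always marked. -/
def BRule.marked {L : Lang} {Γ : List Ty} : BRule L Γ → Config → Bool
  | .andR _ _, c => c.suc.headD false
  | .orL _ _, c => c.ant.headD false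
  | .impL _ _, c => c.ant.headD false
  | .cut _, _ => true

/-- The marked occurrences of the left premise `s` (given as second argument). -/
def BRule.upLeft {L : Lang} {Γ : List Ty} : BRule L Γ → Seq L Γ → Config → Config
  | .andR _ _, s, c =>
      ⟨c.ant.take s.ant.length, c.suc.headD false :: c.suc.tail.take s.suc.tail.length⟩
  | .orL _ _, s, c =>
      ⟨c.ant.headD false :: c.ant.tail.take s.ant.tail.length, c.suc.take s.suc.length⟩
  | .impL _ _, s, c =>
      ⟨c.ant.tail.take s.ant.length, c.ant.headD false :: c.suc.take s.suc.tail.length⟩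
  | .cut _, s, c => ⟨c.ant.take s.ant.length, true :: c.suc.take s.suc.tail.length⟩

/-- The marked occurrences of the right premise; the second argument is the left premise. -/
def BRule.upRight {L : Lang} {Γ : List Ty} : BRule L Γ → Seq L Γ → Config → Config
  | .andR _ _, s, c =>
      ⟨c.ant.drop s.ant.length, c.suc.headD false :: c.suc.tail.drop s.suc.tail.length⟩
  | .orL _ _, s, c =>
      ⟨c.ant.headD false :: c.ant.tail.drop s.ant.tail.length, c.suc.drop s.suc.length⟩
  | .impL _ _, s, c =>
      ⟨c.ant.headD false :: c.ant.tail.drop s.ant.length, c.suc.drop s.suc.tail.length⟩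
  | .cut _, s, c => ⟨true :: c.ant.drop s.ant.length, c.suc.drop s.suc.tail.length⟩

/-- The elements of `l` that are marked `b`. -/
def pick {α : Type} (b : Bool) (l : List α) (m : List Bool) : List α :=
  (l.zip m).filterMap fun x => if x.2 = b then some x.1 else none

/-- The subsequent of the unmarked occurrences (the ancestors of the end-sequent that do not belong
to the configuration). -/
def Seq.unmarked {L : Lang} {Γ : List Ty} (s : Seq L Γ) (c : Config) : Seq L Γ :=
  ⟨pick false s.ant c.ant, pick false s.suc c.suc⟩

/-- Clause-set terms over the clause-set symbols `cl^{ψ_j, Ω}`. -/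
inductive CST (L : Lang) (K : ProofSyms L) (Γ : List Ty)
  | cls (C : Clause L Γ)
  | sym (j : Fin (K.m + 1)) (Ω : Config) (a : Tm L Γ Ty.nat) (as : Sub L (K.params j) Γ)
  | plus (t₁ t₂ : CST L K Γ)
  | times (t₁ t₂ : CST L K Γ)

/-- The characteristic term `Θ(π, Ω)`. -/
def Pf.char {L : Lang} {K : ProofSyms L} {Γ : List Ty} : Pf L K Γ → Config → CST L K Γ
  | .ax A, c => .cls ⟨pick true [A] c.ant, pick true [A] c.suc⟩
  | .link j a as, c => .sym j c a as
  | .un r π, c => π.char (r.up c)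
  | .bin r π₁ π₂, c =>
      let t₁ := π₁.char (r.upLeft π₁.concl c)
      let t₂ := π₂.char (r.upRight π₁.concl c)
      if r.marked c then .plus t₁ t₂ else .times t₁ t₂

def CST.map {L : Lang} {K : ProofSyms L} {Γ Δ : List Ty} (f : ∀ {τ : Ty}, Tm L Γ τ → Tm L Δ τ) :
    CST L K Γ → CST L K Δ
  | .cls C => .cls (C.map f)
  | .sym j Ω a as => .sym j Ω (f a) fun τ v => f (as τ v)
  | .plus t₁ t₂ => .plus (t₁.map f) (t₂.map f)
  | .times t₁ t₂ => .times (t₁.map f) (t₂.map f)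

/-- Evaluation of a clause-set term to its normal form under the rules
`cl^{ψ_j,Ω}(0, xs) → Θ(π_j, Ω)`, `cl^{ψ_j,Ω}(s(k), xs) → Θ(ν_j(k), Ω)` and the rules of the
language. -/
inductive CST.Eval {L : Lang} {E : Rules L} (Ψ : ProofSchema L E) :
    CST L Ψ.K [] → CST L Ψ.K [] → Prop
  | cls (C : Clause L []) : Eval Ψ (.cls C) (.cls (C.map fun t => t.nf E))
  | plus {t₁ t₂ u₁ u₂ : CST L Ψ.K []} :
      Eval Ψ t₁ u₁ → Eval Ψ t₂ u₂ → Eval Ψ (.plus t₁ t₂) (.plus u₁ u₂)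
  | times {t₁ t₂ u₁ u₂ : CST L Ψ.K []} :
      Eval Ψ t₁ u₁ → Eval Ψ t₂ u₂ → Eval Ψ (.times t₁ t₂) (.times u₁ u₂)
  | symZero (j : Fin (Ψ.K.m + 1)) (Ω : Config) (a : Tm L [] Ty.nat)
      (as : Sub L (Ψ.K.params j) []) (u : CST L Ψ.K []) : a.nf E = Tm.num 0 →
      Eval Ψ (((Ψ.base j).char Ω).map fun t => t.sub as) u → Eval Ψ (.sym j Ω a as) u
  | symSucc (j : Fin (Ψ.K.m + 1)) (Ω : Config) (a : Tm L [] Ty.nat)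
      (as : Sub L (Ψ.K.params j) []) (n : ℕ) (u : CST L Ψ.K []) : a.nf E = Tm.num (n + 1) →
      Eval Ψ (((Ψ.step j).char Ω).map fun t => t.sub (Sub.cons (Tm.num n) as)) u →
      Eval Ψ (.sym j Ω a as) u

/-- The set of clauses denoted by a normal clause-set term. -/
def CST.clauses {L : Lang} {K : ProofSyms L} {Γ : List Ty} : CST L K Γ → Set (Clause L Γ)
  | .cls C => {C}
  | .sym _ _ _ _ => ∅
  | .plus t₁ t₂ => t₁.clauses ∪ t₂.clauses
  | .times t₁ t₂ => Set.image2 Clause.comp t₁.clauses t₂.clauses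

/-- Projection terms over the projection symbols `pr^{ψ_j, Ω}`; `wk s` is the operation `w^s`. -/
inductive PT (L : Lang) (K : ProofSyms L) (Γ : List Ty)
  | ax (A : Atm L Γ)
  | sym (j : Fin (K.m + 1)) (Ω : Config) (a : Tm L Γ Ty.nat) (as : Sub L (K.params j) Γ)
  | un (r : URule L Γ) (t : PT L K Γ)
  | wk (s : Seq L Γ) (t : PT L K Γ)
  | plus (t₁ t₂ : PT L K Γ)
  | times (r : BRule L Γ) (t₁ t₂ : PT L K Γ)

/-- The characteristic projection term `Ξ(π, Ω)`. -/
def Pf.proj {L : Lang} {K : ProofSyms L} {Γ : List Ty} : Pf L K Γ → Config → PT L K Γ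
  | .ax A, _ => .ax A
  | .link j a as, c => .sym j c a as
  | .un r π, c => if r.skip c then π.proj (r.up c) else .un r (π.proj (r.up c))
  | .bin r π₁ π₂, c =>
      let c₁ := r.upLeft π₁.concl c
      let c₂ := r.upRight π₁.concl c
      if r.marked c then
        .plus (.wk (π₂.concl.unmarked c₂) (π₁.proj c₁)) (.wk (π₁.concl.unmarked c₁) (π₂.proj c₂))
      else .times r (π₁.proj c₁) (π₂.proj c₂)

def PT.map {L : Lang} {K : ProofSyms L} {Γ Δ : List Ty} (T : Tr L Γ Δ) : PT L K Γ → PT L K Δ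
  | .ax A => .ax (A.map T.tm)
  | .sym j Ω a as => .sym j Ω (T.tm a) fun τ v => T.tm (as τ v)
  | .un r t => .un (r.map T) (t.map T)
  | .wk s t => .wk (s.map T) (t.map T)
  | .plus t₁ t₂ => .plus (t₁.map T) (t₂.map T)
  | .times r t₁ t₂ => .times (r.map T) (t₁.map T) (t₂.map T)

/-- Evaluation of a projection term to its normal form under the rules
`pr^{ψ_j,Ω}(0, xs) → Ξ(π_j, Ω)`, `pr^{ψ_j,Ω}(s(k), xs) → Ξ(ν_j(k), Ω)` and the rules of the
language. -/
inductive PT.Eval {L : Lang} {E : Rules L} (Ψ : ProofSchema L E) :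
    PT L Ψ.K [] → PT L Ψ.K [] → Prop
  | ax (A : Atm L []) : Eval Ψ (.ax A) (.ax (A.map fun t => t.nf E))
  | un (r : URule L []) {t u : PT L Ψ.K []} :
      Eval Ψ t u → Eval Ψ (.un r t) (.un (r.map (Tr.nf E)) u)
  | wk (s : Seq L []) {t u : PT L Ψ.K []} :
      Eval Ψ t u → Eval Ψ (.wk s t) (.wk (s.map (Tr.nf E)) u)
  | plus {t₁ t₂ u₁ u₂ : PT L Ψ.K []} :
      Eval Ψ t₁ u₁ → Eval Ψ t₂ u₂ → Eval Ψ (.plus t₁ t₂) (.plus u₁ u₂)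
  | times (r : BRule L []) {t₁ t₂ u₁ u₂ : PT L Ψ.K []} :
      Eval Ψ t₁ u₁ → Eval Ψ t₂ u₂ →
      Eval Ψ (.times r t₁ t₂) (.times (r.map (Tr.nf E)) u₁ u₂)
  | symZero (j : Fin (Ψ.K.m + 1)) (Ω : Config) (a : Tm L [] Ty.nat)
      (as : Sub L (Ψ.K.params j) []) (u : PT L Ψ.K []) : a.nf E = Tm.num 0 →
      Eval Ψ (((Ψ.base j).proj Ω).map (Tr.sub as)) u → Eval Ψ (.sym j Ω a as) u
  | symSucc (j : Fin (Ψ.K.m + 1)) (Ω : Config) (a : Tm L [] Ty.nat)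
      (as : Sub L (Ψ.K.params j) []) (n : ℕ) (u : PT L Ψ.K []) : a.nf E = Tm.num (n + 1) →
      Eval Ψ (((Ψ.step j).proj Ω).map (Tr.sub (Sub.cons (Tm.num n) as))) u →
      Eval Ψ (.sym j Ω a as) u

open Classical in
/-- Bring an occurrence of `A` in the antecedent to the front. -/
noncomputable def Pf.frontAnt {L : Lang} {K : ProofSyms L} {Γ : List Ty} (A : Fm L Γ)
    (π : Pf L K Γ) : Pf L K Γ := .un (.frontL (π.concl.ant.idxOf A)) π

open Classical in
noncomputable def Pf.frontSuc {L : Lang} {K : ProofSyms L} {Γ : List Ty} (A : Fm L Γ)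
    (π : Pf L K Γ) : Pf L K Γ := .un (.frontR (π.concl.suc.idxOf A)) π

open Classical in
/-- Bring two occurrences of `A` in the antecedent to the front. -/
noncomputable def Pf.frontAnt2 {L : Lang} {K : ProofSyms L} {Γ : List Ty} (A : Fm L Γ)
    (π : Pf L K Γ) : Pf L K Γ :=
  .un (.frontL ((π.frontAnt A).concl.ant.tail.idxOf A + 1)) (π.frontAnt A)

open Classical in
noncomputable def Pf.frontSuc2 {L : Lang} {K : ProofSyms L} {Γ : List Ty} (A : Fm L Γ)
    (π : Pf L K Γ) : Pf L K Γ :=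
  .un (.frontR ((π.frontSuc A).concl.suc.tail.idxOf A + 1)) (π.frontSuc A)

/-- Apply a unary rule to a proof, after bringing the auxiliary formulas to the front. -/
noncomputable def URule.apply {L : Lang} {K : ProofSyms L} {Γ : List Ty} (r : URule L Γ)
    (π : Pf L K Γ) : Pf L K Γ :=
  .un r <| match r with
    | .negL A => π.frontSuc A
    | .negR A => π.frontAnt A
    | .andL1 A _ => π.frontAnt A
    | .andL2 _ B => π.frontAnt B
    | .orR1 A _ => π.frontSuc A
    | .orR2 _ B => π.frontSuc B
    | .impR A B => (π.frontAnt A).frontSuc B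
    | .allL A t => π.frontAnt (A.inst t)
    | .allR A x t => π.frontSuc (A.inst (.app (.v2 x) t))
    | .exL A x t => π.frontAnt (A.inst (.app (.v2 x) t))
    | .exR A t => π.frontSuc (A.inst t)
    | .cL A => π.frontAnt2 A
    | .cR A => π.frontSuc2 A
    | _ => π

noncomputable def BRule.apply {L : Lang} {K : ProofSyms L} {Γ : List Ty} (r : BRule L Γ)
    (π₁ π₂ : Pf L K Γ) : Pf L K Γ :=
  match r with
  | .andR A B => .bin r (π₁.frontSuc A) (π₂.frontSuc B)
  | .orL A B => .bin r (π₁.frontAnt A) (π₂.frontAnt B)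
  | .impL A B => .bin r (π₁.frontSuc A) (π₂.frontAnt B)
  | .cut A => .bin r (π₁.frontSuc A) (π₂.frontAnt A)

/-- `π` followed by weakenings that add `s`. -/
def Pf.weakenBy {L : Lang} {K : ProofSyms L} {Γ : List Ty} (s : Seq L Γ) (π : Pf L K Γ) :
    Pf L K Γ :=
  s.suc.foldr (fun A ρ => .un (.wR A) ρ) (s.ant.foldr (fun A ρ => .un (.wL A) ρ) π)

open Classical in
/-- The set of proofs denoted by a normal projection term. -/
noncomputable def PT.proofs {L : Lang} {K : ProofSyms L} {Γ : List Ty} :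
    PT L K Γ → Finset (Pf L K Γ)
  | .ax A => {.ax A}
  | .sym _ _ _ _ => ∅
  | .un r t => t.proofs.image r.apply
  | .wk s t => t.proofs.image (Pf.weakenBy s)
  | .plus t₁ t₂ => t₁.proofs ∪ t₂.proofs
  | .times r t₁ t₂ => Finset.image₂ r.apply t₁.proofs t₂.proofs

/-- The empty configuration for the end-sequent of the schema. -/
def ProofSchema.noConfig {L : Lang} {E : Rules L} (Ψ : ProofSchema L E) : Config :=
  ⟨List.replicate (Ψ.K.endSeq 0).ant.length false, List.replicate (Ψ.K.endSeq 0).suc.length false⟩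

/-- `c` is the normal form of the schematic characteristic term at `α`, so that `c.clauses` is the
characteristic clause set of the schema at `α`. -/
def ProofSchema.CharAt {L : Lang} {E : Rules L} (Ψ : ProofSchema L E) (h : Ψ.K.params 0 = [])
    (α : ℕ) (c : CST L Ψ.K []) : Prop :=
  CST.Eval Ψ (.sym 0 Ψ.noConfig (Tm.num α) (noArgs h)) c

/-- `ξ` is the normal form of the schematic projection term at `α`, so that `ξ.proofs` is the
projection set of the schema at `α`. -/
def ProofSchema.ProjAt {L : Lang} {E : Rules L} (Ψ : ProofSchema L E) (h : Ψ.K.params 0 = [])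
    (α : ℕ) (ξ : PT L Ψ.K []) : Prop :=
  PT.Eval Ψ (.sym 0 Ψ.noConfig (Tm.num α) (noArgs h)) ξ

/-- The size of the projection set: the total number of inferences in its elements. -/
noncomputable def PT.size {L : Lang} {K : ProofSyms L} {Γ : List Ty} (ξ : PT L K Γ) : ℕ :=
  ∑ φ ∈ ξ.proofs, φ.size

/-! ## Resolution proof schemata -/

/-- Clause symbols with the numbers of their second-order and clause arguments. -/
structure ClauseSyms where
  C : Type
  nx : C → ℕ
  nX : C → ℕ

/-- Clause schemata with free clause variables `0, ..., m - 1`. -/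
inductive CS (L : Lang) (A : ClauseSyms) (Γ : List Ty) (m : ℕ)
  | cls (C : Clause L Γ)
  | var (X : Fin m)
  | comp (C D : CS L A Γ m)
  | sym (c : A.C) (a : Tm L Γ Ty.nat) (xs : Fin (A.nx c) → Tm L Γ Ty.seq)
      (Xs : Fin (A.nX c) → CS L A Γ m)

def CS.map {L : Lang} {A : ClauseSyms} {Γ Δ : List Ty} {m m' : ℕ}
    (f : ∀ {τ : Ty}, Tm L Γ τ → Tm L Δ τ) (μ : Fin m → CS L A Δ m') :
    CS L A Γ m → CS L A Δ m'
  | .cls C => .cls (C.map f)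
  | .var X => μ X
  | .comp C D => .comp (C.map f μ) (D.map f μ)
  | .sym c a xs Xs => .sym c (f a) (fun i => f (xs i)) fun i => (Xs i).map f μ

/-- Resolution terms over calls `ρ_j(a, xs, Xs)` of the symbols `0, ..., g`, with `nx` second-order
and `nX` clause arguments. -/
inductive RTm (L : Lang) (A : ClauseSyms) (g nx nX : ℕ) (Γ : List Ty) (m : ℕ)
  | cls (C : CS L A Γ m)
  | res (s₁ s₂ : RTm L A g nx nX Γ m) (P : Atm L Γ)
  | call (j : Fin (g + 1)) (a : Tm L Γ Ty.nat) (xs : Fin nx → Tm L Γ Ty.seq)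
      (Xs : Fin nX → CS L A Γ m)

def RTm.map {L : Lang} {A : ClauseSyms} {g nx nX : ℕ} {Γ Δ : List Ty} {m m' : ℕ}
    (f : ∀ {τ : Ty}, Tm L Γ τ → Tm L Δ τ) (μ : Fin m → CS L A Δ m') :
    RTm L A g nx nX Γ m → RTm L A g nx nX Δ m'
  | .cls C => .cls (C.map f μ)
  | .res s₁ s₂ P => .res (s₁.map f μ) (s₂.map f μ) (P.map f)
  | .call j a xs Xs => .call j (f a) (fun i => f (xs i)) fun i => (Xs i).map f μ

/-- All calls `ρ_j(a, ...)` satisfy `p j a`. -/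
def RTm.Calls {L : Lang} {A : ClauseSyms} {g nx nX : ℕ} {Γ : List Ty} {m : ℕ}
    (p : Fin (g + 1) → Tm L Γ Ty.nat → Prop) : RTm L A g nx nX Γ m → Prop
  | .cls _ => True
  | .res s₁ s₂ _ => s₁.Calls p ∧ s₂.Calls p
  | .call j a _ _ => p j a

/-- The context of `n` second-order arguments. -/
abbrev seqCtx (n : ℕ) : List Ty := List.replicate n Ty.seq

def seqSub {L : Lang} {Γ : List Ty} : ∀ {n : ℕ}, (Fin n → Tm L Γ Ty.seq) → Sub L (seqCtx n) Γ
  | 0, _ => fun _ v => nomatch v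
  | _ + 1, f => Sub.cons (f 0) (seqSub fun i => f i.succ)

/-- Resolution proof schemata `ρ_0, ..., ρ_g` over the second-order variables `names` and `nX`
clause variables, together with the definitions of the clause symbols:
`c(0, xs, Xs) → cbase`, `c(s(k), xs, Xs) → c(k, xs, Xs) ∘ cstep`. -/
structure ResSchema (L : Lang) where
  A : ClauseSyms
  cbase : ∀ c, CS L A (seqCtx (A.nx c)) (A.nX c)
  cstep : ∀ c, Clause L (Ty.nat :: seqCtx (A.nx c))
  g : ℕ
  nx : ℕ
  nX : ℕ
  names : Fin nx → L.V
  base : Fin (g + 1) → RTm L A g nx nX (seqCtx nx) nX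
  step : Fin (g + 1) → RTm L A g nx nX (Ty.nat :: seqCtx nx) nX
  base_calls : ∀ i, (base i).Calls fun j _ => i < j
  step_calls : ∀ i, (step i).Calls fun j a => i < j ∨ (j = i ∧ a = .var Var.zero)

/-- Evaluation of clause schemata without variables to clauses in normal form. -/
inductive CS.Eval {L : Lang} (E : Rules L) (R : ResSchema L) :
    CS L R.A [] 0 → Clause L [] → Prop
  | cls (C : Clause L []) : Eval E R (.cls C) (C.map fun t => t.nf E)
  | comp {C D : CS L R.A [] 0} {C' D' : Clause L []} :
      Eval E R C C' → Eval E R D D' → Eval E R (.comp C D) (C'.comp D')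
  | symZero (c : R.A.C) (a : Tm L [] Ty.nat) (xs : Fin (R.A.nx c) → Tm L [] Ty.seq)
      (Xs : Fin (R.A.nX c) → CS L R.A [] 0) (C : Clause L []) : a.nf E = Tm.num 0 →
      Eval E R ((R.cbase c).map (fun t => t.sub (seqSub xs)) Xs) C → Eval E R (.sym c a xs Xs) C
  | symSucc (c : R.A.C) (a : Tm L [] Ty.nat) (xs : Fin (R.A.nx c) → Tm L [] Ty.seq)
      (Xs : Fin (R.A.nX c) → CS L R.A [] 0) (n : ℕ) (C : Clause L []) : a.nf E = Tm.num (n + 1) →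
      Eval E R (.sym c (Tm.num n) xs Xs) C →
      Eval E R (.sym c a xs Xs) (C.comp
        ((R.cstep c).map fun t => (t.sub (Sub.cons (Tm.num n) (seqSub xs))).nf E))

/-- Resolution deductions as terms `r(t₁; t₂; P)` over clauses. -/
inductive RTree (L : Lang)
  | leaf (C : Clause L [])
  | res (t₁ t₂ : RTree L) (P : Atm L [])

/-- Evaluation of resolution terms without variables to normal form. -/
inductive RTm.Eval {L : Lang} (E : Rules L) (R : ResSchema L) :
    RTm L R.A R.g R.nx R.nX [] 0 → RTree L → Prop
  | cls {C : CS L R.A [] 0} {C' : Clause L []} : C.Eval E R C' → Eval E R (.cls C) (.leaf C')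
  | res {s₁ s₂ : RTm L R.A R.g R.nx R.nX [] 0} {t₁ t₂ : RTree L} (P : Atm L []) :
      Eval E R s₁ t₁ → Eval E R s₂ t₂ →
      Eval E R (.res s₁ s₂ P) (.res t₁ t₂ (P.map fun t => t.nf E))
  | callZero (j : Fin (R.g + 1)) (a : Tm L [] Ty.nat) (xs : Fin R.nx → Tm L [] Ty.seq)
      (Xs : Fin R.nX → CS L R.A [] 0) (t : RTree L) : a.nf E = Tm.num 0 →
      Eval E R ((R.base j).map (fun t => t.sub (seqSub xs)) Xs) t → Eval E R (.call j a xs Xs) t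
  | callSucc (j : Fin (R.g + 1)) (a : Tm L [] Ty.nat) (xs : Fin R.nx → Tm L [] Ty.seq)
      (Xs : Fin R.nX → CS L R.A [] 0) (n : ℕ) (t : RTree L) : a.nf E = Tm.num (n + 1) →
      Eval E R ((R.step j).map (fun t => t.sub (Sub.cons (Tm.num n) (seqSub xs))) Xs) t →
      Eval E R (.call j a xs Xs) t

/-- A substitution `λ` for the clause variables (its range may contain `n` but no clause
variables) and a substitution schema `θ = {x ← λ k. θ x}` for the second-order variables, where in
`θ x` the variable number `0` is `k` and number `1` is `n`. -/
structure ResSubst (L : Lang) (R : ResSchema L) where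
  lam : Fin R.nX → CS L R.A [Ty.nat] 0
  theta : L.V → Tm L [Ty.nat, Ty.nat] Ty.ind

/-- The term `ρ_0(n, xs, Xs)λθ`. -/
def ResSubst.top {L : Lang} {R : ResSchema L} (s : ResSubst L R) :
    RTm L R.A R.g R.nx R.nX [Ty.nat] 0 :=
  RTm.map (fun t => t.vsub fun x => .lam (s.theta x)) Fin.elim0
    (.call 0 (.var Var.zero) (fun i => .v2 (R.names i)) s.lam)

/-- `t` is the normal form of `ρ_0(n, xs, Xs)λθ{n ← α}`. -/
def ResSubst.EvalAt {L : Lang} (E : Rules L) {R : ResSchema L} (s : ResSubst L R) (α : ℕ)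
    (t : RTree L) : Prop :=
  RTm.Eval E R (s.top.map (fun u => u.sub (Sub.cons (Tm.num α) Sub.id)) Fin.elim0) t

open Classical in
/-- The end-clause; a resolution step removes all occurrences of the atom. -/
noncomputable def RTree.es {L : Lang} : RTree L → Clause L []
  | .leaf C => C
  | .res t₁ t₂ P => ⟨t₁.es.ant ++ t₂.es.ant.filter (· ≠ P), t₁.es.suc.filter (· ≠ P) ++ t₂.es.suc⟩

def RTree.leaves {L : Lang} : RTree L → List (Clause L [])
  | .leaf C => [C]
  | .res t₁ t₂ _ => t₁.leaves ++ t₂.leaves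

def RTree.PivotsGround {L : Lang} : RTree L → Prop
  | .leaf _ => True
  | .res t₁ t₂ P => P.V2Free ∧ t₁.PivotsGround ∧ t₂.PivotsGround

/-- The number of nodes. -/
def RTree.size {L : Lang} : RTree L → ℕ
  | .leaf _ => 1
  | .res t₁ t₂ _ => t₁.size + t₂.size + 1

/-- `t` is a ground resolution refutation of ground instances of clauses from `S`. -/
def RTree.IsGroundRefutation {L : Lang} (t : RTree L) (S : Set (Clause L [])) : Prop :=
  t.es = ⟨[], []⟩ ∧ t.PivotsGround ∧
  ∀ D ∈ t.leaves, ∃ C ∈ S, ∃ σ : PSub L, σ.Ground ∧ D.Same (C.map fun u => u.psub σ)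

/-- The schema, with the given substitutions, is a resolution refutation schema of the
characteristic clause set of `Ψ` (ground after evaluation). -/
def ResSubst.Refutes {L : Lang} {E : Rules L} {R : ResSchema L} (s : ResSubst L R)
    (Ψ : ProofSchema L E) (h : Ψ.K.params 0 = []) : Prop :=
  ∀ β, ∃ c t, Ψ.CharAt h β c ∧ s.EvalAt E β t ∧ t.IsGroundRefutation c.clauses

/-! ## The evaluation phase -/

/-- Make one occurrence of `A` in the antecedent, at the front, out of `n`: by contractions, or by a
weakening if `n = 0`. -/
noncomputable def Pf.contrL {L : Lang} {K : ProofSyms L} {Γ : List Ty} (A : Fm L Γ) :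
    ℕ → Pf L K Γ → Pf L K Γ
  | 0, π => .un (.wL A) π
  | 1, π => π.frontAnt A
  | n + 2, π => Pf.contrL A (n + 1) (.un (.cL A) (π.frontAnt2 A))

noncomputable def Pf.contrR {L : Lang} {K : ProofSyms L} {Γ : List Ty} (A : Fm L Γ) :
    ℕ → Pf L K Γ → Pf L K Γ
  | 0, π => .un (.wR A) π
  | 1, π => π.frontSuc A
  | n + 2, π => Pf.contrR A (n + 1) (.un (.cR A) (π.frontSuc2 A))

open Classical in
/-- `Skeleton S C P t π`: the derivation `π` is the transformation `TR(t)` of the resolution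
deduction `t`, where each leaf `D = Cσ` (`C` in the clause set, `σ` ground) has been replaced by
`φσ`, for a projection `φ` of `S ∘ C`, and the contexts are propagated down. -/
inductive Skeleton {L : Lang} {K : ProofSyms L} (S : Seq L []) (CL : Set (Clause L []))
    (PR : Finset (Pf L K [])) : RTree L → Pf L K [] → Prop
  | leaf (D C : Clause L []) (σ : PSub L) (φ : Pf L K []) :
      C ∈ CL → φ ∈ PR → φ.concl.Same (S.comp C.toSeq) → σ.Ground →
      D.Same (C.map fun u => u.psub σ) → Skeleton S CL PR (.leaf D) (φ.map (Tr.psub σ))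
  | res (t₁ t₂ : RTree L) (P : Atm L []) (π₁ π₂ : Pf L K []) :
      Skeleton S CL PR t₁ π₁ → Skeleton S CL PR t₂ π₂ →
      Skeleton S CL PR (.res t₁ t₂ P)
        (.bin (.cut P.toFm) (π₁.contrR P.toFm (t₁.es.suc.count P))
          (π₂.contrL P.toFm (t₂.es.ant.count P)))

/-- Contract `n` copies of the sequent `S` to one. -/
noncomputable def Pf.contractAll {L : Lang} {K : ProofSyms L} {Γ : List Ty} (S : Seq L Γ) (n : ℕ)
    (π : Pf L K Γ) : Pf L K Γ :=
  S.suc.foldl (fun ρ A => ρ.contrR A n) (S.ant.foldl (fun ρ A => ρ.contrL A n) π)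

/-- `π` is a result of the evaluation phase at `α`, where the characteristic term, the projection
term and the resolution refutation schema evaluate to `c`, `ξ` and `t`. -/
def Output {L : Lang} {E : Rules L} (Ψ : ProofSchema L E) (h : Ψ.K.params 0 = []) {R : ResSchema L}
    (s : ResSubst L R) (α : ℕ) (c : CST L Ψ.K []) (ξ : PT L Ψ.K []) (t : RTree L)
    (π : Pf L Ψ.K []) : Prop :=
  Ψ.CharAt h α c ∧ Ψ.ProjAt h α ξ ∧ s.EvalAt E α t ∧ t.IsGroundRefutation c.clauses ∧
  ∃ π₀, Skeleton ((Ψ.seqAt h α).map (Tr.nf E)) c.clauses ξ.proofs t π₀ ∧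
    π = π₀.contractAll ((Ψ.seqAt h α).map (Tr.nf E)) t.leaves.length

/-! ## Symbolic size -/

/-- `∑ f` over the variables of a context, i.e. over the components of a tuple of arguments. -/
def sumVar : (Γ : List Ty) → (∀ τ, Var Γ τ → ℕ) → ℕ
  | [], _ => 0
  | τ :: Γ, f => f τ Var.zero + sumVar Γ fun υ v => f υ (Var.succ v)

/-- The number of symbols. -/
def Tm.symbols {L : Lang} : ∀ {Γ : List Ty} {τ : Ty}, Tm L Γ τ → ℕ
  | _, _, .var _ => 1
  | _, _, .v2 _ => 1
  | _, _, .app u t => u.symbols + t.symbols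
  | _, _, .lam t => t.symbols + 1
  | _, _, .zero => 1
  | _, _, .succ t => t.symbols + 1
  | _, _, .con _ as => sumVar _ (fun τ v => (as τ v).symbols) + 1
  | _, _, .dfn _ t as => t.symbols + sumVar _ (fun τ v => (as τ v).symbols) + 1

def Fm.symbols {L : Lang} : ∀ {Γ : List Ty}, Fm L Γ → ℕ
  | _, .pr _ as => sumVar _ (fun τ v => (as τ v).symbols) + 1
  | _, .dpr _ t as => t.symbols + sumVar _ (fun τ v => (as τ v).symbols) + 1
  | _, .neg A => A.symbols + 1
  | _, .and A B => A.symbols + B.symbols + 1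
  | _, .or A B => A.symbols + B.symbols + 1
  | _, .imp A B => A.symbols + B.symbols + 1
  | _, .all A => A.symbols + 1
  | _, .ex A => A.symbols + 1

def Seq.symbols {L : Lang} {Γ : List Ty} (s : Seq L Γ) : ℕ :=
  (s.ant.map Fm.symbols).sum + (s.suc.map Fm.symbols).sum + 1

/-- The number of symbols in all sequents of the proof (exchange moves are not inferences). -/
def Pf.symbols {L : Lang} {K : ProofSyms L} {Γ : List Ty} : Pf L K Γ → ℕ
  | .ax A => (Pf.ax A : Pf L K Γ).concl.symbols
  | .link j a as => (Pf.link j a as : Pf L K Γ).concl.symbols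
  | .un r π => π.symbols + r.cost * (r.concl π.concl).symbols
  | .bin r π₁ π₂ => π₁.symbols + π₂.symbols + (r.concl π₁.concl π₂.concl).symbols

/-- The total number of symbols in the elements of the projection set. -/
noncomputable def PT.symbols {L : Lang} {K : ProofSyms L} {Γ : List Ty} (ξ : PT L K Γ) : ℕ :=
  ∑ φ ∈ ξ.proofs, φ.symbols

def RTree.symbols {L : Lang} : RTree L → ℕ
  | .leaf C => C.toSeq.symbols
  | .res t₁ t₂ P => t₁.symbols + t₂.symbols + P.toFm.symbols + 1

end Ceres

open Ceres

/-!
The proof avoids confluence of the rewrite rules. Terms and formulas get a denotation: a value for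
each type (a number, a normal individual term, a sequence of such terms), with the defined symbols
read as the functions given by their recursion equations, along the well-founded orders. Rewriting
preserves denotations (`Fm.Red.den_eq`), every expression rewrites to the expression that its
denotation describes (`Fm.red_den_id`), and a normal expression is its own denotation. Hence normal
forms exist, are unique and commute with substitution (`Fm.nf_sub`), and "replace the parameters by
values, then normalize" is a uniform operation on proofs.

The central fact is `ProofSchema.matches_at`: each projection is a cut-free proof, without equality
inferences, links and strong quantifier rules, of the end-sequent extended by a clause of the
characteristic clause set, and each clause of the set has such a projection. It is proved by
induction on the proofs of the schema (`Pf.matches_of_links`), following the marked occurrences from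
the end-sequent upwards: an unmarked inference acts on the part of the end-sequent, whereas a marked
one merely relabels or merges clauses. Proof links are resolved by induction on the proof symbol and
the recursion argument (`ProofSyms.link_induction`). Since the end-sequent is skolemized and unmarked
formulas are its ancestors, no unmarked strong quantifier inference occurs. This is why projections
have no eigenvariables and may be instantiated by an arbitrary ground substitution
(`Pf.Plain.valid_psub`).

Replacing the leaves of the refutation by instances of projections and its steps by contractions and
atomic cuts gives a ground derivation of one copy of the end-sequent for each leaf
(`Skeleton.spec`), from which the evaluation phase contracts all copies to one
(`Pf.contractAll_spec`). For the number of inferences, with `N` the size of the projection set and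
`M` the size of the refutation, an end-sequent in the derivation has at most `2NM` formula
occurrences, so that each resolution step costs at most `4NM + 3` inferences, and the final
contractions cost `O(NM)` (`Skeleton.size_contractAll_le`).

For the number of symbols the ground substitution at a leaf matters, because variables that do not
occur in the clause may be replaced by terms of any size. Here the output is chosen: these variables
are replaced by a fixed ground term of the language, and the values at the other variables are
subterms of the leaf of the refutation (`Clause.exists_small_psub`). Hence an instance of a
projection is larger than the projection by at most a factor linear in the size of the refutation,
and the count of inferences is repeated with symbols (`exists_symbols_contractAll_le`).
-/

namespace Ceres

/-! ### Substitution calculus -/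

section Substitution

variable {L : Lang}

theorem Ren.lift_comp {Γ Δ Θ : List Ty} {υ : Ty} (r : Ren Γ Δ) (r' : Ren Δ Θ) :
    (fun τ v => r'.lift υ τ (r.lift υ τ v)) = Ren.lift υ (fun τ v => r' τ (r τ v)) := by
  funext τ v; cases v <;> rfl

theorem Tm.ren_ren {Γ : List Ty} {τ : Ty} (t : Tm L Γ τ) :
    ∀ {Δ Θ : List Ty} (r : Ren Γ Δ) (r' : Ren Δ Θ),
      (t.ren r).ren r' = t.ren fun τ v => r' τ (r τ v) := by
  induction t with
  | var v => intros; rfl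
  | v2 x => intros; rfl
  | app u t ihu iht => intros; simp only [Tm.ren, ihu, iht]
  | lam t ih => intros; simp only [Tm.ren, ih, Ren.lift_comp]
  | zero => intros; rfl
  | succ t ih => intros; simp only [Tm.ren, ih]
  | con f as ih => intros; simp only [Tm.ren, ih]
  | dfn d t as iht ih => intros; simp only [Tm.ren, ih, iht]

theorem Sub.lift_ren {Γ Δ Θ : List Ty} {υ : Ty} (r : Ren Γ Δ) (σ : Sub L Δ Θ) :
    (fun τ v => σ.lift υ τ (r.lift υ τ v)) = Sub.lift υ (fun τ v => σ τ (r τ v)) := by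
  funext τ v; cases v <;> rfl

theorem Tm.ren_sub {Γ : List Ty} {τ : Ty} (t : Tm L Γ τ) :
    ∀ {Δ Θ : List Ty} (r : Ren Γ Δ) (σ : Sub L Δ Θ),
      (t.ren r).sub σ = t.sub fun τ v => σ τ (r τ v) := by
  induction t with
  | var v => intros; rfl
  | v2 x => intros; rfl
  | app u t ihu iht => intros; simp only [Tm.ren, Tm.sub, ihu, iht]
  | lam t ih => intros; simp only [Tm.ren, Tm.sub, ih, Sub.lift_ren]
  | zero => intros; rfl
  | succ t ih => intros; simp only [Tm.ren, Tm.sub, ih]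
  | con f as ih => intros; simp only [Tm.ren, Tm.sub, ih]
  | dfn d t as iht ih => intros; simp only [Tm.ren, Tm.sub, ih, iht]

theorem Sub.ren_lift {Γ Δ Θ : List Ty} {υ : Ty} (σ : Sub L Γ Δ) (r : Ren Δ Θ) :
    (fun τ v => (σ.lift υ τ v).ren (r.lift υ)) = Sub.lift υ (fun τ v => (σ τ v).ren r) := by
  funext τ v
  cases v with
  | zero => rfl
  | succ v => simp only [Sub.lift, Sub.cons, Tm.weaken, Tm.ren_ren]; rfl

theorem Tm.sub_ren {Γ : List Ty} {τ : Ty} (t : Tm L Γ τ) :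
    ∀ {Δ Θ : List Ty} (σ : Sub L Γ Δ) (r : Ren Δ Θ),
      (t.sub σ).ren r = t.sub fun τ v => (σ τ v).ren r := by
  induction t with
  | var v => intros; rfl
  | v2 x => intros; rfl
  | app u t ihu iht => intros; simp only [Tm.ren, Tm.sub, ihu, iht]
  | lam t ih => intros; simp only [Tm.ren, Tm.sub, ih, Sub.ren_lift]
  | zero => intros; rfl
  | succ t ih => intros; simp only [Tm.ren, Tm.sub, ih]
  | con f as ih => intros; simp only [Tm.ren, Tm.sub, ih]
  | dfn d t as iht ih => intros; simp only [Tm.ren, Tm.sub, ih, iht]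

/-- Composition of substitutions. -/
def Sub.comp {Γ Δ Θ : List Ty} (σ : Sub L Γ Δ) (σ' : Sub L Δ Θ) : Sub L Γ Θ :=
  fun τ v => (σ τ v).sub σ'

theorem Tm.weaken_sub_lift {Γ Δ : List Ty} {τ υ : Ty} (t : Tm L Γ τ) (σ : Sub L Γ Δ) :
    (t.weaken υ).sub (σ.lift υ) = (t.sub σ).weaken υ := by
  simp only [Tm.weaken, Tm.ren_sub, Tm.sub_ren]; rfl

theorem Sub.comp_lift {Γ Δ Θ : List Ty} {υ : Ty} (σ : Sub L Γ Δ) (σ' : Sub L Δ Θ) :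
    (σ.lift υ).comp (σ'.lift υ) = (σ.comp σ').lift υ := by
  funext τ v
  cases v with
  | zero => rfl
  | succ v => exact Tm.weaken_sub_lift _ _

theorem Tm.sub_sub {Γ : List Ty} {τ : Ty} (t : Tm L Γ τ) :
    ∀ {Δ Θ : List Ty} (σ : Sub L Γ Δ) (σ' : Sub L Δ Θ),
      (t.sub σ).sub σ' = t.sub (σ.comp σ') := by
  induction t with
  | var v => intros; rfl
  | v2 x => intros; rfl
  | app u t ihu iht => intros; simp only [Tm.sub, ihu, iht]
  | lam t ih => intros; simp only [Tm.sub, ih, Sub.comp_lift]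
  | zero => intros; rfl
  | succ t ih => intros; simp only [Tm.sub, ih]
  | con f as ih => intros; simp only [Tm.sub, ih]
  | dfn d t as iht ih => intros; simp only [Tm.sub, ih, iht]

theorem Sub.id_lift {Γ : List Ty} {υ : Ty} :
    Sub.lift υ (Sub.id : Sub L Γ Γ) = Sub.id := by
  funext τ v; cases v <;> rfl

theorem Tm.sub_id {Γ : List Ty} {τ : Ty} (t : Tm L Γ τ) : t.sub Sub.id = t := by
  induction t with
  | var v => rfl
  | v2 x => rfl
  | app u t ihu iht => simp only [Tm.sub, ihu, iht]
  | lam t ih => simp only [Tm.sub, Sub.id_lift, ih]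
  | zero => rfl
  | succ t ih => simp only [Tm.sub, ih]
  | con f as ih => simp only [Tm.sub, ih]
  | dfn d t as iht ih => simp only [Tm.sub, ih, iht]

theorem Tm.weaken_sub_cons {Γ Δ : List Ty} {τ υ : Ty} (t : Tm L Γ τ) (u : Tm L Δ υ)
    (σ : Sub L Γ Δ) : (t.weaken υ).sub (Sub.cons u σ) = t.sub σ := by
  simp only [Tm.weaken, Tm.ren_sub]; rfl

theorem Sub.lift_comp_cons {Γ Δ Θ : List Ty} {υ : Ty} (σ : Sub L Γ Δ) (t : Tm L Θ υ)
    (σ' : Sub L Δ Θ) : (σ.lift υ).comp (Sub.cons t σ') = Sub.cons t (σ.comp σ') := by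
  funext τ v
  cases v with
  | zero => rfl
  | succ v => exact Tm.weaken_sub_cons _ _ _

theorem Sub.comp_id {Γ Δ : List Ty} (σ : Sub L Γ Δ) : σ.comp Sub.id = σ := by
  funext τ v; exact Tm.sub_id _

theorem Sub.cons_comp {Γ Δ Θ : List Ty} {υ : Ty} (t : Tm L Δ υ) (σ : Sub L Γ Δ)
    (σ' : Sub L Δ Θ) : (Sub.cons t σ).comp σ' = Sub.cons (t.sub σ') (σ.comp σ') := by
  funext τ v; cases v <;> rfl

theorem Tm.sub_ren_eq_weaken {Γ : List Ty} {τ υ : Ty} (t : Tm L Γ τ) :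
    t.sub (fun _ v => Tm.var (Var.succ v)) = t.weaken υ := by
  have := Tm.ren_sub t (fun _ v => Var.succ v) (Sub.id (L := L) (Γ := υ :: Γ))
  rw [Tm.sub_id] at this
  exact this.symm

theorem Tm.num_sub {Γ Δ : List Ty} (σ : Sub L Γ Δ) (n : ℕ) :
    (Tm.num n : Tm L Γ _).sub σ = Tm.num n := by
  induction n with
  | zero => rfl
  | succ n ih => simp only [Tm.num, Tm.sub, ih]

theorem Tm.num_injective {Γ : List Ty} {m n : ℕ} (h : (Tm.num m : Tm L Γ _) = Tm.num n) :
    m = n := by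
  induction m generalizing n with
  | zero => cases n with
    | zero => rfl
    | succ n => cases h
  | succ m ih => cases n with
    | zero => cases h
    | succ n => simp only [Tm.num, Tm.succ.injEq] at h; rw [ih h]

theorem Fm.sub_sub {Γ : List Ty} (A : Fm L Γ) :
    ∀ {Δ Θ : List Ty} (σ : Sub L Γ Δ) (σ' : Sub L Δ Θ),
      (A.sub σ).sub σ' = A.sub (σ.comp σ') := by
  induction A with
  | pr p as => intros; simp only [Fm.sub, Tm.sub_sub]
  | dpr q t as => intros; simp only [Fm.sub, Tm.sub_sub]
  | neg A ih => intros; simp only [Fm.sub, ih]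
  | and A B ihA ihB => intros; simp only [Fm.sub, ihA, ihB]
  | or A B ihA ihB => intros; simp only [Fm.sub, ihA, ihB]
  | imp A B ihA ihB => intros; simp only [Fm.sub, ihA, ihB]
  | all A ih => intros; simp only [Fm.sub, ih, Sub.comp_lift]
  | ex A ih => intros; simp only [Fm.sub, ih, Sub.comp_lift]

theorem Fm.sub_id {Γ : List Ty} (A : Fm L Γ) : A.sub Sub.id = A := by
  induction A with
  | pr p as => simp only [Fm.sub, Tm.sub_id]
  | dpr q t as => simp only [Fm.sub, Tm.sub_id]
  | neg A ih => simp only [Fm.sub, ih]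
  | and A B ihA ihB => simp only [Fm.sub, ihA, ihB]
  | or A B ihA ihB => simp only [Fm.sub, ihA, ihB]
  | imp A B ihA ihB => simp only [Fm.sub, ihA, ihB]
  | all A ih => simp only [Fm.sub, Sub.id_lift, ih]
  | ex A ih => simp only [Fm.sub, Sub.id_lift, ih]

/-- The arguments of constant symbols have base sorts, so that they are represented by their values
(see `Val.reify`). -/
theorem exists_base_of_var : ∀ {l : List Srt} {τ : Ty}, Var (l.map Ty.base) τ → ∃ s, τ = Ty.base s
  | _ :: _, _, .zero => ⟨_, rfl⟩
  | _ :: l, _, .succ v => exists_base_of_var (l := l) v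

end Substitution

/-! ### Denotations of terms -/

section TermDenotation

variable {L : Lang}

/-- The values of expressions of a type over a context `Δ`: numbers, terms, and sequences of terms,
the last ones indexed by the metatheoretic natural numbers. -/
abbrev Val (L : Lang) (Δ : List Ty) : Ty → Type
  | .base .o => ℕ
  | .base .i => Tm L Δ Ty.ind
  | .seq => ℕ → Tm L Δ Ty.ind

/-- Assignments of values over `Δ` to the variables of `Γ`. -/
abbrev Env (L : Lang) (Γ Δ : List Ty) : Type := ∀ τ, Var Γ τ → Val L Δ τ

/-- The assignment `ρ`, extended by the value `a` of the variable number `0`. -/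
def Env.cons {Γ Δ : List Ty} {υ : Ty} (a : Val L Δ υ) (ρ : Env L Γ Δ) : Env L (υ :: Γ) Δ
  | _, Var.zero => a
  | _, Var.succ v => ρ _ v

/-- The term that represents a value.  At type `seq` no normal term exists in general; the
abstraction returned there is never used. -/
def Val.reify {Δ : List Ty} : ∀ {τ : Ty}, Val L Δ τ → Tm L Δ τ
  | .base .o, n => Tm.num n
  | .base .i, t => t
  | .seq, f => .lam ((f 0).weaken _)

/-- Substitution in values. -/
def Val.sub {Δ Δ' : List Ty} (s : Sub L Δ Δ') : ∀ {τ : Ty}, Val L Δ τ → Val L Δ' τ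
  | .base .o, n => n
  | .base .i, t => Tm.sub s t
  | .seq, f => fun n => Tm.sub s (f n)

def Env.sub {Γ Δ Δ' : List Ty} (ρ : Env L Γ Δ) (s : Sub L Δ Δ') : Env L Γ Δ' :=
  fun τ v => (ρ τ v).sub s

/-- Interpretations of the defined function symbols. -/
abbrev DInt (L : Lang) (Δ : List Ty) : Type :=
  ∀ d : L.D, ℕ → Env L (L.dargs d) Δ → Val L Δ (Ty.base (L.dres d))

/-- The value of a term. -/
def Tm.den {Δ : List Ty} (J : DInt L Δ) : ∀ {Γ : List Ty} {τ : Ty}, Tm L Γ τ → Env L Γ Δ → Val L Δ τ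
  | _, _, .var v, ρ => ρ _ v
  | _, _, .v2 x, _ => fun n => .app (.v2 x) (Tm.num n)
  | _, _, .app u t, ρ => (u.den J ρ : ℕ → Tm L Δ Ty.ind) (t.den J ρ : ℕ)
  | _, _, .lam t, ρ => fun n => t.den J (Env.cons (υ := Ty.nat) n ρ)
  | _, _, .zero, _ => (0 : ℕ)
  | _, _, .succ t, ρ => ((t.den J ρ : ℕ) + 1 : ℕ)
  | _, _, .con f as, ρ => .con f fun τ v => ((as τ v).den J ρ).reify
  | _, _, .dfn d t as, ρ => J d (t.den J ρ : ℕ) fun τ v => (as τ v).den J ρ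

/-- A value of an arbitrary base sort, used as a default. -/
def Tm.defaultVal {Δ : List Ty} : ∀ {s : Srt}, Tm L Δ (Ty.base s) → Val L Δ (Ty.base s)
  | .o, _ => (0 : ℕ)
  | .i, t => t

variable (E : Rules L)

open Classical in
/-- The interpretation of the defined function symbols given by the rules, by recursion on the
order of the symbols and then on the first argument. -/
noncomputable def Rules.dint (Δ : List Ty) : DInt L Δ :=
  E.dlt_wf.fix fun d IH n e =>
    let J : DInt L Δ := fun d' =>
      if h : E.dlt d' d then IH d' h
      else fun n e => Tm.defaultVal (.dfn d' (Tm.num n) fun _ v => (e _ v).reify)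
    Nat.rec ((E.dbase d).den J e)
      (fun k prev => (E.dstep d).den J (Env.cons prev (Env.cons (υ := Ty.nat) k e))) n

theorem Tm.den_congr {Δ : List Ty} {p : L.D → Prop} {J J' : DInt L Δ} (hJ : ∀ d, p d → J d = J' d)
    {Γ : List Ty} {τ : Ty} (t : Tm L Γ τ) : ∀ (ρ : Env L Γ Δ), t.DAll p → t.den J ρ = t.den J' ρ := by
  induction t with
  | var v => intros; rfl
  | v2 x => intros; rfl
  | app u t ihu iht => intro ρ h; simp only [Tm.den, ihu ρ h.1, iht ρ h.2]
  | lam t ih => intro ρ h; funext n; exact ih _ h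
  | zero => intros; rfl
  | succ t ih => intro ρ h; simp only [Tm.den, ih ρ h]
  | con f as ih => intro ρ h; simp only [Tm.den, ih _ _ ρ (h _ _)]
  | dfn d t as iht ih => intro ρ h; simp only [Tm.den, ih _ _ ρ (h.2.2 _ _), iht ρ h.2.1, hJ d h.1]

theorem Rules.dint_zero {Δ : List Ty} (d : L.D) (e : Env L (L.dargs d) Δ) :
    E.dint Δ d 0 e = (E.dbase d).den (E.dint Δ) e := by
  conv_lhs => rw [Rules.dint, WellFounded.fix_eq]
  refine Tm.den_congr (p := fun d' => E.dlt d' d) ?_ _ e (E.dbase_lt d)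
  intro d' h
  simp only [h, dif_pos]; rfl

theorem Rules.dint_succ {Δ : List Ty} (d : L.D) (n : ℕ) (e : Env L (L.dargs d) Δ) :
    E.dint Δ d (n + 1) e = (E.dstep d).den (E.dint Δ)
      (Env.cons (E.dint Δ d n e) (Env.cons (υ := Ty.nat) n e)) := by
  conv_lhs => rw [Rules.dint, WellFounded.fix_eq]
  conv_rhs => rw [show E.dint Δ d n e = _ from congrFun (congrFun (WellFounded.fix_eq _ _ d) n) e]
  refine Tm.den_congr (p := fun d' => E.dlt d' d) ?_ _ _ (E.dstep_lt d)
  intro d' h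
  simp only [h, dif_pos]; rfl

theorem Tm.DAll_true {Γ : List Ty} {τ : Ty} (t : Tm L Γ τ) : t.DAll fun _ => True := by
  induction t <;> simp_all [Tm.DAll]

theorem Env.cons_sub {Γ Δ Δ' : List Ty} {υ : Ty} (a : Val L Δ υ) (ρ : Env L Γ Δ) (s : Sub L Δ Δ') :
    (Env.cons a ρ).sub s = Env.cons (a.sub s) (ρ.sub s) := by
  funext τ v; cases v <;> rfl

theorem Val.reify_sub {Δ Δ' : List Ty} (s : Sub L Δ Δ') {b : Srt} (a : Val L Δ (Ty.base b)) :
    a.reify.sub s = (a.sub s).reify := by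
  cases b with
  | o => exact Tm.num_sub _ _
  | i => rfl

/-- Values commute with substitution.  This and the similar statements below are relativized to the
symbols that satisfy `p`, so that they apply in the induction on the order of the defined symbols,
where the claim is available for smaller symbols only. -/
theorem Tm.den_sub_of {Δ Δ' : List Ty} (s : Sub L Δ Δ') {p : L.D → Prop} {J : DInt L Δ}
    {J' : DInt L Δ'} (hJ : ∀ d, p d → ∀ n e, (J d n e).sub s = J' d n (e.sub s))
    {Γ : List Ty} {τ : Ty} (t : Tm L Γ τ) :
    ∀ (ρ : Env L Γ Δ), t.DAll p → (t.den J ρ).sub s = t.den J' (ρ.sub s) := by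
  induction t with
  | var v => intros; rfl
  | v2 x => intros; funext n; simp only [Tm.den, Val.sub, Tm.sub, Tm.num_sub]
  | app u t ihu iht =>
    intro ρ h
    simp only [Tm.den, ← ihu ρ h.1, ← iht ρ h.2]; rfl
  | lam t ih =>
    intro ρ h; funext n
    refine (ih _ h).trans ?_
    rw [Env.cons_sub]; rfl
  | zero => intros; rfl
  | succ t ih => intro ρ h; simp only [Tm.den, ← ih ρ h]; rfl
  | con f as ih =>
    intro ρ h
    simp only [Tm.den, Val.sub, Tm.sub]
    congr 1; funext τ v
    obtain ⟨b, rfl⟩ := exists_base_of_var v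
    rw [← ih _ _ ρ (h _ _), Val.reify_sub]
  | dfn d t as iht ih =>
    intro ρ h
    simp only [Tm.den, hJ d h.1, ← iht ρ h.2.1]
    congr 1; funext τ v
    exact ih _ _ ρ (h.2.2 _ _)

theorem Rules.dint_sub {Δ Δ' : List Ty} (s : Sub L Δ Δ') (d : L.D) :
    ∀ n (e : Env L (L.dargs d) Δ), (E.dint Δ d n e).sub s = E.dint Δ' d n (e.sub s) := by
  induction d using E.dlt_wf.induction with
  | _ d IH =>
    intro n e
    induction n with
    | zero => rw [dint_zero, dint_zero]; exact Tm.den_sub_of s IH _ _ (E.dbase_lt d)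
    | succ n ih =>
      rw [dint_succ, dint_succ, Tm.den_sub_of s IH _ _ (E.dstep_lt d), Env.cons_sub, Env.cons_sub,
        ih]; rfl

theorem Tm.den_sub_val {Γ Δ Δ' : List Ty} {τ : Ty} (t : Tm L Γ τ) (ρ : Env L Γ Δ) (s : Sub L Δ Δ') :
    (t.den (E.dint Δ) ρ).sub s = t.den (E.dint Δ') (ρ.sub s) :=
  Tm.den_sub_of s (fun d _ => E.dint_sub s d) t ρ t.DAll_true

theorem Tm.den_ren {Δ : List Ty} (J : DInt L Δ) {Γ : List Ty} {τ : Ty} (t : Tm L Γ τ) :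
    ∀ {Θ : List Ty} (r : Ren Γ Θ) (ρ : Env L Θ Δ),
      (t.ren r).den J ρ = t.den J fun τ v => ρ τ (r τ v) := by
  induction t with
  | var v => intros; rfl
  | v2 x => intros; rfl
  | app u t ihu iht => intros; simp only [Tm.ren, Tm.den, ihu, iht]
  | lam t ih =>
    intros; funext n; simp only [Tm.ren, Tm.den, ih]
    congr 1; funext τ v; cases v <;> rfl
  | zero => intros; rfl
  | succ t ih => intros; simp only [Tm.ren, Tm.den, ih]
  | con f as ih => intros; simp only [Tm.ren, Tm.den, ih]
  | dfn d t as iht ih => intros; simp only [Tm.ren, Tm.den, ih, iht]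

theorem Tm.den_sub {Δ : List Ty} (J : DInt L Δ) {Γ : List Ty} {τ : Ty} (t : Tm L Γ τ) :
    ∀ {Θ : List Ty} (σ : Sub L Γ Θ) (ρ : Env L Θ Δ),
      (t.sub σ).den J ρ = t.den J fun τ v => (σ τ v).den J ρ := by
  induction t with
  | var v => intros; rfl
  | v2 x => intros; rfl
  | app u t ihu iht => intros; simp only [Tm.sub, Tm.den, ihu, iht]
  | lam t ih =>
    intros; funext n; simp only [Tm.sub, Tm.den, ih]
    congr 1; funext τ v
    cases v with
    | zero => rfl
    | succ v => simp only [Sub.lift, Sub.cons, Tm.weaken, Tm.den_ren]; rfl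
  | zero => intros; rfl
  | succ t ih => intros; simp only [Tm.sub, Tm.den, ih]
  | con f as ih => intros; simp only [Tm.sub, Tm.den, ih]
  | dfn d t as iht ih => intros; simp only [Tm.sub, Tm.den, ih, iht]

/-- Rewriting preserves the value. -/
theorem Tm.Red.den_eq {Δ : List Ty} {Γ : List Ty} {τ : Ty} {t t' : Tm L Γ τ} (h : t.Red E t') :
    ∀ ρ : Env L Γ Δ, t.den (E.dint Δ) ρ = t'.den (E.dint Δ) ρ := by
  induction h with
  | refl t => intros; rfl
  | trans _ _ ih₁ ih₂ => intro ρ; rw [ih₁, ih₂]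
  | app _ _ ih₁ ih₂ => intro ρ; simp only [Tm.den, ih₁, ih₂]
  | lam _ ih => intro ρ; simp only [Tm.den, ih]
  | succ _ ih => intro ρ; simp only [Tm.den, ih]
  | con f _ ih => intro ρ; simp only [Tm.den, ih]
  | dfn d _ _ ih₁ ih => intro ρ; simp only [Tm.den, ih₁, ih]
  | beta t s =>
    intro ρ; rw [Tm.den_sub]; simp only [Tm.den]
    congr 1; funext τ v; cases v <;> rfl
  | dzero d as => intro ρ; rw [Tm.den_sub]; simp only [Tm.den]; exact E.dint_zero _ _
  | dsucc d t as =>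
    intro ρ; rw [Tm.den_sub]; simp only [Tm.den]
    rw [E.dint_succ]
    congr 1; funext τ v
    cases v with
    | zero => rfl
    | succ v => cases v <;> rfl

/-- The term rewrites to (a representation of) the value. -/
def Val.Red (E : Rules L) {Δ : List Ty} : ∀ {τ : Ty}, Tm L Δ τ → Val L Δ τ → Prop
  | .base .o, t, n => t.Red E (Tm.num n)
  | .base .i, t, u => t.Red E u
  | .seq, t, f => ∀ n, (Tm.app t (Tm.num n)).Red E (f n)

theorem Val.Red.trans {E : Rules L} {Δ : List Ty} {τ : Ty} {t t' : Tm L Δ τ} {a : Val L Δ τ}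
    (h : t.Red E t') (h' : Val.Red E t' a) : Val.Red E t a := by
  match τ with
  | .base .o => exact Tm.Red.trans h h'
  | .base .i => exact Tm.Red.trans h h'
  | .seq => exact fun n => Tm.Red.trans (.app h (.refl _)) (h' n)

theorem Val.Red.reify {E : Rules L} {Δ : List Ty} {b : Srt} {t : Tm L Δ (Ty.base b)}
    {a : Val L Δ (Ty.base b)} (h : Val.Red E t a) : t.Red E a.reify := by
  cases b with
  | o => exact h
  | i => exact h

/-- The relativized form of `Val.red_den`. -/
theorem Val.red_of {E : Rules L} {Δ : List Ty} {p : L.D → Prop}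
    (hJ : ∀ d, p d → ∀ n (as : Sub L (L.dargs d) Δ) e, (∀ τ v, Val.Red E (as τ v) (e τ v)) →
      Val.Red E (.dfn d (Tm.num n) as) (E.dint Δ d n e)) {Γ : List Ty} {τ : Ty} (t : Tm L Γ τ) :
    ∀ (σ : Sub L Γ Δ) (ρ : Env L Γ Δ), (∀ τ v, Val.Red E (σ τ v) (ρ τ v)) → t.DAll p →
      Val.Red E (t.sub σ) (t.den (E.dint Δ) ρ) := by
  induction t with
  | var v => intro σ ρ h _; exact h _ v
  | v2 x => intro σ ρ h _ n; exact .refl _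
  | app u t ihu iht =>
    intro σ ρ h hp
    exact Tm.Red.trans (.app (.refl _) (iht σ ρ h hp.2)) (ihu σ ρ h hp.1 _)
  | lam t ih =>
    intro σ ρ h hp n
    refine Tm.Red.trans (.beta _ _) ?_
    rw [Tm.sub_sub, Sub.lift_comp_cons, Sub.comp_id]
    refine ih _ _ ?_ hp
    intro τ v
    cases v with
    | zero => exact .refl _
    | succ v => exact h _ v
  | zero => intro σ ρ h _; exact .refl _
  | succ t ih => intro σ ρ h hp; exact .succ (ih σ ρ h hp)
  | con f as ih =>
    intro σ ρ h hp
    refine Tm.Red.con f fun τ v => ?_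
    obtain ⟨b, rfl⟩ := exists_base_of_var v
    exact (ih _ _ σ ρ h (hp _ _)).reify
  | dfn d t as iht ih =>
    intro σ ρ h hp
    refine Val.Red.trans (.dfn d (iht σ ρ h hp.2.1) fun τ v => .refl _) ?_
    exact hJ d hp.1 _ _ _ fun τ v => ih _ _ σ ρ h (hp.2.2 _ _)

theorem Rules.dint_red {Δ : List Ty} (d : L.D) : ∀ n (as : Sub L (L.dargs d) Δ) e,
    (∀ τ v, Val.Red E (as τ v) (e τ v)) → Val.Red E (.dfn d (Tm.num n) as) (E.dint Δ d n e) := by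
  induction d using E.dlt_wf.induction with
  | _ d IH =>
    intro n as e h
    induction n with
    | zero =>
      rw [dint_zero]
      exact Val.Red.trans (.dzero d as) (Val.red_of IH _ _ _ h (E.dbase_lt d))
    | succ n ih =>
      rw [dint_succ]
      refine Val.Red.trans (.dsucc d _ as) (Val.red_of IH _ _ _ ?_ (E.dstep_lt d))
      intro τ v
      cases v with
      | zero => exact ih
      | succ v => cases v with
        | zero => exact Tm.Red.refl _
        | succ v => exact h _ v

/-- Every instance of a term rewrites to its value. -/
theorem Val.red_den {Γ Δ : List Ty} {τ : Ty} (t : Tm L Γ τ) (σ : Sub L Γ Δ) (ρ : Env L Γ Δ)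
    (h : ∀ τ v, Val.Red E (σ τ v) (ρ τ v)) : Val.Red E (t.sub σ) (t.den (E.dint Δ) ρ) :=
  Val.red_of (fun d _ => E.dint_red d) t σ ρ h t.DAll_true

/-- All terms of a value satisfy `Q`. -/
def Val.All {Δ : List Ty} (Q : Tm L Δ Ty.ind → Prop) : ∀ {τ : Ty}, Val L Δ τ → Prop
  | .base .o, _ => True
  | .base .i, t => Q t
  | .seq, f => ∀ n, Q (f n)

theorem Tm.num_normal {Γ : List Ty} (n : ℕ) : (Tm.num n : Tm L Γ _).Normal := by
  induction n <;> simp_all [Tm.num, Tm.Normal]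

theorem Tm.num_v2Free {Γ : List Ty} (n : ℕ) : (Tm.num n : Tm L Γ _).V2Free := by
  induction n <;> simp_all [Tm.num, Tm.V2Free]

theorem Val.All.normal {Δ : List Ty} {b : Srt} {a : Val L Δ (Ty.base b)}
    (h : Val.All Tm.Normal a) : a.reify.Normal := by
  cases b with
  | o => exact Tm.num_normal _
  | i => exact h

theorem Val.All.v2Free {Δ : List Ty} {b : Srt} {a : Val L Δ (Ty.base b)}
    (h : Val.All Tm.V2Free a) : a.reify.V2Free := by
  cases b with
  | o => exact Tm.num_v2Free _
  | i => exact h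

theorem Env.all_cons {Γ Δ : List Ty} {Q : Tm L Δ Ty.ind → Prop} {υ : Ty} {a : Val L Δ υ}
    {ρ : Env L Γ Δ} (ha : Val.All Q a) (h : ∀ τ v, Val.All Q (ρ τ v)) :
    ∀ τ v, Val.All Q (Env.cons a ρ τ v) := by
  intro τ v
  cases v with
  | zero => exact ha
  | succ v => exact h _ v

/-- Values built from values satisfying `Q` satisfy `Q`, when `Q` is closed under the constant
function symbols and either holds for the variables `x(n)` or no second-order variable occurs. -/
theorem Tm.den_all_of {Δ : List Ty} {Q : Tm L Δ Ty.ind → Prop} {b : Prop}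
    (hv : b → ∀ x n, Q (.app (.v2 x) (Tm.num n)))
    (hc : ∀ f (e : Env L ((L.fargs f).map Ty.base) Δ), (∀ τ v, Val.All Q (e τ v)) →
      Q (.con f fun τ v => (e τ v).reify)) {p : L.D → Prop} {J : DInt L Δ}
    (hJ : ∀ d, p d → ∀ n e, (∀ τ v, Val.All Q (e τ v)) → Val.All Q (J d n e))
    {Γ : List Ty} {τ : Ty} (t : Tm L Γ τ) : ∀ (ρ : Env L Γ Δ), t.DAll p → (b ∨ t.V2Free) →
      (∀ τ v, Val.All Q (ρ τ v)) → Val.All Q (t.den J ρ) := by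
  induction t with
  | var v => intro ρ _ _ h; exact h _ v
  | v2 x => intro ρ _ hb h n; exact hv (hb.resolve_right id) x n
  | app u t ihu iht =>
    intro ρ hp hb h
    exact ihu ρ hp.1 (hb.imp_right And.left) h _
  | lam t ih =>
    intro ρ hp hb h n
    exact ih _ hp hb (Env.all_cons trivial h)
  | zero => intros; trivial
  | succ t ih => intros; trivial
  | con f as ih =>
    intro ρ hp hb h
    exact hc f _ fun τ v => ih _ _ ρ (hp _ _) (hb.imp_right fun k => k _ _) h
  | dfn d t as iht ih =>
    intro ρ hp hb h
    exact hJ d hp.1 _ _ fun τ v => ih _ _ ρ (hp.2.2 _ _) (hb.imp_right fun k => k.2 _ _) h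

theorem Rules.dint_all {Δ : List Ty} {Q : Tm L Δ Ty.ind → Prop}
    (hc : ∀ f (e : Env L ((L.fargs f).map Ty.base) Δ), (∀ τ v, Val.All Q (e τ v)) →
      Q (.con f fun τ v => (e τ v).reify)) (d : L.D) :
    ∀ n e, (∀ τ v, Val.All Q (e τ v)) → Val.All Q (E.dint Δ d n e) := by
  induction d using E.dlt_wf.induction with
  | _ d IH =>
    intro n e h
    induction n with
    | zero =>
      rw [dint_zero]
      exact Tm.den_all_of False.elim hc IH _ _ (E.dbase_lt d) (.inr (E.dbase_v2 d)) h
    | succ n ih =>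
      rw [dint_succ]
      exact Tm.den_all_of False.elim hc IH _ _ (E.dstep_lt d) (.inr (E.dstep_v2 d))
        (Env.all_cons ih (Env.all_cons trivial h))

theorem Tm.den_normal {Γ Δ : List Ty} {τ : Ty} (t : Tm L Γ τ) (ρ : Env L Γ Δ)
    (h : ∀ τ v, Val.All Tm.Normal (ρ τ v)) : Val.All Tm.Normal (t.den (E.dint Δ) ρ) := by
  have hc : ∀ f (e : Env L ((L.fargs f).map Ty.base) Δ), (∀ τ v, Val.All Tm.Normal (e τ v)) →
      (Tm.con f fun τ v => (e τ v).reify).Normal := by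
    intro f e he τ v
    obtain ⟨b, rfl⟩ := exists_base_of_var v
    exact (he _ v).normal
  exact Tm.den_all_of (b := True) (fun _ x n => ⟨trivial, Tm.num_normal n⟩) hc
    (fun d _ => E.dint_all hc d) t ρ t.DAll_true (.inl trivial) h

theorem Tm.den_v2Free {Γ Δ : List Ty} {τ : Ty} (t : Tm L Γ τ) (ρ : Env L Γ Δ) (ht : t.V2Free)
    (h : ∀ τ v, Val.All Tm.V2Free (ρ τ v)) : Val.All Tm.V2Free (t.den (E.dint Δ) ρ) := by
  have hc : ∀ f (e : Env L ((L.fargs f).map Ty.base) Δ), (∀ τ v, Val.All Tm.V2Free (e τ v)) →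
      (Tm.con f fun τ v => (e τ v).reify).V2Free := by
    intro f e he τ v
    obtain ⟨b, rfl⟩ := exists_base_of_var v
    exact (he _ v).v2Free
  exact Tm.den_all_of False.elim hc
    (fun d _ => E.dint_all hc d) t ρ t.DAll_true (.inr ht) h

end TermDenotation

/-! ### Denotations of formulas -/

section FormulaDenotation

variable {L : Lang}

/-- The environment under a quantifier: the bound variable denotes itself. -/
def Env.lift {Γ Δ : List Ty} (ρ : Env L Γ Δ) : Env L (Ty.ind :: Γ) (Ty.ind :: Δ) :=
  Env.cons (υ := Ty.ind) (Tm.var Var.zero) (ρ.sub fun _ v => .var (.succ v))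

/-- Interpretations of the defined predicate symbols. -/
abbrev QInt (L : Lang) : Type :=
  ∀ (q : L.Q) (_ : ℕ) (Δ : List Ty), Env L (L.qargs q) Δ → Fm L Δ

variable (E : Rules L)

/-- The value of a formula: a formula without defined symbols and abstractions. -/
noncomputable def Fm.den (J : QInt L) : ∀ {Γ Δ : List Ty}, Fm L Γ → Env L Γ Δ → Fm L Δ
  | _, _, .pr p as, ρ => .pr p fun τ v => ((as τ v).den (E.dint _) ρ).reify
  | _, Δ, .dpr q t as, ρ => J q (t.den (E.dint Δ) ρ : ℕ) Δ fun τ v => (as τ v).den (E.dint Δ) ρ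
  | _, _, .neg A, ρ => .neg (A.den J ρ)
  | _, _, .and A B, ρ => .and (A.den J ρ) (B.den J ρ)
  | _, _, .or A B, ρ => .or (A.den J ρ) (B.den J ρ)
  | _, _, .imp A B, ρ => .imp (A.den J ρ) (B.den J ρ)
  | _, _, .all A, ρ => .all (A.den J ρ.lift)
  | _, _, .ex A, ρ => .ex (A.den J ρ.lift)

/-- The order on pairs of a defined predicate symbol and a number along which the rules unfold. -/
def Rules.CallLt : L.Q × ℕ → L.Q × ℕ → Prop := Prod.Lex E.qlt (· < ·)

theorem Rules.callLt_wf : WellFounded E.CallLt := WellFounded.prod_lex E.qlt_wf Nat.lt_wfRel.wf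

open Classical in
/-- The interpretation of the defined predicate symbols given by the rules. -/
noncomputable def Rules.qintAux : ∀ x : L.Q × ℕ, ∀ (Δ : List Ty), Env L (L.qargs x.1) Δ → Fm L Δ :=
  E.callLt_wf.fix fun x IH _ e =>
    let J : QInt L := fun q n Δ e =>
      if h : E.CallLt (q, n) x then IH (q, n) h Δ e
      else .dpr q (Tm.num n) fun _ v => (e _ v).reify
    match x, e with
    | (q, 0), e => (E.qbase q).den E J e
    | (q, n + 1), e => (E.qstep q).den E J (Env.cons (υ := Ty.nat) n e)

/-- The interpretation of the defined predicate symbols, as a function of two arguments. -/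
noncomputable def Rules.qint : QInt L := fun q n => E.qintAux (q, n)

/-- All evaluations of defined predicate symbols that the value of the formula calls for are
allowed by `P`. -/
def Fm.QCalls (P : L.Q → ℕ → Prop) : ∀ {Γ Δ : List Ty}, Fm L Γ → Env L Γ Δ → Prop
  | _, _, .pr _ _, _ => True
  | _, Δ, .dpr q t _, ρ => P q (t.den (E.dint Δ) ρ : ℕ)
  | _, _, .neg A, ρ => A.QCalls P ρ
  | _, _, .and A B, ρ => A.QCalls P ρ ∧ B.QCalls P ρ
  | _, _, .or A B, ρ => A.QCalls P ρ ∧ B.QCalls P ρ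
  | _, _, .imp A B, ρ => A.QCalls P ρ ∧ B.QCalls P ρ
  | _, _, .all A, ρ => A.QCalls P ρ.lift
  | _, _, .ex A, ρ => A.QCalls P ρ.lift

theorem Fm.qCalls_true {Γ : List Ty} (A : Fm L Γ) :
    ∀ {Δ : List Ty} (ρ : Env L Γ Δ), A.QCalls E (fun _ _ => True) ρ := by
  induction A <;> intros <;> simp_all [Fm.QCalls]

theorem Tm.den_weaken {Γ Δ : List Ty} {τ υ : Ty} (t : Tm L Γ τ) (a : Val L Δ υ) (ρ : Env L Γ Δ)
    (J : DInt L Δ) : (t.weaken υ).den J (Env.cons a ρ) = t.den J ρ := by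
  simp only [Tm.weaken, Tm.den_ren]; rfl

theorem Tm.den_weaken_lift {Γ Δ : List Ty} {τ : Ty} (t : Tm L Γ τ) (ρ : Env L Γ Δ) :
    (t.weaken Ty.ind).den (E.dint _) ρ.lift
      = (t.den (E.dint _) ρ).sub fun _ v => .var (.succ v) := by
  rw [Env.lift, Tm.den_weaken, Tm.den_sub_val]

/-- The syntactic condition on a right-hand side, by which the symbol `q` is called only with its
original arguments, bounds the calls of its value: a recursive call has the recursion argument
`n`. -/
theorem Fm.QAll.qCalls {lt : L.Q → Prop} {rec : Prop} {q : L.Q} {n : ℕ} {P : L.Q → ℕ → Prop}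
    (h₁ : ∀ q' k, lt q' → P q' k) (h₂ : rec → P q n) {Γ : List Ty} (A : Fm L Γ) :
    ∀ {Δ : List Ty} (y : Tm L Γ Ty.nat) (xs : Sub L (L.qargs q) Γ) (ρ : Env L Γ Δ),
      (y.den (E.dint Δ) ρ : ℕ) = n → A.QAll lt rec q y xs → A.QCalls E P ρ := by
  induction A with
  | pr p as => intros; trivial
  | dpr q' t as =>
    intro Δ y xs ρ hy h
    rcases h with h | ⟨hr, h⟩
    · exact h₁ _ _ h
    · cases h; subst hy; exact h₂ hr
  | neg A ih => intro Δ y xs ρ hy h; exact ih y xs ρ hy h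
  | and A B ihA ihB => intro Δ y xs ρ hy h; exact ⟨ihA y xs ρ hy h.1, ihB y xs ρ hy h.2⟩
  | or A B ihA ihB => intro Δ y xs ρ hy h; exact ⟨ihA y xs ρ hy h.1, ihB y xs ρ hy h.2⟩
  | imp A B ihA ihB => intro Δ y xs ρ hy h; exact ⟨ihA y xs ρ hy h.1, ihB y xs ρ hy h.2⟩
  | all A ih =>
    intro Δ y xs ρ hy h
    exact ih (y.weaken _) (fun τ v => (xs τ v).weaken _) ρ.lift ((Tm.den_weaken_lift E y ρ).trans hy) h
  | ex A ih =>
    intro Δ y xs ρ hy h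
    exact ih (y.weaken _) (fun τ v => (xs τ v).weaken _) ρ.lift ((Tm.den_weaken_lift E y ρ).trans hy) h

theorem Rules.qbase_qCalls {Δ : List Ty} (q : L.Q) (e : Env L (L.qargs q) Δ) :
    (E.qbase q).QCalls E (fun q' k => E.CallLt (q', k) (q, 0)) e :=
  Fm.QAll.qCalls E (n := 0) (fun _ _ h => Prod.Lex.left _ _ h) False.elim _ .zero _ e rfl
    (E.qbase_lt q)

theorem Rules.qstep_qCalls {Δ : List Ty} (q : L.Q) (n : ℕ) (e : Env L (L.qargs q) Δ) :
    (E.qstep q).QCalls E (fun q' k => E.CallLt (q', k) (q, n + 1)) (Env.cons (υ := Ty.nat) n e) :=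
  Fm.QAll.qCalls E (n := n) (P := fun q' k => E.CallLt (q', k) (q, n + 1))
    (fun _ _ h => Prod.Lex.left _ _ h) (fun _ => Prod.Lex.right _ (Nat.lt_succ_self n)) _
    (.var .zero) _ _ rfl (E.qstep_lt q)

theorem Fm.den_congr {P : L.Q → ℕ → Prop} {J J' : QInt L}
    (hJ : ∀ q n, P q n → ∀ Δ e, J q n Δ e = J' q n Δ e) {Γ : List Ty} (A : Fm L Γ) :
    ∀ {Δ : List Ty} (ρ : Env L Γ Δ), A.QCalls E P ρ → A.den E J ρ = A.den E J' ρ := by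
  induction A with
  | pr p as => intros; rfl
  | dpr q t as => intro Δ ρ h; exact hJ _ _ h _ _
  | neg A ih => intro Δ ρ h; simp only [Fm.den, ih ρ h]
  | and A B ihA ihB => intro Δ ρ h; simp only [Fm.den, ihA ρ h.1, ihB ρ h.2]
  | or A B ihA ihB => intro Δ ρ h; simp only [Fm.den, ihA ρ h.1, ihB ρ h.2]
  | imp A B ihA ihB => intro Δ ρ h; simp only [Fm.den, ihA ρ h.1, ihB ρ h.2]
  | all A ih => intro Δ ρ h; simp only [Fm.den, ih _ h]
  | ex A ih => intro Δ ρ h; simp only [Fm.den, ih _ h]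

theorem Rules.qint_zero {Δ : List Ty} (q : L.Q) (e : Env L (L.qargs q) Δ) :
    E.qint q 0 Δ e = (E.qbase q).den E E.qint e := by
  conv_lhs => rw [Rules.qint, Rules.qintAux, WellFounded.fix_eq]
  refine Fm.den_congr E ?_ _ e (E.qbase_qCalls q e)
  intro q' n h Δ e
  simp only [h, dif_pos]; rfl

theorem Rules.qint_succ {Δ : List Ty} (q : L.Q) (n : ℕ) (e : Env L (L.qargs q) Δ) :
    E.qint q (n + 1) Δ e = (E.qstep q).den E E.qint (Env.cons (υ := Ty.nat) n e) := by
  conv_lhs => rw [Rules.qint, Rules.qintAux, WellFounded.fix_eq]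
  refine Fm.den_congr E ?_ _ _ (E.qstep_qCalls q n e)
  intro q' n h Δ e
  simp only [h, dif_pos]; rfl

/-- Induction along the unfolding of the defined predicate symbols. -/
theorem Rules.qint_induction {M : L.Q → ℕ → Prop}
    (h : ∀ q n, (∀ q' k, E.CallLt (q', k) (q, n) → M q' k) → M q n) (q : L.Q) (n : ℕ) : M q n := by
  have : ∀ x : L.Q × ℕ, M x.1 x.2 := fun x => by
    induction x using E.callLt_wf.induction with
    | _ x IH => exact h _ _ fun q' k hk => IH (q', k) hk
  exact this (q, n)

/-! #### Compatibility with substitution -/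

theorem Val.sub_sub {Δ Δ' Δ'' : List Ty} {τ : Ty} (a : Val L Δ τ) (s : Sub L Δ Δ')
    (s' : Sub L Δ' Δ'') : (a.sub s).sub s' = a.sub (s.comp s') := by
  match τ, a with
  | .base .o, _ => rfl
  | .base .i, t => exact Tm.sub_sub t s s'
  | .seq, f => funext n; exact Tm.sub_sub (f n) s s'

theorem Val.sub_id {Δ : List Ty} {τ : Ty} (a : Val L Δ τ) : a.sub Sub.id = a := by
  match τ, a with
  | .base .o, _ => rfl
  | .base .i, t => exact Tm.sub_id t
  | .seq, f => funext n; exact Tm.sub_id (f n)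

theorem Env.lift_sub_lift {Γ Δ Δ' : List Ty} (ρ : Env L Γ Δ) (s : Sub L Δ Δ') :
    ρ.lift.sub (s.lift Ty.ind) = (ρ.sub s).lift := by
  funext τ v
  cases v with
  | zero => rfl
  | succ v =>
    change ((ρ τ v).sub _).sub _ = ((ρ τ v).sub s).sub _
    rw [Val.sub_sub, Val.sub_sub]
    congr 1; funext τ' w
    exact (Tm.sub_ren_eq_weaken _).symm

theorem Env.lift_sub_cons {Γ Δ : List Ty} (ρ : Env L Γ Δ) (t : Tm L Δ Ty.ind) :
    ρ.lift.sub (Sub.cons t Sub.id) = Env.cons (υ := Ty.ind) t ρ := by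
  funext τ v
  cases v with
  | zero => rfl
  | succ v =>
    change ((ρ τ v).sub _).sub _ = ρ τ v
    rw [Val.sub_sub]
    exact Val.sub_id _

theorem Fm.den_sub_of {P : L.Q → ℕ → Prop} {J : QInt L}
    (hJ : ∀ q n, P q n → ∀ Δ Δ' e (s : Sub L Δ Δ'), (J q n Δ e).sub s = J q n Δ' (e.sub s))
    {Γ : List Ty} (A : Fm L Γ) :
    ∀ {Δ Δ' : List Ty} (ρ : Env L Γ Δ) (s : Sub L Δ Δ'), A.QCalls E P ρ →
      (A.den E J ρ).sub s = A.den E J (ρ.sub s) := by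
  induction A with
  | pr p as =>
    intro Δ Δ' ρ s _
    simp only [Fm.den, Fm.sub]
    congr 1; funext τ v
    obtain ⟨b, rfl⟩ := exists_base_of_var v
    rw [Val.reify_sub, Tm.den_sub_val]
  | dpr q t as =>
    intro Δ Δ' ρ s h
    simp only [Fm.den, ← Tm.den_sub_val]
    exact hJ _ _ h _ _ _ _
  | neg A ih => intro Δ Δ' ρ s h; simp only [Fm.den, Fm.sub, ih ρ s h]
  | and A B ihA ihB => intro Δ Δ' ρ s h; simp only [Fm.den, Fm.sub, ihA ρ s h.1, ihB ρ s h.2]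
  | or A B ihA ihB => intro Δ Δ' ρ s h; simp only [Fm.den, Fm.sub, ihA ρ s h.1, ihB ρ s h.2]
  | imp A B ihA ihB => intro Δ Δ' ρ s h; simp only [Fm.den, Fm.sub, ihA ρ s h.1, ihB ρ s h.2]
  | all A ih => intro Δ Δ' ρ s h; simp only [Fm.den, Fm.sub, ih _ _ h, Env.lift_sub_lift]
  | ex A ih => intro Δ Δ' ρ s h; simp only [Fm.den, Fm.sub, ih _ _ h, Env.lift_sub_lift]

theorem Rules.qint_sub (q : L.Q) (n : ℕ) : ∀ Δ Δ' e (s : Sub L Δ Δ'),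
    (E.qint q n Δ e).sub s = E.qint q n Δ' (e.sub s) := by
  refine E.qint_induction (M := fun q n => ∀ Δ Δ' e (s : Sub L Δ Δ'),
    (E.qint q n Δ e).sub s = E.qint q n Δ' (e.sub s)) ?_ q n
  intro q n IH Δ Δ' e s
  cases n with
  | zero => rw [qint_zero, qint_zero]; exact Fm.den_sub_of E IH _ e s (E.qbase_qCalls q e)
  | succ n =>
    rw [qint_succ, qint_succ, Fm.den_sub_of E IH _ _ s (E.qstep_qCalls q n e), Env.cons_sub]; rfl

theorem Fm.den_sub_val {Γ Δ Δ' : List Ty} (A : Fm L Γ) (ρ : Env L Γ Δ) (s : Sub L Δ Δ') :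
    (A.den E E.qint ρ).sub s = A.den E E.qint (ρ.sub s) :=
  Fm.den_sub_of E (fun q n _ => E.qint_sub q n) A ρ s (A.qCalls_true E ρ)

theorem Sub.den_lift {Γ Θ Δ : List Ty} (σ : Sub L Γ Θ) (ρ : Env L Θ Δ) :
    (fun τ v => (σ.lift Ty.ind τ v).den (E.dint _) ρ.lift)
      = Env.lift fun τ v => (σ τ v).den (E.dint _) ρ := by
  funext τ v
  cases v with
  | zero => rfl
  | succ v => exact Tm.den_weaken_lift E _ _

theorem Sub.den_cons {Γ Θ Δ : List Ty} {υ : Ty} (J : DInt L Δ) (t : Tm L Θ υ) (σ : Sub L Γ Θ)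
    (ρ : Env L Θ Δ) : (fun τ v => (Sub.cons t σ τ v).den J ρ)
      = Env.cons (t.den J ρ) fun τ v => (σ τ v).den J ρ := by
  funext τ v; cases v <;> rfl

theorem Fm.den_sub {J : QInt L} {Γ : List Ty} (A : Fm L Γ) :
    ∀ {Θ Δ : List Ty} (σ : Sub L Γ Θ) (ρ : Env L Θ Δ),
      (A.sub σ).den E J ρ = A.den E J fun τ v => (σ τ v).den (E.dint Δ) ρ := by
  induction A with
  | pr p as => intros; simp only [Fm.sub, Fm.den, Tm.den_sub]
  | dpr q t as => intros; simp only [Fm.sub, Fm.den, Tm.den_sub]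
  | neg A ih => intros; simp only [Fm.sub, Fm.den, ih]
  | and A B ihA ihB => intros; simp only [Fm.sub, Fm.den, ihA, ihB]
  | or A B ihA ihB => intros; simp only [Fm.sub, Fm.den, ihA, ihB]
  | imp A B ihA ihB => intros; simp only [Fm.sub, Fm.den, ihA, ihB]
  | all A ih => intros; simp only [Fm.sub, Fm.den, ih, Sub.den_lift]
  | ex A ih => intros; simp only [Fm.sub, Fm.den, ih, Sub.den_lift]

/-- Normalization commutes with the instantiation of a quantifier, hence preserves the quantifier
rules. -/
theorem Fm.den_inst {Γ Δ : List Ty} (A : Fm L (Ty.ind :: Γ)) (t : Tm L Γ Ty.ind) (ρ : Env L Γ Δ) :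
    (A.inst t).den E E.qint ρ
      = (A.den E E.qint ρ.lift).inst (t.den (E.dint Δ) ρ : Tm L Δ Ty.ind) := by
  rw [Fm.inst, Fm.inst, Fm.den_sub, Fm.den_sub_val, Env.lift_sub_cons, Sub.den_cons]; rfl

/-! #### Soundness and completeness of the value for rewriting -/

theorem Fm.Red.den_eq {Γ : List Ty} {A A' : Fm L Γ} (h : A.Red E A') :
    ∀ {Δ : List Ty} (ρ : Env L Γ Δ), A.den E E.qint ρ = A'.den E E.qint ρ := by
  induction h with
  | refl t => intros; rfl
  | trans _ _ ih₁ ih₂ => intro Δ ρ; rw [ih₁, ih₂]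
  | pr p h => intro Δ ρ; simp only [Fm.den, fun τ v => (h τ v).den_eq E ρ]
  | dpr q h₁ h => intro Δ ρ; simp only [Fm.den, fun τ v => (h τ v).den_eq E ρ, h₁.den_eq E ρ]
  | neg _ ih => intro Δ ρ; simp only [Fm.den, ih]
  | and _ _ ih₁ ih₂ => intro Δ ρ; simp only [Fm.den, ih₁, ih₂]
  | or _ _ ih₁ ih₂ => intro Δ ρ; simp only [Fm.den, ih₁, ih₂]
  | imp _ _ ih₁ ih₂ => intro Δ ρ; simp only [Fm.den, ih₁, ih₂]
  | all _ ih => intro Δ ρ; simp only [Fm.den, ih]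
  | ex _ ih => intro Δ ρ; simp only [Fm.den, ih]
  | qzero q as => intro Δ ρ; rw [Fm.den_sub]; exact E.qint_zero _ _
  | qsucc q t as =>
    intro Δ ρ; rw [Fm.den_sub, Sub.den_cons]; exact E.qint_succ _ _ _

theorem Fm.EqE.den_eq {Γ Δ : List Ty} {A A' : Fm L Γ} (h : A.EqE E A') (ρ : Env L Γ Δ) :
    A.den E E.qint ρ = A'.den E E.qint ρ := by
  induction h with
  | rel _ _ h => exact h.den_eq E ρ
  | refl => rfl
  | symm _ _ _ ih => exact ih.symm
  | trans _ _ _ _ _ ih₁ ih₂ => exact ih₁.trans ih₂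

theorem Tm.Red.sub {Γ : List Ty} {τ : Ty} {t t' : Tm L Γ τ} (h : t.Red E t') :
    ∀ {Δ : List Ty} (s : Sub L Γ Δ), (t.sub s).Red E (t'.sub s) := by
  induction h with
  | refl t => intros; exact .refl _
  | trans _ _ ih₁ ih₂ => intro Δ s; exact .trans (ih₁ s) (ih₂ s)
  | app _ _ ih₁ ih₂ => intro Δ s; exact .app (ih₁ s) (ih₂ s)
  | lam _ ih => intro Δ s; exact .lam (ih _)
  | succ _ ih => intro Δ s; exact .succ (ih _)
  | con f _ ih => intro Δ s; exact .con f fun τ v => ih τ v s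
  | dfn d _ _ ih₁ ih => intro Δ s; exact .dfn d (ih₁ s) fun τ v => ih τ v s
  | beta t u =>
    intro Δ s
    have := Tm.Red.beta (E := E) (t.sub (s.lift _)) (u.sub s)
    rwa [Tm.sub_sub, Sub.lift_comp_cons, Sub.comp_id,
      show Sub.cons (u.sub s) s = (Sub.cons u Sub.id).comp s by rw [Sub.cons_comp]; rfl,
      ← Tm.sub_sub] at this
  | dzero d as => intro Δ s; rw [Tm.sub_sub]; exact .dzero d _
  | dsucc d t as =>
    intro Δ s; rw [Tm.sub_sub, Sub.cons_comp, Sub.cons_comp]; exact .dsucc d _ _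

theorem Val.Red.sub {Δ Δ' : List Ty} {τ : Ty} {t : Tm L Δ τ} {a : Val L Δ τ} (h : Val.Red E t a)
    (s : Sub L Δ Δ') : Val.Red E (t.sub s) (a.sub s) := by
  match τ, t, a, h with
  | .base .o, t, n, h =>
    have := Tm.Red.sub E h s
    rwa [Tm.num_sub] at this
  | .base .i, t, n, h => exact Tm.Red.sub E h s
  | .seq, t, f, h =>
    intro n
    have := Tm.Red.sub E (h n) s
    rwa [Tm.sub, Tm.num_sub] at this

theorem Env.red_lift {Γ Δ : List Ty} {σ : Sub L Γ Δ} {ρ : Env L Γ Δ}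
    (h : ∀ τ v, Val.Red E (σ τ v) (ρ τ v)) :
    ∀ τ v, Val.Red E (σ.lift Ty.ind τ v) (ρ.lift τ v) := by
  intro τ v
  cases v with
  | zero => exact Tm.Red.refl _
  | succ v =>
    have := (h τ v).sub E (fun _ v => Tm.var (Var.succ (υ := Ty.ind) v))
    rwa [Tm.sub_ren_eq_weaken] at this

/-- The form of `Fm.red_den` that is relativized to the calls satisfying `P`. -/
theorem Fm.red_of {P : L.Q → ℕ → Prop}
    (hJ : ∀ q n, P q n → ∀ Δ (as : Sub L (L.qargs q) Δ) e, (∀ τ v, Val.Red E (as τ v) (e τ v)) →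
      (Fm.dpr q (Tm.num n) as).Red E (E.qint q n Δ e)) {Γ : List Ty} (A : Fm L Γ) :
    ∀ {Δ : List Ty} (σ : Sub L Γ Δ) (ρ : Env L Γ Δ), (∀ τ v, Val.Red E (σ τ v) (ρ τ v)) →
      A.QCalls E P ρ → (A.sub σ).Red E (A.den E E.qint ρ) := by
  induction A with
  | pr p as =>
    intro Δ σ ρ h _
    refine Fm.Red.pr p fun τ v => ?_
    obtain ⟨b, rfl⟩ := exists_base_of_var v
    exact (Val.red_den E _ σ ρ h).reify
  | dpr q t as =>
    intro Δ σ ρ h hP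
    exact .trans (.dpr q (Val.red_den E t σ ρ h) fun τ v => .refl _)
      (hJ _ _ hP _ _ _ fun τ v => Val.red_den E _ σ ρ h)
  | neg A ih => intro Δ σ ρ h hP; exact .neg (ih σ ρ h hP)
  | and A B ihA ihB => intro Δ σ ρ h hP; exact .and (ihA σ ρ h hP.1) (ihB σ ρ h hP.2)
  | or A B ihA ihB => intro Δ σ ρ h hP; exact .or (ihA σ ρ h hP.1) (ihB σ ρ h hP.2)
  | imp A B ihA ihB => intro Δ σ ρ h hP; exact .imp (ihA σ ρ h hP.1) (ihB σ ρ h hP.2)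
  | all A ih => intro Δ σ ρ h hP; exact .all (ih _ _ (Env.red_lift E h) hP)
  | ex A ih => intro Δ σ ρ h hP; exact .ex (ih _ _ (Env.red_lift E h) hP)

theorem Rules.qint_red (q : L.Q) (n : ℕ) :
    ∀ Δ (as : Sub L (L.qargs q) Δ) e, (∀ τ v, Val.Red E (as τ v) (e τ v)) →
      (Fm.dpr q (Tm.num n) as).Red E (E.qint q n Δ e) := by
  refine E.qint_induction (M := fun q n => ∀ Δ (as : Sub L (L.qargs q) Δ) e,
    (∀ τ v, Val.Red E (as τ v) (e τ v)) →
      (Fm.dpr q (Tm.num n) as).Red E (E.qint q n Δ e)) ?_ q n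
  intro q n IH Δ as e h
  cases n with
  | zero =>
    rw [qint_zero]
    exact .trans (.qzero q as) (Fm.red_of E IH _ as e h (E.qbase_qCalls q e))
  | succ n =>
    rw [qint_succ]
    refine .trans (.qsucc q _ as) (Fm.red_of E IH _ _ _ ?_ (E.qstep_qCalls q n e))
    intro τ v
    cases v with
    | zero => exact Tm.Red.refl _
    | succ v => exact h _ v

/-- Every instance of a formula rewrites to its value. -/
theorem Fm.red_den {Γ Δ : List Ty} (A : Fm L Γ) (σ : Sub L Γ Δ) (ρ : Env L Γ Δ)
    (h : ∀ τ v, Val.Red E (σ τ v) (ρ τ v)) : (A.sub σ).Red E (A.den E E.qint ρ) :=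
  Fm.red_of E (fun q n _ => E.qint_red q n) A σ ρ h (A.qCalls_true E ρ)

/-! #### Values are normal, and ground for ground formulas -/

theorem Tm.Normal.ren {Γ : List Ty} {τ : Ty} {t : Tm L Γ τ} :
    ∀ {Δ : List Ty} (r : Ren Γ Δ), t.Normal → (t.ren r).Normal := by
  induction t <;> intros <;> simp_all [Tm.Normal, Tm.ren]

theorem Tm.V2Free.ren {Γ : List Ty} {τ : Ty} {t : Tm L Γ τ} :
    ∀ {Δ : List Ty} (r : Ren Γ Δ), t.V2Free → (t.ren r).V2Free := by
  induction t <;> intros <;> simp_all [Tm.V2Free, Tm.ren]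

theorem Env.all_lift {Q : ∀ {Δ : List Ty}, Tm L Δ Ty.ind → Prop}
    (hv : ∀ {Δ : List Ty} (v : Var Δ Ty.ind), Q (.var v))
    (hQ : ∀ {Δ : List Ty} (t : Tm L Δ Ty.ind), Q t → Q (t.weaken Ty.ind))
    {Γ Δ : List Ty} {ρ : Env L Γ Δ} (h : ∀ τ v, Val.All Q (ρ τ v)) :
    ∀ τ v, Val.All Q (ρ.lift τ v) := by
  intro τ v
  cases v with
  | zero => exact hv _
  | succ v =>
    change Val.All Q ((ρ τ v).sub _)
    match τ, ρ τ v, h τ v with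
    | .base .o, _, _ => trivial
    | .base .i, t, h => simp only [Val.sub, Tm.sub_ren_eq_weaken]; exact hQ _ h
    | .seq, f, h => intro n; simp only [Val.sub, Tm.sub_ren_eq_weaken]; exact hQ _ (h n)

theorem Env.normal_lift {Γ Δ : List Ty} {ρ : Env L Γ Δ}
    (h : ∀ τ v, Val.All Tm.Normal (ρ τ v)) : ∀ τ v, Val.All Tm.Normal (ρ.lift τ v) :=
  Env.all_lift (Q := fun t => t.Normal) (fun _ => by simp only [Tm.Normal]) (fun _ ht => ht.ren _) h

theorem Env.v2Free_lift {Γ Δ : List Ty} {ρ : Env L Γ Δ}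
    (h : ∀ τ v, Val.All Tm.V2Free (ρ τ v)) : ∀ τ v, Val.All Tm.V2Free (ρ.lift τ v) :=
  Env.all_lift (Q := fun t => t.V2Free) (fun _ => by simp only [Tm.V2Free]) (fun _ ht => ht.ren _) h

theorem Fm.den_normal_of {P : L.Q → ℕ → Prop} {J : QInt L}
    (hJ : ∀ q n, P q n → ∀ Δ e, (∀ τ v, Val.All Tm.Normal (e τ v)) → (J q n Δ e).Normal)
    {Γ : List Ty} (A : Fm L Γ) : ∀ {Δ : List Ty} (ρ : Env L Γ Δ),
      (∀ τ v, Val.All Tm.Normal (ρ τ v)) → A.QCalls E P ρ → (A.den E J ρ).Normal := by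
  induction A with
  | pr p as =>
    intro Δ ρ h _ τ v
    obtain ⟨b, rfl⟩ := exists_base_of_var v
    exact (Tm.den_normal E _ ρ h).normal
  | dpr q t as => intro Δ ρ h hP; exact hJ _ _ hP _ _ fun τ v => Tm.den_normal E _ ρ h
  | neg A ih => intro Δ ρ h hP; exact ih ρ h hP
  | and A B ihA ihB => intro Δ ρ h hP; exact ⟨ihA ρ h hP.1, ihB ρ h hP.2⟩
  | or A B ihA ihB => intro Δ ρ h hP; exact ⟨ihA ρ h hP.1, ihB ρ h hP.2⟩
  | imp A B ihA ihB => intro Δ ρ h hP; exact ⟨ihA ρ h hP.1, ihB ρ h hP.2⟩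
  | all A ih => intro Δ ρ h hP; exact ih _ (Env.normal_lift h) hP
  | ex A ih => intro Δ ρ h hP; exact ih _ (Env.normal_lift h) hP

theorem Rules.qint_normal (q : L.Q) (n : ℕ) :
    ∀ Δ e, (∀ τ v, Val.All Tm.Normal (e τ v)) → (E.qint q n Δ e).Normal := by
  refine E.qint_induction (M := fun q n =>
    ∀ Δ e, (∀ τ v, Val.All Tm.Normal (e τ v)) → (E.qint q n Δ e).Normal) ?_ q n
  intro q n IH Δ e h
  cases n with
  | zero => rw [qint_zero]; exact Fm.den_normal_of E IH _ e h (E.qbase_qCalls q e)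
  | succ n =>
    rw [qint_succ]
    exact Fm.den_normal_of E IH _ _ (Env.all_cons trivial h) (E.qstep_qCalls q n e)

theorem Fm.den_normal {Γ Δ : List Ty} (A : Fm L Γ) (ρ : Env L Γ Δ)
    (h : ∀ τ v, Val.All Tm.Normal (ρ τ v)) : (A.den E E.qint ρ).Normal :=
  Fm.den_normal_of E (fun q n _ => E.qint_normal q n) A ρ h (A.qCalls_true E ρ)

theorem Fm.den_v2Free_of {P : L.Q → ℕ → Prop} {J : QInt L}
    (hJ : ∀ q n, P q n → ∀ Δ e, (∀ τ v, Val.All Tm.V2Free (e τ v)) → (J q n Δ e).V2Free)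
    {Γ : List Ty} (A : Fm L Γ) : ∀ {Δ : List Ty} (ρ : Env L Γ Δ), A.V2Free →
      (∀ τ v, Val.All Tm.V2Free (ρ τ v)) → A.QCalls E P ρ → (A.den E J ρ).V2Free := by
  induction A with
  | pr p as =>
    intro Δ ρ hA h _ τ v
    have := hA _ v
    obtain ⟨b, rfl⟩ := exists_base_of_var v
    exact (Tm.den_v2Free E _ ρ this h).v2Free
  | dpr q t as => intro Δ ρ hA h hP; exact hJ _ _ hP _ _ fun τ v => Tm.den_v2Free E _ ρ (hA.2 _ _) h
  | neg A ih => intro Δ ρ hA h hP; exact ih ρ hA h hP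
  | and A B ihA ihB => intro Δ ρ hA h hP; exact ⟨ihA ρ hA.1 h hP.1, ihB ρ hA.2 h hP.2⟩
  | or A B ihA ihB => intro Δ ρ hA h hP; exact ⟨ihA ρ hA.1 h hP.1, ihB ρ hA.2 h hP.2⟩
  | imp A B ihA ihB => intro Δ ρ hA h hP; exact ⟨ihA ρ hA.1 h hP.1, ihB ρ hA.2 h hP.2⟩
  | all A ih => intro Δ ρ hA h hP; exact ih _ hA (Env.v2Free_lift h) hP
  | ex A ih => intro Δ ρ hA h hP; exact ih _ hA (Env.v2Free_lift h) hP

theorem Rules.qint_v2Free (q : L.Q) (n : ℕ) :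
    ∀ Δ e, (∀ τ v, Val.All Tm.V2Free (e τ v)) → (E.qint q n Δ e).V2Free := by
  refine E.qint_induction (M := fun q n =>
    ∀ Δ e, (∀ τ v, Val.All Tm.V2Free (e τ v)) → (E.qint q n Δ e).V2Free) ?_ q n
  intro q n IH Δ e h
  cases n with
  | zero => rw [qint_zero]; exact Fm.den_v2Free_of E IH _ e (E.qbase_v2 q) h (E.qbase_qCalls q e)
  | succ n =>
    rw [qint_succ]
    exact Fm.den_v2Free_of E IH _ _ (E.qstep_v2 q) (Env.all_cons trivial h) (E.qstep_qCalls q n e)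

theorem Fm.den_v2Free {Γ Δ : List Ty} (A : Fm L Γ) (ρ : Env L Γ Δ) (hA : A.V2Free)
    (h : ∀ τ v, Val.All Tm.V2Free (ρ τ v)) : (A.den E E.qint ρ).V2Free :=
  Fm.den_v2Free_of E (fun q n _ => E.qint_v2Free q n) A ρ hA h (A.qCalls_true E ρ)

end FormulaDenotation

/-! ### Normal forms -/

section NormalForms

variable {L : Lang}

/-- The environment is the identity, on a context of individual variables only. -/
def Env.IsId {Γ : List Ty} (ρ : Env L Γ Γ) : Prop :=
  ∀ τ v, τ = Ty.ind ∧ (ρ τ v).reify = .var v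

theorem Env.IsId.lift {Γ : List Ty} {ρ : Env L Γ Γ} (h : ρ.IsId) : ρ.lift.IsId := by
  intro τ v
  cases v with
  | zero => exact ⟨rfl, rfl⟩
  | succ v =>
    obtain ⟨rfl, h⟩ := h τ v
    refine ⟨rfl, ?_⟩
    change Tm.sub _ (ρ _ v) = _
    rw [show ρ _ v = Tm.var v from h]; rfl

/-- The term is the one that represents the value. -/
def Val.Reps {Δ : List Ty} : ∀ {τ : Ty}, Tm L Δ τ → Val L Δ τ → Prop
  | .base .o, t, n => t = Tm.num n
  | .base .i, t, u => t = u
  | .seq, t, f => ∀ n, .app t (Tm.num n) = f n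

theorem Val.Reps.reify {Δ : List Ty} {b : Srt} {t : Tm L Δ (Ty.base b)} {a : Val L Δ (Ty.base b)}
    (h : Val.Reps t a) : a.reify = t := by
  cases b with
  | o => exact h.symm
  | i => exact h.symm

/-- A normal expression is its own value. -/
theorem Tm.Normal.reps {Γ : List Ty} (J : DInt L Γ) {ρ : Env L Γ Γ} (hρ : ρ.IsId) {τ : Ty}
    {t : Tm L Γ τ} (h : t.Normal) : Val.Reps t (t.den J ρ) := by
  induction t with
  | var v => obtain ⟨rfl, e⟩ := hρ _ v; exact e.symm
  | v2 x => intro n; rfl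
  | app u t ihu iht =>
    have h₂ : t = Tm.num _ := iht J hρ h.2
    change Tm.app u t = _
    conv_lhs => rw [h₂]
    exact ihu J hρ h.1 _
  | lam t ih => exact h.elim
  | zero => rfl
  | succ t ih =>
    have h₂ : t = Tm.num _ := ih J hρ h
    change Tm.succ t = _
    conv_lhs => rw [h₂]
    rfl
  | con f as ih =>
    change Tm.con f as = Tm.con f _
    congr 1; funext τ v
    have := ih τ v J hρ (h τ v)
    obtain ⟨b, rfl⟩ := exists_base_of_var v
    exact this.reify.symm
  | dfn d t as iht ih => exact h.elim

theorem Fm.Normal.den_eq {E : Rules L} {Γ : List Ty} (J : QInt L) {A : Fm L Γ} :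
    ∀ {ρ : Env L Γ Γ}, ρ.IsId → A.Normal → A.den E J ρ = A := by
  induction A with
  | pr p as =>
    intro ρ hρ h
    simp only [Fm.den]
    congr 1; funext τ v
    have := Tm.Normal.reps (E.dint _) hρ (h τ v)
    obtain ⟨b, rfl⟩ := exists_base_of_var v
    exact this.reify
  | dpr q t as => intro ρ hρ h; exact h.elim
  | neg A ih => intro ρ hρ h; simp only [Fm.den, ih hρ h]
  | and A B ihA ihB => intro ρ hρ h; simp only [Fm.den, ihA hρ h.1, ihB hρ h.2]
  | or A B ihA ihB => intro ρ hρ h; simp only [Fm.den, ihA hρ h.1, ihB hρ h.2]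
  | imp A B ihA ihB => intro ρ hρ h; simp only [Fm.den, ihA hρ h.1, ihB hρ h.2]
  | all A ih => intro ρ hρ h; simp only [Fm.den, ih hρ.lift h]
  | ex A ih => intro ρ hρ h; simp only [Fm.den, ih hρ.lift h]

variable (E : Rules L)

theorem Env.IsId.red {Γ : List Ty} {ρ : Env L Γ Γ} (hρ : ρ.IsId) :
    ∀ τ v, Val.Red E (Sub.id τ v) (ρ τ v) := by
  intro τ v
  obtain ⟨rfl, h⟩ := hρ τ v
  change Tm.Red E _ (ρ _ v)
  rw [show ρ _ v = Tm.var v from h]; exact .refl _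

theorem Env.IsId.normal {Γ : List Ty} {ρ : Env L Γ Γ} (hρ : ρ.IsId) :
    ∀ τ v, Val.All Tm.Normal (ρ τ v) := by
  intro τ v
  obtain ⟨rfl, h⟩ := hρ τ v
  change Tm.Normal (ρ _ v)
  rw [show ρ _ v = Tm.var v from h]; trivial

/-- Each formula whose variables are individual variables has a normal form. -/
theorem Fm.red_den_id {Γ : List Ty} {ρ : Env L Γ Γ} (hρ : ρ.IsId) (A : Fm L Γ) :
    A.Red E (A.den E E.qint ρ) := by
  have := A.red_den E Sub.id ρ (hρ.red E)
  rwa [Fm.sub_id] at this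

theorem Tm.red_den_id {Γ : List Ty} {ρ : Env L Γ Γ} (hρ : ρ.IsId) {b : Srt}
    (t : Tm L Γ (Ty.base b)) : t.Red E (t.den (E.dint Γ) ρ).reify := by
  have := (Val.red_den E t Sub.id ρ (hρ.red E)).reify
  rwa [Tm.sub_id] at this

/-- The normal form is the value; in particular it exists and is unique. -/
theorem Fm.nf_eq {Γ : List Ty} {ρ : Env L Γ Γ} (hρ : ρ.IsId) (A : Fm L Γ) :
    A.nf E = A.den E E.qint ρ := by
  have h : ∃ A', A.Red E A' ∧ A'.Normal := ⟨_, A.red_den_id E hρ, A.den_normal E ρ hρ.normal⟩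
  rw [Fm.nf, dif_pos h, h.choose_spec.1.den_eq E ρ, h.choose_spec.2.den_eq _ hρ]

theorem Tm.nf_eq {Γ : List Ty} {ρ : Env L Γ Γ} (hρ : ρ.IsId) {b : Srt} (t : Tm L Γ (Ty.base b)) :
    t.nf E = (t.den (E.dint Γ) ρ).reify := by
  have h : ∃ t' : Tm L Γ (Ty.base b), t.Red E t' ∧ t'.Normal :=
    ⟨_, t.red_den_id E hρ, (t.den_normal E ρ hρ.normal).normal⟩
  rw [Tm.nf, dif_pos h, h.choose_spec.1.den_eq E ρ, (h.choose_spec.2.reps _ hρ).reify]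

/-- The empty environment. -/
def Env.nil {Δ : List Ty} : Env L [] Δ := fun _ v => nomatch v

theorem Env.isId_nil : (Env.nil : Env L [] []).IsId := fun _ v => nomatch v

/-- The values, in the closed context, of a substitution. -/
noncomputable def Sub.env {Γ : List Ty} (σ : Sub L Γ []) : Env L Γ [] :=
  fun τ v => (σ τ v).den (E.dint []) Env.nil

/-- The normal form of an instance depends on the substitution only through its values. -/
theorem Fm.nf_sub {Γ : List Ty} (A : Fm L Γ) (σ : Sub L Γ []) :
    (A.sub σ).nf E = A.den E E.qint (σ.env E) := by
  rw [Fm.nf_eq E Env.isId_nil, Fm.den_sub]; rfl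

theorem Fm.nf_sub_lift {Γ : List Ty} (A : Fm L (Ty.ind :: Γ)) (σ : Sub L Γ []) :
    (A.sub (σ.lift Ty.ind)).nf E = A.den E E.qint (σ.env E).lift := by
  rw [Fm.nf_eq E Env.isId_nil.lift, Fm.den_sub, Sub.den_lift]; rfl

theorem Tm.nf_sub {Γ : List Ty} {b : Srt} (t : Tm L Γ (Ty.base b)) (σ : Sub L Γ []) :
    (t.sub σ).nf E = (t.den (E.dint []) (σ.env E)).reify := by
  rw [Tm.nf_eq E Env.isId_nil, Tm.den_sub]; rfl

theorem Sub.env_normal {Γ : List Ty} (σ : Sub L Γ []) : ∀ τ v, Val.All Tm.Normal (σ.env E τ v) :=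
  fun _ _ => Tm.den_normal E _ _ Env.isId_nil.normal

end NormalForms

/-! ### Marked and unmarked occurrences -/

section Marks

variable {α β : Type}

@[simp] theorem pick_nil (b : Bool) (m : List Bool) : pick b ([] : List α) m = [] := rfl

@[simp] theorem pick_cons (b b' : Bool) (a : α) (l : List α) (m : List Bool) :
    pick b (a :: l) (b' :: m) = if b' = b then a :: pick b l m else pick b l m := by
  by_cases h : b' = b <;> simp [pick, h]

theorem pick_map (f : α → β) (b : Bool) (l : List α) (m : List Bool) :
    pick b (l.map f) m = (pick b l m).map f := by
  induction l generalizing m with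
  | nil => rfl
  | cons a l ih =>
    cases m with
    | nil => rfl
    | cons b' m => rw [List.map_cons, pick_cons, pick_cons, ih]; split <;> rfl

theorem pick_append (b : Bool) (l l' : List α) (m : List Bool) :
    pick b (l ++ l') m = pick b l (m.take l.length) ++ pick b l' (m.drop l.length) := by
  induction l generalizing m with
  | nil => rfl
  | cons a l ih =>
    cases m with
    | nil => simp [pick]
    | cons b' m =>
      simp only [List.cons_append, pick_cons, ih, List.length_cons, List.take_succ_cons,
        List.drop_succ_cons]
      split <;> rfl

theorem pick_replicate (b : Bool) (l : List α) : pick b l (List.replicate l.length b) = l := by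
  induction l with
  | nil => rfl
  | cons a l ih => simp [List.replicate_succ, ih]

theorem toFront_eq {i : ℕ} {l : List α} (h : i < l.length) : toFront i l = l[i] :: l.eraseIdx i := by
  simp [toFront, List.getElem?_eq_getElem h]

theorem length_toFront {i : ℕ} {l : List α} (h : i < l.length) :
    (toFront i l).length = l.length := by
  rw [toFront_eq h, List.length_cons, List.length_eraseIdx_of_lt h]; omega

theorem toFront_perm {i : ℕ} {l : List α} (h : i < l.length) : (toFront i l).Perm l := by
  rw [toFront_eq h]; exact List.getElem_cons_eraseIdx_perm h

theorem length_fromFront {i : ℕ} {l : List α} (h : i < l.length) :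
    (fromFront i l).length = l.length := by
  cases l with
  | nil => rfl
  | cons a l =>
    simp only [List.length_cons] at h
    rw [fromFront, List.length_insertIdx_of_le_length (by omega), List.length_cons]

/-- Moving an occurrence to the front and its mark along with it keeps the marked elements. -/
theorem pick_toFront (b : Bool) {i : ℕ} {l : List α} {m : List Bool} (h : i < l.length)
    (hm : m.length = l.length) :
    (pick b (toFront i l) m).Perm (pick b l (fromFront i m)) := by
  cases m with
  | nil => simp only [List.length_nil] at hm; omega
  | cons b' m =>
    rw [toFront_eq h, fromFront]
    simp only [List.length_cons] at hm
    induction i generalizing l m with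
    | zero =>
      cases l with
      | nil => simp at h
      | cons a l => simp
    | succ i ih =>
      cases l with
      | nil => simp at h
      | cons a l =>
        cases m with
        | nil => simp only [List.length_cons, List.length_nil] at hm h; omega
        | cons b'' m =>
          simp only [List.length_cons] at hm h
          have := ih (l := l) (by omega) m (by omega)
          simp only [List.getElem_cons_succ, List.eraseIdx_cons_succ, List.insertIdx_succ_cons,
            pick_cons] at this ⊢
          by_cases h₁ : b' = b <;> by_cases h₂ : b'' = b <;> simp only [h₁, h₂, if_true, if_false] at this ⊢
          · exact (List.Perm.swap _ _ _).trans (this.cons a)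
          · exact this
          · exact this.cons a
          · exact this

end Marks

section Sequents

variable {L : Lang} {E : Rules L}

theorem Seq.Same.refl {Γ : List Ty} (s : Seq L Γ) : s.Same s := ⟨.refl _, .refl _⟩

theorem Seq.Same.symm {Γ : List Ty} {s s' : Seq L Γ} (h : s.Same s') : s'.Same s :=
  ⟨h.1.symm, h.2.symm⟩

theorem Seq.Same.trans {Γ : List Ty} {s s' s'' : Seq L Γ} (h : s.Same s') (h' : s'.Same s'') :
    s.Same s'' := ⟨h.1.trans h'.1, h.2.trans h'.2⟩

theorem Seq.Same.map {Γ Δ : List Ty} {s s' : Seq L Γ} (T : Tr L Γ Δ) (h : s.Same s') :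
    (s.map T).Same (s'.map T) := ⟨h.1.map _, h.2.map _⟩

theorem perm_append_comm_four {α : Type} (l₁ l₂ l₃ l₄ : List α) :
    ((l₁ ++ l₂) ++ (l₃ ++ l₄)).Perm ((l₁ ++ l₃) ++ (l₂ ++ l₄)) := by
  simp only [List.append_assoc]
  refine List.Perm.append_left _ ?_
  rw [← List.append_assoc, ← List.append_assoc]
  exact List.Perm.append_right _ List.perm_append_comm

theorem Seq.Same.comp {Γ : List Ty} {s₁ s₁' s₂ s₂' : Seq L Γ} (h₁ : s₁.Same s₁')
    (h₂ : s₂.Same s₂') : (s₁.comp s₂).Same (s₁'.comp s₂') :=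
  ⟨h₁.1.append h₂.1, h₁.2.append h₂.2⟩

theorem Clause.toSeq_comp {Γ : List Ty} (C D : Clause L Γ) :
    (C.comp D).toSeq = C.toSeq.comp D.toSeq := by
  simp [Clause.toSeq, Clause.comp, Seq.comp]

theorem Seq.map_comp {Γ Δ : List Ty} (T : Tr L Γ Δ) (s s' : Seq L Γ) :
    (s.comp s').map T = (s.map T).comp (s'.map T) := by
  simp [Seq.map, Seq.comp]

theorem Seq.map_unmarked {Γ Δ : List Ty} (T : Tr L Γ Δ) (s : Seq L Γ) (c : Config) :
    (s.unmarked c).map T = (s.map T).unmarked c := by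
  simp [Seq.map, Seq.unmarked, pick_map]

theorem Seq.NoStrong.of_same {Γ : List Ty} {s s' : Seq L Γ} (h : s.Same s') (hs : s.NoStrong) :
    s'.NoStrong :=
  ⟨fun A hA => hs.1 A (h.1.mem_iff.2 hA), fun A hA => hs.2 A (h.2.mem_iff.2 hA)⟩

theorem Seq.NoStrong.of_comp {Γ : List Ty} {s s' : Seq L Γ} (h : (s.comp s').NoStrong) :
    s.NoStrong ∧ s'.NoStrong :=
  ⟨⟨fun A hA => h.1 A (List.mem_append_left _ hA), fun A hA => h.2 A (List.mem_append_left _ hA)⟩,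
   ⟨fun A hA => h.1 A (List.mem_append_right _ hA), fun A hA => h.2 A (List.mem_append_right _ hA)⟩⟩

theorem Fm.NoStrong.sub {Γ : List Ty} {A : Fm L Γ} : ∀ {b : Bool} {Δ : List Ty} (s : Sub L Γ Δ),
    A.NoStrong b → (A.sub s).NoStrong b := by
  induction A with
  | pr p as => intros; trivial
  | dpr q t as => intros; trivial
  | neg A ih => intro b Δ s h; exact ih s h
  | and A B ihA ihB => intro b Δ s h; exact ⟨ihA s h.1, ihB s h.2⟩
  | or A B ihA ihB => intro b Δ s h; exact ⟨ihA s h.1, ihB s h.2⟩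
  | imp A B ihA ihB => intro b Δ s h; exact ⟨ihA s h.1, ihB s h.2⟩
  | all A ih => intro b Δ s h; exact ⟨h.1, ih _ h.2⟩
  | ex A ih => intro b Δ s h; exact ⟨h.1, ih _ h.2⟩

/-- The configuration has a mark for each occurrence of the sequent. -/
def Config.Fits {Γ : List Ty} (c : Config) (s : Seq L Γ) : Prop :=
  c.ant.length = s.ant.length ∧ c.suc.length = s.suc.length

theorem Config.Fits.map {Γ Δ : List Ty} {c : Config} {s : Seq L Γ} (h : c.Fits s) (T : Tr L Γ Δ) :
    c.Fits (s.map T) := by simpa [Config.Fits, Seq.map] using h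

theorem Config.Fits.of_map {Γ Δ : List Ty} {c : Config} {s : Seq L Γ} {T : Tr L Γ Δ}
    (h : c.Fits (s.map T)) : c.Fits s := by simpa [Config.Fits, Seq.map] using h

/-- The rule is neither a strong quantifier rule nor the equality rule. -/
def URule.Weak {Γ : List Ty} : URule L Γ → Prop
  | .allR _ _ _ => False
  | .exL _ _ _ => False
  | .eqv _ => False
  | _ => True

theorem URule.up_fits {Γ : List Ty} {r : URule L Γ} {s : Seq L Γ} {c : Config}
    (h : r.OK E s) (hc : c.Fits (r.concl s)) : (r.up c).Fits s := by
  obtain ⟨a, d⟩ := s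
  obtain ⟨m, n⟩ := c
  cases r with
  | eqv s' =>
    have h₁ := h.1.length_eq
    have h₂ := h.2.length_eq
    exact ⟨hc.1.trans h₁.symm, hc.2.trans h₂.symm⟩
  | frontL i =>
    have := length_toFront h
    simp only [URule.concl, Config.Fits, URule.up] at hc this ⊢
    refine ⟨?_, hc.2⟩
    rw [length_fromFront (by rw [hc.1, this]; exact h), hc.1, this]
  | frontR i =>
    have := length_toFront h
    simp only [URule.concl, Config.Fits, URule.up] at hc this ⊢
    refine ⟨hc.1, ?_⟩
    rw [length_fromFront (by rw [hc.2, this]; exact h), hc.2, this]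
  | allR A x t =>
    obtain ⟨l, rfl, -⟩ := h
    simpa [Config.Fits, URule.concl, URule.up] using hc
  | exL A x t =>
    obtain ⟨l, rfl, -⟩ := h
    simpa [Config.Fits, URule.concl, URule.up] using hc
  | impR A B =>
    obtain ⟨⟨l, rfl⟩, l', rfl⟩ := h
    simpa [Config.Fits, URule.concl, URule.up] using hc
  | wL A =>
    simp only [Config.Fits, URule.concl, URule.up, List.length_cons, List.length_tail] at hc ⊢
    omega
  | wR A =>
    simp only [Config.Fits, URule.concl, URule.up, List.length_cons, List.length_tail] at hc ⊢
    omega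
  | cL A =>
    obtain ⟨l, rfl⟩ := h
    simpa [Config.Fits, URule.concl, URule.up] using hc
  | cR A =>
    obtain ⟨l, rfl⟩ := h
    simpa [Config.Fits, URule.concl, URule.up] using hc
  | negL A =>
    obtain ⟨l, rfl⟩ := h
    simp only [Config.Fits, URule.concl, URule.up, List.length_cons, List.length_tail] at hc ⊢
    omega
  | negR A =>
    obtain ⟨l, rfl⟩ := h
    simp only [Config.Fits, URule.concl, URule.up, List.length_cons, List.length_tail] at hc ⊢
    omega
  | _ =>
    obtain ⟨l, rfl⟩ := h
    exact hc

/-- A rule with unmarked principal formula acts on the unmarked part of the premise. -/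
theorem URule.unmarked_of_not_skip {Γ : List Ty} {r : URule L Γ} {s : Seq L Γ} {c : Config}
    (h : r.OK E s) (hc : c.Fits (r.concl s)) (hr : r.Weak) (hs : r.skip c = false) :
    r.OK E (s.unmarked (r.up c)) ∧
      (r.concl s).unmarked c = r.concl (s.unmarked (r.up c)) := by
  obtain ⟨a, d⟩ := s
  obtain ⟨m, n⟩ := c
  cases r with
  | eqv s' => exact hr.elim
  | allR A x t => exact hr.elim
  | exL A x t => exact hr.elim
  | frontL i => cases hs
  | frontR i => cases hs
  | impR A B =>
    obtain ⟨⟨l, rfl⟩, l', rfl⟩ := h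
    rcases n with _ | ⟨b, n⟩
    · simp [Config.Fits, URule.concl] at hc
    · simp only [URule.skip, List.headD_cons] at hs
      subst hs
      simp [Seq.unmarked, URule.concl, URule.up, URule.OK]
  | wL A =>
    rcases m with _ | ⟨b, m⟩
    · simp [Config.Fits, URule.concl] at hc
    · simp only [URule.skip, List.headD_cons] at hs
      subst hs
      simp [Seq.unmarked, URule.concl, URule.up, URule.OK]
  | wR A =>
    rcases n with _ | ⟨b, n⟩
    · simp [Config.Fits, URule.concl] at hc
    · simp only [URule.skip, List.headD_cons] at hs
      subst hs
      simp [Seq.unmarked, URule.concl, URule.up, URule.OK]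
  | _ =>
    obtain ⟨l, rfl⟩ := h
    first
    | (rcases m with _ | ⟨b, m⟩
       · simp [Config.Fits, URule.concl] at hc
       · simp only [URule.skip, List.headD_cons] at hs
         subst hs
         simp [Seq.unmarked, URule.concl, URule.up, URule.OK])
    | (rcases n with _ | ⟨b, n⟩
       · simp [Config.Fits, URule.concl] at hc
       · simp only [URule.skip, List.headD_cons] at hs
         subst hs
         simp [Seq.unmarked, URule.concl, URule.up, URule.OK])

/-- A strong quantifier rule with unmarked principal formula leaves that formula in the unmarked
part of the conclusion. -/
theorem URule.weak_of_noStrong {Γ Δ : List Ty} {r : URule L Γ} {s : Seq L Γ} {c : Config}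
    (hc : c.Fits (r.concl s)) (hs : r.skip c = false) (T : Tr L Γ Δ)
    (hall : ∀ A, ∃ B, T.fm (.all A) = .all B) (hex : ∀ A, ∃ B, T.fm (.ex A) = .ex B)
    (hn : (((r.concl s).unmarked c).map T).NoStrong) : r.Weak := by
  obtain ⟨m, n⟩ := c
  cases r with
  | eqv s' => cases hs
  | allR A x t =>
    rcases n with _ | ⟨b, n⟩
    · simp [Config.Fits, URule.concl] at hc
    · simp only [URule.skip, List.headD_cons] at hs
      subst hs
      obtain ⟨B, hB⟩ := hall A
      have := hn.2 (T.fm (.all A)) (by simp [Seq.map, Seq.unmarked, URule.concl])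
      rw [hB] at this
      cases this.1
  | exL A x t =>
    rcases m with _ | ⟨b, m⟩
    · simp [Config.Fits, URule.concl] at hc
    · simp only [URule.skip, List.headD_cons] at hs
      subst hs
      obtain ⟨B, hB⟩ := hex A
      have := hn.1 (T.fm (.ex A)) (by simp [Seq.map, Seq.unmarked, URule.concl])
      rw [hB] at this
      cases this.1
  | _ => trivial

/-- An omitted rule does not change the unmarked part of the sequent. -/
theorem URule.unmarked_of_skip {Γ : List Ty} {r : URule L Γ} {s : Seq L Γ} {c : Config}
    (h : r.OK E s) (hc : c.Fits (r.concl s)) (hr : ∀ s', r ≠ .eqv s') (hs : r.skip c = true) :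
    ((r.concl s).unmarked c).Same (s.unmarked (r.up c)) := by
  obtain ⟨a, d⟩ := s
  obtain ⟨m, n⟩ := c
  cases r with
  | eqv s' => exact (hr s' rfl).elim
  | frontL i =>
    refine ⟨pick_toFront false h ?_, .refl _⟩
    rw [hc.1]; exact length_toFront h
  | frontR i =>
    refine ⟨.refl _, pick_toFront false h ?_⟩
    rw [hc.2]; exact length_toFront h
  | allR A x t =>
    obtain ⟨l, rfl, -⟩ := h
    rcases n with _ | ⟨b, n⟩
    · simp [Config.Fits, URule.concl] at hc
    · simp only [URule.skip, List.headD_cons] at hs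
      subst hs
      simp [Seq.unmarked, URule.concl, URule.up, Seq.Same]
  | exL A x t =>
    obtain ⟨l, rfl, -⟩ := h
    rcases m with _ | ⟨b, m⟩
    · simp [Config.Fits, URule.concl] at hc
    · simp only [URule.skip, List.headD_cons] at hs
      subst hs
      simp [Seq.unmarked, URule.concl, URule.up, Seq.Same]
  | impR A B =>
    obtain ⟨⟨l, rfl⟩, l', rfl⟩ := h
    rcases n with _ | ⟨b, n⟩
    · simp [Config.Fits, URule.concl] at hc
    · simp only [URule.skip, List.headD_cons] at hs
      subst hs
      simp [Seq.unmarked, URule.concl, URule.up, Seq.Same]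
  | wL A =>
    rcases m with _ | ⟨b, m⟩
    · simp [Config.Fits, URule.concl] at hc
    · simp only [URule.skip, List.headD_cons] at hs
      subst hs
      simp [Seq.unmarked, URule.concl, URule.up, Seq.Same]
  | wR A =>
    rcases n with _ | ⟨b, n⟩
    · simp [Config.Fits, URule.concl] at hc
    · simp only [URule.skip, List.headD_cons] at hs
      subst hs
      simp [Seq.unmarked, URule.concl, URule.up, Seq.Same]
  | _ =>
    obtain ⟨l, rfl⟩ := h
    first
    | (rcases m with _ | ⟨b, m⟩
       · simp [Config.Fits, URule.concl] at hc
       · simp only [URule.skip, List.headD_cons] at hs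
         subst hs
         simp [Seq.unmarked, URule.concl, URule.up, Seq.Same])
    | (rcases n with _ | ⟨b, n⟩
       · simp [Config.Fits, URule.concl] at hc
       · simp only [URule.skip, List.headD_cons] at hs
         subst hs
         simp [Seq.unmarked, URule.concl, URule.up, Seq.Same])

theorem BRule.up_fits {Γ : List Ty} {r : BRule L Γ} {s s' : Seq L Γ} {c : Config}
    (h : r.OK s s') (hc : c.Fits (r.concl s s')) :
    (r.upLeft s c).Fits s ∧ (r.upRight s c).Fits s' := by
  obtain ⟨a, d⟩ := s
  obtain ⟨a', d'⟩ := s'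
  cases r <;>
  · obtain ⟨⟨l, rfl⟩, l', rfl⟩ := h
    simp [Config.Fits, BRule.concl, BRule.upLeft, BRule.upRight] at hc ⊢
    omega

/-- A binary rule with marked auxiliary formulas merges the unmarked parts of its premises. -/
theorem BRule.unmarked_of_marked {Γ : List Ty} {r : BRule L Γ} {s s' : Seq L Γ} {c : Config}
    (h : r.OK s s') (hc : c.Fits (r.concl s s')) (hm : r.marked c = true) :
    (r.concl s s').unmarked c
      = (s.unmarked (r.upLeft s c)).comp (s'.unmarked (r.upRight s c)) := by
  obtain ⟨a, d⟩ := s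
  obtain ⟨a', d'⟩ := s'
  obtain ⟨m, n⟩ := c
  cases r with
  | andR A B =>
    obtain ⟨⟨l, rfl⟩, l', rfl⟩ := h
    rcases n with _ | ⟨b, n⟩
    · simp [Config.Fits, BRule.concl] at hc
    · simp only [BRule.marked, List.headD_cons] at hm
      subst hm
      simp [Seq.unmarked, BRule.concl, BRule.upLeft, BRule.upRight, Seq.comp, pick_append]
  | orL A B =>
    obtain ⟨⟨l, rfl⟩, l', rfl⟩ := h
    rcases m with _ | ⟨b, m⟩
    · simp [Config.Fits, BRule.concl] at hc
    · simp only [BRule.marked, List.headD_cons] at hm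
      subst hm
      simp [Seq.unmarked, BRule.concl, BRule.upLeft, BRule.upRight, Seq.comp, pick_append]
  | impL A B =>
    obtain ⟨⟨l, rfl⟩, l', rfl⟩ := h
    rcases m with _ | ⟨b, m⟩
    · simp [Config.Fits, BRule.concl] at hc
    · simp only [BRule.marked, List.headD_cons] at hm
      subst hm
      simp [Seq.unmarked, BRule.concl, BRule.upLeft, BRule.upRight, Seq.comp, pick_append]
  | cut A =>
    obtain ⟨⟨l, rfl⟩, l', rfl⟩ := h
    simp [Seq.unmarked, BRule.concl, BRule.upLeft, BRule.upRight, Seq.comp, pick_append]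

/-- A binary rule with unmarked auxiliary formulas acts on the unmarked parts of its premises. -/
theorem BRule.unmarked_of_not_marked {Γ : List Ty} {r : BRule L Γ} {s s' : Seq L Γ} {c : Config}
    (h : r.OK s s') (hc : c.Fits (r.concl s s')) (hm : r.marked c = false) :
    r.OK (s.unmarked (r.upLeft s c)) (s'.unmarked (r.upRight s c)) ∧
    (r.concl s s').unmarked c
      = r.concl (s.unmarked (r.upLeft s c)) (s'.unmarked (r.upRight s c)) := by
  obtain ⟨a, d⟩ := s
  obtain ⟨a', d'⟩ := s'
  obtain ⟨m, n⟩ := c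
  cases r with
  | andR A B =>
    obtain ⟨⟨l, rfl⟩, l', rfl⟩ := h
    rcases n with _ | ⟨b, n⟩
    · simp [Config.Fits, BRule.concl] at hc
    · simp only [BRule.marked, List.headD_cons] at hm
      subst hm
      simp [Seq.unmarked, BRule.concl, BRule.upLeft, BRule.upRight, BRule.OK, pick_append]
  | orL A B =>
    obtain ⟨⟨l, rfl⟩, l', rfl⟩ := h
    rcases m with _ | ⟨b, m⟩
    · simp [Config.Fits, BRule.concl] at hc
    · simp only [BRule.marked, List.headD_cons] at hm
      subst hm
      simp [Seq.unmarked, BRule.concl, BRule.upLeft, BRule.upRight, BRule.OK, pick_append]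
  | impL A B =>
    obtain ⟨⟨l, rfl⟩, l', rfl⟩ := h
    rcases m with _ | ⟨b, m⟩
    · simp [Config.Fits, BRule.concl] at hc
    · simp only [BRule.marked, List.headD_cons] at hm
      subst hm
      simp [Seq.unmarked, BRule.concl, BRule.upLeft, BRule.upRight, BRule.OK, pick_append]
  | cut A => cases hm

end Sequents

/-! ### Uniform operations on rules and sequents -/

section Transport

variable {L : Lang} {E : Rules L}

/-- The operation commutes with the logical connectives, the quantifiers and atoms. -/
structure Tr.Hom {Γ Δ : List Ty} (T : Tr L Γ Δ) : Prop where
  neg : ∀ A, T.fm (.neg A) = .neg (T.fm A)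
  and : ∀ A B, T.fm (.and A B) = .and (T.fm A) (T.fm B)
  or : ∀ A B, T.fm (.or A B) = .or (T.fm A) (T.fm B)
  imp : ∀ A B, T.fm (.imp A B) = .imp (T.fm A) (T.fm B)
  all : ∀ A, T.fm (.all A) = .all (T.fmI A)
  ex : ∀ A, T.fm (.ex A) = .ex (T.fmI A)
  atom : ∀ A : Atm L Γ, T.fm A.toFm = (A.map T.tm).toFm

/-- The operation by which an expression is replaced by its value. -/
noncomputable def Tr.den (E : Rules L) {Γ Δ : List Ty} (ρ : Env L Γ Δ) : Tr L Γ Δ :=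
  ⟨fun t => (t.den (E.dint Δ) ρ).reify, fun A => A.den E E.qint ρ, fun A => A.den E E.qint ρ.lift⟩

theorem Tr.den_hom {Γ Δ : List Ty} (ρ : Env L Γ Δ) : (Tr.den E ρ).Hom := by
  constructor <;> intros <;> rfl

theorem Tr.psub_hom {Γ : List Ty} (σ : PSub L) : (Tr.psub σ : Tr L Γ Γ).Hom := by
  constructor <;> intros <;> rfl

theorem map_toFront {α β : Type} (f : α → β) (i : ℕ) (l : List α) :
    (toFront i l).map f = toFront i (l.map f) := by
  simp only [toFront, List.map_append, List.getElem?_map, List.eraseIdx_map]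
  cases l[i]? <;> rfl

theorem URule.concl_map {Γ Δ : List Ty} {T : Tr L Γ Δ} (hT : T.Hom) (r : URule L Γ) (s : Seq L Γ) :
    (r.map T).concl (s.map T) = (r.concl s).map T := by
  cases r <;> simp [URule.map, URule.concl, Seq.map, hT.neg, hT.and, hT.or, hT.imp, hT.all, hT.ex,
    map_toFront]

/-- Rules other than the strong quantifier rules and the equality rule are preserved by every
uniform operation that commutes with the instantiation of quantifiers; no eigenvariable condition
is involved. -/
theorem URule.ok_map {Γ Δ : List Ty} {T : Tr L Γ Δ} {r : URule L Γ}
    (hT : ∀ A t, r = .allL A t ∨ r = .exR A t → T.fm (A.inst t) = (T.fmI A).inst (T.tm t))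
    {s : Seq L Γ} (hr : r.Weak) (h : r.OK E s) : (r.map T).OK E (s.map T) := by
  obtain ⟨a, d⟩ := s
  cases r with
  | allR A x t => exact hr.elim
  | exL A x t => exact hr.elim
  | eqv s => exact hr.elim
  | allL A t => obtain ⟨l, rfl⟩ := h; exact ⟨l.map T.fm, by simp [Seq.map, hT]⟩
  | exR A t => obtain ⟨l, rfl⟩ := h; exact ⟨l.map T.fm, by simp [Seq.map, hT]⟩
  | impR A B =>
    obtain ⟨⟨l, rfl⟩, l', rfl⟩ := h
    exact ⟨⟨l.map T.fm, rfl⟩, l'.map T.fm, rfl⟩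
  | wL A => trivial
  | wR A => trivial
  | frontL i => simpa [URule.map, URule.OK, Seq.map] using h
  | frontR i => simpa [URule.map, URule.OK, Seq.map] using h
  | _ => obtain ⟨l, rfl⟩ := h; exact ⟨l.map T.fm, rfl⟩

theorem BRule.concl_map {Γ Δ : List Ty} {T : Tr L Γ Δ} (hT : T.Hom) (r : BRule L Γ)
    (s s' : Seq L Γ) : (r.map T).concl (s.map T) (s'.map T) = (r.concl s s').map T := by
  cases r <;> simp [BRule.map, BRule.concl, Seq.map, hT.and, hT.or, hT.imp]

theorem BRule.ok_map {Γ Δ : List Ty} {T : Tr L Γ Δ} {r : BRule L Γ} {s s' : Seq L Γ}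
    (h : r.OK s s') : (r.map T).OK (s.map T) (s'.map T) := by
  obtain ⟨a, d⟩ := s
  obtain ⟨a', d'⟩ := s'
  cases r <;>
  · obtain ⟨⟨l, rfl⟩, l', rfl⟩ := h
    exact ⟨⟨l.map T.fm, rfl⟩, l'.map T.fm, rfl⟩

theorem URule.Weak.map {Γ Δ : List Ty} {T : Tr L Γ Δ} {r : URule L Γ} (h : r.Weak) :
    (r.map T).Weak := by
  cases r <;> exact h

/-- The unary rules that may occur in projections: no strong quantifier rule and no equality rule,
and the rule data are in normal form. -/
def URule.Plain {Γ : List Ty} : URule L Γ → Prop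
  | .negL A => A.Normal
  | .negR A => A.Normal
  | .andL1 A B => A.Normal ∧ B.Normal
  | .andL2 A B => A.Normal ∧ B.Normal
  | .orR1 A B => A.Normal ∧ B.Normal
  | .orR2 A B => A.Normal ∧ B.Normal
  | .impR A B => A.Normal ∧ B.Normal
  | .allL A t => A.Normal ∧ t.Normal
  | .allR _ _ _ => False
  | .exL _ _ _ => False
  | .exR A t => A.Normal ∧ t.Normal
  | .wL A => A.Normal
  | .wR A => A.Normal
  | .cL A => A.Normal
  | .cR A => A.Normal
  | .eqv _ => False
  | .frontL _ => True
  | .frontR _ => True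

/-- The binary rules that may occur in projections. -/
def BRule.Plain {Γ : List Ty} : BRule L Γ → Prop
  | .andR A B => A.Normal ∧ B.Normal
  | .orL A B => A.Normal ∧ B.Normal
  | .impL A B => A.Normal ∧ B.Normal
  | .cut _ => False

/-- All inferences are of the kind that may occur in projections, and there are no links. -/
def Pf.Plain {K : ProofSyms L} {Γ : List Ty} : Pf L K Γ → Prop
  | .ax A => A.toFm.Normal
  | .link _ _ _ => False
  | .un r π => r.Plain ∧ π.Plain
  | .bin r π₁ π₂ => r.Plain ∧ π₁.Plain ∧ π₂.Plain

theorem URule.Plain.weak {Γ : List Ty} {r : URule L Γ} (h : r.Plain) : r.Weak := by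
  cases r <;> first | exact h.elim | trivial

theorem URule.plain_den {Γ Δ : List Ty} {ρ : Env L Γ Δ} (hρ : ∀ τ v, Val.All Tm.Normal (ρ τ v))
    {r : URule L Γ} (hr : r.Weak) : (r.map (Tr.den E ρ)).Plain := by
  have h₁ : ∀ A, ((Tr.den E ρ).fm A).Normal := fun A => A.den_normal E ρ hρ
  have h₂ : ∀ A, ((Tr.den E ρ).fmI A).Normal := fun A => A.den_normal E _ (Env.normal_lift hρ)
  have h₃ : ∀ t : Tm L Γ Ty.ind, ((Tr.den E ρ).tm t).Normal := fun t => (t.den_normal E ρ hρ).normal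
  cases r <;> simp_all [URule.map, URule.Plain, URule.Weak]

theorem BRule.plain_den {Γ Δ : List Ty} {ρ : Env L Γ Δ} (hρ : ∀ τ v, Val.All Tm.Normal (ρ τ v))
    {r : BRule L Γ} (hr : ∀ A, r ≠ .cut A) : (r.map (Tr.den E ρ)).Plain := by
  have h₁ : ∀ A, ((Tr.den E ρ).fm A).Normal := fun A => A.den_normal E ρ hρ
  cases r <;> simp_all [BRule.map, BRule.Plain]

/-- The premise of a rule on formulas without strong quantifiers has none, either. -/
theorem URule.noStrong_premise {Γ : List Ty} {r : URule L Γ} {s : Seq L Γ} (h : r.OK E s)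
    (hr : r.Weak) (hn : (r.concl s).NoStrong) : s.NoStrong := by
  obtain ⟨a, d⟩ := s
  cases r with
  | allR A x t => exact hr.elim
  | exL A x t => exact hr.elim
  | eqv s => exact hr.elim
  | allL A t =>
    obtain ⟨l, rfl⟩ := h
    simp only [Seq.NoStrong, URule.concl, List.tail_cons, List.forall_mem_cons, Fm.NoStrong] at hn ⊢
    exact ⟨⟨hn.1.1.2.sub _, hn.1.2⟩, hn.2⟩
  | exR A t =>
    obtain ⟨l, rfl⟩ := h
    simp only [Seq.NoStrong, URule.concl, List.tail_cons, List.forall_mem_cons, Fm.NoStrong] at hn ⊢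
    exact ⟨hn.1, hn.2.1.2.sub _, hn.2.2⟩
  | frontL i => exact ⟨fun A hA => hn.1 A ((toFront_perm h).mem_iff.2 hA), hn.2⟩
  | frontR i => exact ⟨hn.1, fun A hA => hn.2 A ((toFront_perm h).mem_iff.2 hA)⟩
  | impR A B =>
    obtain ⟨⟨l, rfl⟩, l', rfl⟩ := h
    simp_all [Seq.NoStrong, URule.concl, Fm.NoStrong]
  | wL A => simp_all [Seq.NoStrong, URule.concl]
  | wR A => simp_all [Seq.NoStrong, URule.concl]
  | _ =>
    obtain ⟨l, rfl⟩ := h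
    simp_all [Seq.NoStrong, URule.concl, Fm.NoStrong]

/-- Cuts are excluded because a cut formula may contain strong quantifiers. -/
theorem BRule.noStrong_premises {Γ : List Ty} {r : BRule L Γ} {s s' : Seq L Γ} (h : r.OK s s')
    (hr : ∀ A, r ≠ .cut A) (hn : (r.concl s s').NoStrong) : s.NoStrong ∧ s'.NoStrong := by
  obtain ⟨a, d⟩ := s
  obtain ⟨a', d'⟩ := s'
  cases r with
  | cut A => exact (hr A rfl).elim
  | andR A B =>
    obtain ⟨⟨l, rfl⟩, l', rfl⟩ := h
    simp only [Seq.NoStrong, BRule.concl, List.tail_cons, List.forall_mem_cons, Fm.NoStrong,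
      List.forall_mem_append] at hn ⊢
    tauto
  | orL A B =>
    obtain ⟨⟨l, rfl⟩, l', rfl⟩ := h
    simp only [Seq.NoStrong, BRule.concl, List.tail_cons, List.forall_mem_cons, Fm.NoStrong,
      List.forall_mem_append] at hn ⊢
    tauto
  | impL A B =>
    obtain ⟨⟨l, rfl⟩, l', rfl⟩ := h
    simp only [Seq.NoStrong, BRule.concl, List.tail_cons, List.forall_mem_cons, Fm.NoStrong,
      List.forall_mem_append, Bool.not_false] at hn ⊢
    tauto

end Transport

/-! ### Applying rules modulo exchange -/

section Apply

variable {L : Lang} {E : Rules L} {K : ProofSyms L} {Γ : List Ty}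

open Classical in
theorem toFront_idxOf {α : Type} {a : α} {l l' : List α} (h : l.Perm (a :: l')) :
    l.idxOf a < l.length ∧ ∃ l'', toFront (l.idxOf a) l = a :: l'' ∧ l''.Perm l' := by
  have ha : a ∈ l := h.mem_iff.2 List.mem_cons_self
  have hi : l.idxOf a < l.length := List.idxOf_lt_length_of_mem ha
  refine ⟨hi, l.eraseIdx (l.idxOf a), ?_, ?_⟩
  · rw [toFront_eq hi, List.getElem_idxOf]
  · have := List.getElem_cons_eraseIdx_perm hi
    rw [List.getElem_idxOf] at this
    exact (this.trans h).cons_inv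

theorem Pf.frontAnt_spec {π : Pf L K Γ} {A : Fm L Γ} {l : List (Fm L Γ)}
    (h : π.concl.ant.Perm (A :: l)) (hπ : π.Valid E) : (π.frontAnt A).Valid E ∧
      ∃ l', (π.frontAnt A).concl = ⟨A :: l', π.concl.suc⟩ ∧ l'.Perm l := by
  classical
  obtain ⟨hi, l', e, hp⟩ := toFront_idxOf h
  refine ⟨⟨hπ, ?_⟩, l', ?_, hp⟩
  · exact hi
  · simp only [Pf.frontAnt, Pf.concl, URule.concl]
    rw [← e]

theorem Pf.frontSuc_spec {π : Pf L K Γ} {A : Fm L Γ} {l : List (Fm L Γ)}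
    (h : π.concl.suc.Perm (A :: l)) (hπ : π.Valid E) : (π.frontSuc A).Valid E ∧
      ∃ l', (π.frontSuc A).concl = ⟨π.concl.ant, A :: l'⟩ ∧ l'.Perm l := by
  classical
  obtain ⟨hi, l', e, hp⟩ := toFront_idxOf h
  refine ⟨⟨hπ, ?_⟩, l', ?_, hp⟩
  · exact hi
  · simp only [Pf.frontSuc, Pf.concl, URule.concl]
    rw [← e]

theorem toFront_succ_cons {α : Type} {i : ℕ} {a b : α} {l l' : List α}
    (h : toFront i l = b :: l') (hi : i < l.length) : toFront (i + 1) (a :: l) = b :: a :: l' := by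
  rw [toFront_eq hi] at h
  rw [toFront_eq (by simpa using hi)]
  simp only [List.cons.injEq] at h
  simp [h.1, h.2]

theorem Pf.frontAnt2_spec {π : Pf L K Γ} {A : Fm L Γ} {l : List (Fm L Γ)}
    (h : π.concl.ant.Perm (A :: A :: l)) (hπ : π.Valid E) : (π.frontAnt2 A).Valid E ∧
      ∃ l', (π.frontAnt2 A).concl = ⟨A :: A :: l', π.concl.suc⟩ ∧ l'.Perm l := by
  classical
  obtain ⟨hv, l₁, e₁, hp₁⟩ := Pf.frontAnt_spec h hπ
  obtain ⟨hi, l', e, hp⟩ := toFront_idxOf hp₁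
  have ht : (π.frontAnt A).concl.ant.tail = l₁ := by rw [e₁]; rfl
  refine ⟨⟨hv, ?_⟩, l', ?_, hp⟩
  · simp only [URule.OK, ht]
    rw [e₁]
    exact Nat.succ_lt_succ hi
  · simp only [Pf.frontAnt2, Pf.concl, URule.concl, ht]
    rw [e₁, ← toFront_succ_cons e hi]

theorem Pf.frontSuc2_spec {π : Pf L K Γ} {A : Fm L Γ} {l : List (Fm L Γ)}
    (h : π.concl.suc.Perm (A :: A :: l)) (hπ : π.Valid E) : (π.frontSuc2 A).Valid E ∧
      ∃ l', (π.frontSuc2 A).concl = ⟨π.concl.ant, A :: A :: l'⟩ ∧ l'.Perm l := by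
  classical
  obtain ⟨hv, l₁, e₁, hp₁⟩ := Pf.frontSuc_spec h hπ
  obtain ⟨hi, l', e, hp⟩ := toFront_idxOf hp₁
  have ht : (π.frontSuc A).concl.suc.tail = l₁ := by rw [e₁]; rfl
  refine ⟨⟨hv, ?_⟩, l', ?_, hp⟩
  · simp only [URule.OK, ht]
    rw [e₁]
    exact Nat.succ_lt_succ hi
  · simp only [Pf.frontSuc2, Pf.concl, URule.concl, ht]
    rw [e₁, ← toFront_succ_cons e hi]

/-- A unary rule that is applicable to a part of the end-sequent of a proof can be applied to the
proof. -/
theorem URule.apply_spec {r : URule L Γ} {S D : Seq L Γ} (h : r.OK E S) (hr : r.Weak)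
    (hf : (∀ i, r ≠ .frontL i) ∧ ∀ i, r ≠ .frontR i) {φ : Pf L K Γ} (hφ : φ.Valid E)
    (hs : φ.concl.Same (S.comp D)) :
    (r.apply φ).Valid E ∧ (r.apply φ).concl.Same ((r.concl S).comp D) := by
  obtain ⟨a, d⟩ := S
  cases r with
  | allR A x t => exact hr.elim
  | exL A x t => exact hr.elim
  | eqv s => exact hr.elim
  | frontL i => exact (hf.1 i rfl).elim
  | frontR i => exact (hf.2 i rfl).elim
  | wL A => exact ⟨⟨hφ, trivial⟩, hs.1.cons _, hs.2⟩
  | wR A => exact ⟨⟨hφ, trivial⟩, hs.1, hs.2.cons _⟩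
  | negL A =>
    obtain ⟨l, rfl⟩ := h
    obtain ⟨hv, l', e, hp⟩ := Pf.frontSuc_spec hs.2 hφ
    refine ⟨⟨hv, l', by rw [e]⟩, ?_⟩
    simp only [URule.apply, Pf.concl, e, URule.concl, List.tail_cons]
    exact ⟨hs.1.cons _, hp⟩
  | negR A =>
    obtain ⟨l, rfl⟩ := h
    obtain ⟨hv, l', e, hp⟩ := Pf.frontAnt_spec hs.1 hφ
    refine ⟨⟨hv, l', by rw [e]⟩, ?_⟩
    simp only [URule.apply, Pf.concl, e, URule.concl, List.tail_cons]
    exact ⟨hp, hs.2.cons _⟩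
  | impR A B =>
    obtain ⟨⟨l, rfl⟩, l₁, rfl⟩ := h
    obtain ⟨hv, l', e, hp⟩ := Pf.frontAnt_spec hs.1 hφ
    obtain ⟨hv₂, l₂, e₂, hp₂⟩ := Pf.frontSuc_spec (π := φ.frontAnt A) (A := B) (by rw [e]; exact hs.2) hv
    refine ⟨⟨hv₂, ⟨l', by rw [e₂, e]⟩, l₂, by rw [e₂]⟩, ?_⟩
    simp only [URule.apply, Pf.concl, e₂, e, URule.concl, List.tail_cons]
    exact ⟨hp, hp₂.cons _⟩
  | cL A =>
    obtain ⟨l, rfl⟩ := h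
    obtain ⟨hv, l', e, hp⟩ := Pf.frontAnt2_spec hs.1 hφ
    refine ⟨⟨hv, l', by rw [e]⟩, ?_⟩
    simp only [URule.apply, Pf.concl, e, URule.concl, List.tail_cons]
    exact ⟨hp.cons _, hs.2⟩
  | cR A =>
    obtain ⟨l, rfl⟩ := h
    obtain ⟨hv, l', e, hp⟩ := Pf.frontSuc2_spec hs.2 hφ
    refine ⟨⟨hv, l', by rw [e]⟩, ?_⟩
    simp only [URule.apply, Pf.concl, e, URule.concl, List.tail_cons]
    exact ⟨hs.1, hp.cons _⟩
  | _ =>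
    obtain ⟨l, rfl⟩ := h
    first
    | (obtain ⟨hv, l', e, hp⟩ := Pf.frontAnt_spec hs.1 hφ
       refine ⟨⟨hv, l', by rw [e]⟩, ?_⟩
       simp only [URule.apply, Pf.concl, e, URule.concl, List.tail_cons]
       exact ⟨hp.cons _, hs.2⟩)
    | (obtain ⟨hv, l', e, hp⟩ := Pf.frontSuc_spec hs.2 hφ
       refine ⟨⟨hv, l', by rw [e]⟩, ?_⟩
       simp only [URule.apply, Pf.concl, e, URule.concl, List.tail_cons]
       exact ⟨hs.1, hp.cons _⟩)

theorem URule.plain_apply {r : URule L Γ} {φ : Pf L K Γ} (hr : r.Plain) (hφ : φ.Plain) :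
    (r.apply φ).Plain := by
  cases r <;> simp_all [URule.apply, Pf.Plain, Pf.frontAnt, Pf.frontSuc, Pf.frontAnt2,
    Pf.frontSuc2, URule.Plain]

theorem append_append_perm {α : Type} {l₁ l₂ m₁ m₂ n₁ n₂ : List α} (h₁ : l₁.Perm (m₁ ++ n₁))
    (h₂ : l₂.Perm (m₂ ++ n₂)) : (l₁ ++ l₂).Perm (m₁ ++ m₂ ++ (n₁ ++ n₂)) :=
  (h₁.append h₂).trans (perm_append_comm_four _ _ _ _)

/-- A binary rule that is applicable to parts of the end-sequents of two proofs can be applied to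
the proofs. -/
theorem BRule.apply_spec {r : BRule L Γ} {S₁ S₂ D₁ D₂ : Seq L Γ} (h : r.OK S₁ S₂)
    {φ₁ φ₂ : Pf L K Γ} (h₁ : φ₁.Valid E) (h₂ : φ₂.Valid E)
    (hs₁ : φ₁.concl.Same (S₁.comp D₁)) (hs₂ : φ₂.concl.Same (S₂.comp D₂)) :
    (r.apply φ₁ φ₂).Valid E ∧
      (r.apply φ₁ φ₂).concl.Same ((r.concl S₁ S₂).comp (D₁.comp D₂)) := by
  obtain ⟨a₁, d₁⟩ := S₁
  obtain ⟨a₂, d₂⟩ := S₂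
  cases r with
  | andR A B =>
    obtain ⟨⟨l, rfl⟩, l', rfl⟩ := h
    obtain ⟨hv₁, l₁, e₁, hp₁⟩ := Pf.frontSuc_spec hs₁.2 h₁
    obtain ⟨hv₂, l₂, e₂, hp₂⟩ := Pf.frontSuc_spec hs₂.2 h₂
    refine ⟨⟨hv₁, hv₂, ⟨l₁, by rw [e₁]⟩, l₂, by rw [e₂]⟩, ?_⟩
    simp only [BRule.apply, Pf.concl, e₁, e₂, BRule.concl, List.tail_cons]
    exact ⟨append_append_perm hs₁.1 hs₂.1, (append_append_perm hp₁ hp₂).cons _⟩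
  | orL A B =>
    obtain ⟨⟨l, rfl⟩, l', rfl⟩ := h
    obtain ⟨hv₁, l₁, e₁, hp₁⟩ := Pf.frontAnt_spec hs₁.1 h₁
    obtain ⟨hv₂, l₂, e₂, hp₂⟩ := Pf.frontAnt_spec hs₂.1 h₂
    refine ⟨⟨hv₁, hv₂, ⟨l₁, by rw [e₁]⟩, l₂, by rw [e₂]⟩, ?_⟩
    simp only [BRule.apply, Pf.concl, e₁, e₂, BRule.concl, List.tail_cons]
    exact ⟨(append_append_perm hp₁ hp₂).cons _, append_append_perm hs₁.2 hs₂.2⟩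
  | impL A B =>
    obtain ⟨⟨l, rfl⟩, l', rfl⟩ := h
    obtain ⟨hv₁, l₁, e₁, hp₁⟩ := Pf.frontSuc_spec hs₁.2 h₁
    obtain ⟨hv₂, l₂, e₂, hp₂⟩ := Pf.frontAnt_spec hs₂.1 h₂
    refine ⟨⟨hv₁, hv₂, ⟨l₁, by rw [e₁]⟩, l₂, by rw [e₂]⟩, ?_⟩
    simp only [BRule.apply, Pf.concl, e₁, e₂, BRule.concl, List.tail_cons]
    exact ⟨(append_append_perm hs₁.1 hp₂).cons _, append_append_perm hp₁ hs₂.2⟩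
  | cut A =>
    obtain ⟨⟨l, rfl⟩, l', rfl⟩ := h
    obtain ⟨hv₁, l₁, e₁, hp₁⟩ := Pf.frontSuc_spec hs₁.2 h₁
    obtain ⟨hv₂, l₂, e₂, hp₂⟩ := Pf.frontAnt_spec hs₂.1 h₂
    refine ⟨⟨hv₁, hv₂, ⟨l₁, by rw [e₁]⟩, l₂, by rw [e₂]⟩, ?_⟩
    simp only [BRule.apply, Pf.concl, e₁, e₂, BRule.concl, List.tail_cons]
    exact ⟨append_append_perm hs₁.1 hp₂, append_append_perm hp₁ hs₂.2⟩

theorem BRule.plain_apply {r : BRule L Γ} {φ₁ φ₂ : Pf L K Γ} (hr : r.Plain) (h₁ : φ₁.Plain)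
    (h₂ : φ₂.Plain) : (r.apply φ₁ φ₂).Plain := by
  cases r <;> simp_all [BRule.apply, Pf.Plain, Pf.frontAnt, Pf.frontSuc, URule.Plain, BRule.Plain]

theorem Pf.weakenBy_spec (s : Seq L Γ) {φ : Pf L K Γ} (hφ : φ.Valid E) :
    (φ.weakenBy s).Valid E ∧ (φ.weakenBy s).concl = s.comp φ.concl := by
  have h₁ : ∀ (l : List (Fm L Γ)) (ρ : Pf L K Γ), ρ.Valid E →
      (l.foldr (fun A ρ => Pf.un (.wL A) ρ) ρ).Valid E ∧
      (l.foldr (fun A ρ => Pf.un (.wL A) ρ) ρ).concl = ⟨l ++ ρ.concl.ant, ρ.concl.suc⟩ := by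
    intro l ρ hρ
    induction l with
    | nil => exact ⟨hρ, rfl⟩
    | cons A l ih =>
      refine ⟨⟨ih.1, trivial⟩, ?_⟩
      simp only [List.foldr_cons, Pf.concl, ih.2, URule.concl]; rfl
  have h₂ : ∀ (l : List (Fm L Γ)) (ρ : Pf L K Γ), ρ.Valid E →
      (l.foldr (fun A ρ => Pf.un (.wR A) ρ) ρ).Valid E ∧
      (l.foldr (fun A ρ => Pf.un (.wR A) ρ) ρ).concl = ⟨ρ.concl.ant, l ++ ρ.concl.suc⟩ := by
    intro l ρ hρ
    induction l with
    | nil => exact ⟨hρ, rfl⟩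
    | cons A l ih =>
      refine ⟨⟨ih.1, trivial⟩, ?_⟩
      simp only [List.foldr_cons, Pf.concl, ih.2, URule.concl]; rfl
  have h := h₁ s.ant φ hφ
  have h' := h₂ s.suc _ h.1
  exact ⟨h'.1, by rw [Pf.weakenBy, h'.2, h.2]; rfl⟩

theorem Pf.plain_weakenBy {s : Seq L Γ} {φ : Pf L K Γ} (hφ : φ.Plain)
    (hs : (∀ A ∈ s.ant, A.Normal) ∧ ∀ A ∈ s.suc, A.Normal) : (φ.weakenBy s).Plain := by
  have h₁ : ∀ (l : List (Fm L Γ)) (ρ : Pf L K Γ), (∀ A ∈ l, A.Normal) → ρ.Plain →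
      (l.foldr (fun A ρ => Pf.un (.wL A) ρ) ρ).Plain := by
    intro l ρ hl hρ
    induction l with
    | nil => exact hρ
    | cons A l ih =>
      rw [List.forall_mem_cons] at hl
      exact ⟨hl.1, ih hl.2⟩
  have h₂ : ∀ (l : List (Fm L Γ)) (ρ : Pf L K Γ), (∀ A ∈ l, A.Normal) → ρ.Plain →
      (l.foldr (fun A ρ => Pf.un (.wR A) ρ) ρ).Plain := by
    intro l ρ hl hρ
    induction l with
    | nil => exact hρ
    | cons A l ih =>
      rw [List.forall_mem_cons] at hl
      exact ⟨hl.1, ih hl.2⟩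
  exact h₂ _ _ hs.2 (h₁ _ _ hs.1 hφ)

end Apply

/-! ### Projections and characteristic clauses -/

section Projections

variable {L : Lang}

/-- The proof is a projection of `S ∘ C`. -/
structure Pf.IsProj (E : Rules L) {K : ProofSyms L} {Γ : List Ty} (S : Seq L Γ) (C : Clause L Γ)
    (φ : Pf L K Γ) : Prop where
  valid : φ.Valid E
  plain : φ.Plain
  concl : φ.concl.Same (S.comp C.toSeq)

/-- Each proof of the set is a projection for some clause of the clause set, and each clause has a
projection in the set. -/
structure Matches (E : Rules L) {K : ProofSyms L} {Γ : List Ty} (S : Seq L Γ)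
    (CL : Set (Clause L Γ)) (PR : Finset (Pf L K Γ)) : Prop where
  clause : ∀ φ ∈ PR, ∃ C ∈ CL, φ.IsProj E S C
  proof : ∀ C ∈ CL, ∃ φ ∈ PR, φ.IsProj E S C

variable {E : Rules L} {K : ProofSyms L} {Γ : List Ty}

theorem Matches.of_same {S S' : Seq L Γ} (h : S.Same S') {CL : Set (Clause L Γ)}
    {PR : Finset (Pf L K Γ)} (hm : Matches E S CL PR) : Matches E S' CL PR := by
  have key : ∀ C (φ : Pf L K Γ), φ.IsProj E S C → φ.IsProj E S' C := fun C φ hφ =>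
    ⟨hφ.valid, hφ.plain, hφ.concl.trans (h.comp (.refl _))⟩
  refine ⟨fun φ hφ => ?_, fun C hC => ?_⟩
  · obtain ⟨C, hC, hp⟩ := hm.clause φ hφ
    exact ⟨C, hC, key _ _ hp⟩
  · obtain ⟨φ, hφ, hp⟩ := hm.proof C hC
    exact ⟨φ, hφ, key _ _ hp⟩

open Classical in
theorem Matches.image {S S' : Seq L Γ} {CL : Set (Clause L Γ)} {PR : Finset (Pf L K Γ)}
    (hm : Matches E S CL PR) {f : Pf L K Γ → Pf L K Γ}
    (hf : ∀ C φ, φ.IsProj E S C → (f φ).IsProj E S' C) : Matches E S' CL (PR.image f) := by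
  refine ⟨fun φ hφ => ?_, fun C hC => ?_⟩
  · obtain ⟨φ, hφ', rfl⟩ := Finset.mem_image.1 hφ
    obtain ⟨C, hC, hp⟩ := hm.clause φ hφ'
    exact ⟨C, hC, hf _ _ hp⟩
  · obtain ⟨φ, hφ, hp⟩ := hm.proof C hC
    exact ⟨f φ, Finset.mem_image_of_mem f hφ, hf _ _ hp⟩

open Classical in
theorem Matches.union {S : Seq L Γ} {CL₁ CL₂ : Set (Clause L Γ)} {PR₁ PR₂ : Finset (Pf L K Γ)}
    (h₁ : Matches E S CL₁ PR₁) (h₂ : Matches E S CL₂ PR₂) :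
    Matches E S (CL₁ ∪ CL₂) (PR₁ ∪ PR₂) := by
  refine ⟨fun φ hφ => ?_, fun C hC => ?_⟩
  · rcases Finset.mem_union.1 hφ with h | h
    · obtain ⟨C, hC, hp⟩ := h₁.clause φ h
      exact ⟨C, .inl hC, hp⟩
    · obtain ⟨C, hC, hp⟩ := h₂.clause φ h
      exact ⟨C, .inr hC, hp⟩
  · rcases hC with h | h
    · obtain ⟨φ, hφ, hp⟩ := h₁.proof C h
      exact ⟨φ, Finset.mem_union_left _ hφ, hp⟩
    · obtain ⟨φ, hφ, hp⟩ := h₂.proof C h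
      exact ⟨φ, Finset.mem_union_right _ hφ, hp⟩

open Classical in
theorem Matches.image₂ {S₁ S₂ S : Seq L Γ} {CL₁ CL₂ : Set (Clause L Γ)}
    {PR₁ PR₂ : Finset (Pf L K Γ)} (h₁ : Matches E S₁ CL₁ PR₁) (h₂ : Matches E S₂ CL₂ PR₂)
    {f : Pf L K Γ → Pf L K Γ → Pf L K Γ}
    (hf : ∀ C₁ C₂ φ₁ φ₂, φ₁.IsProj E S₁ C₁ → φ₂.IsProj E S₂ C₂ →
      (f φ₁ φ₂).IsProj E S (C₁.comp C₂)) :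
    Matches E S (Set.image2 Clause.comp CL₁ CL₂) (Finset.image₂ f PR₁ PR₂) := by
  refine ⟨fun φ hφ => ?_, fun C hC => ?_⟩
  · obtain ⟨φ₁, hφ₁, φ₂, hφ₂, rfl⟩ := Finset.mem_image₂.1 hφ
    obtain ⟨C₁, hC₁, hp₁⟩ := h₁.clause φ₁ hφ₁
    obtain ⟨C₂, hC₂, hp₂⟩ := h₂.clause φ₂ hφ₂
    exact ⟨_, Set.mem_image2_of_mem hC₁ hC₂, hf _ _ _ _ hp₁ hp₂⟩
  · obtain ⟨C₁, hC₁, C₂, hC₂, rfl⟩ := hC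
    obtain ⟨φ₁, hφ₁, hp₁⟩ := h₁.proof C₁ hC₁
    obtain ⟨φ₂, hφ₂, hp₂⟩ := h₂.proof C₂ hC₂
    exact ⟨_, Finset.mem_image₂_of_mem hφ₁ hφ₂, hf _ _ _ _ hp₁ hp₂⟩

/-! #### Normal forms of instances -/

variable (E) in
theorem Atm.nf_sub (A : Atm L Γ) (σ : Sub L Γ []) :
    (A.map fun t => t.sub σ).map (fun t => t.nf E) = A.map (Tr.den E (σ.env E)).tm := by
  simp only [Atm.map]
  congr 1; funext τ v
  obtain ⟨b, rfl⟩ := exists_base_of_var v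
  exact Tm.nf_sub E _ _

variable (E) in
theorem Seq.nf_sub (s : Seq L Γ) (σ : Sub L Γ []) :
    (s.map (Tr.sub σ)).map (Tr.nf E) = s.map (Tr.den E (σ.env E)) := by
  simp only [Seq.map, List.map_map]
  congr 1 <;> exact List.map_congr_left fun A _ => Fm.nf_sub E A σ

variable (E) in
theorem URule.nf_sub (r : URule L Γ) (σ : Sub L Γ []) :
    (r.map (Tr.sub σ)).map (Tr.nf E) = r.map (Tr.den E (σ.env E)) := by
  have h₁ : ∀ A, (Tr.nf E).fm ((Tr.sub σ).fm A) = (Tr.den E (σ.env E)).fm A :=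
    fun A => Fm.nf_sub E A σ
  have h₂ : ∀ A, (Tr.nf E).fmI ((Tr.sub σ).fmI A) = (Tr.den E (σ.env E)).fmI A :=
    fun A => Fm.nf_sub_lift E A σ
  have h₃ : ∀ {b : Srt} (t : Tm L Γ (Ty.base b)),
      (Tr.nf E).tm ((Tr.sub σ).tm t) = (Tr.den E (σ.env E)).tm t :=
    fun t => Tm.nf_sub E t σ
  cases r <;> simp only [URule.map, h₁, h₂, h₃, Seq.nf_sub]

variable (E) in
theorem BRule.nf_sub (r : BRule L Γ) (σ : Sub L Γ []) :
    (r.map (Tr.sub σ)).map (Tr.nf E) = r.map (Tr.den E (σ.env E)) := by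
  have h₁ : ∀ A, (Tr.nf E).fm ((Tr.sub σ).fm A) = (Tr.den E (σ.env E)).fm A :=
    fun A => Fm.nf_sub E A σ
  cases r <;> simp only [BRule.map, h₁]

variable (E) in
theorem Tr.den_inst {Δ : List Ty} (ρ : Env L Γ Δ) (A : Fm L (Ty.ind :: Γ)) (t : Tm L Γ Ty.ind) :
    (Tr.den E ρ).fm (A.inst t) = ((Tr.den E ρ).fmI A).inst ((Tr.den E ρ).tm t) :=
  A.den_inst E t ρ

variable (E) in
theorem Seq.den_normal (s : Seq L Γ) (σ : Sub L Γ []) :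
    (∀ A ∈ (s.map (Tr.den E (σ.env E))).ant, A.Normal) ∧
      ∀ A ∈ (s.map (Tr.den E (σ.env E))).suc, A.Normal := by
  constructor <;>
  · intro A hA
    obtain ⟨B, -, rfl⟩ := List.mem_map.1 hA
    exact B.den_normal E _ (σ.env_normal E)

variable (E) in
/-- Closed terms of sort `o` have numerals as normal forms. -/
theorem Tm.exists_nf_num (t : Tm L [] Ty.nat) : ∃ n, t.nf E = Tm.num n :=
  ⟨_, Tm.nf_eq E (b := .o) Env.isId_nil t⟩

variable (E) in
theorem Tm.nf_num (n : ℕ) : (Tm.num n : Tm L [] _).nf E = Tm.num n := by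
  have h := Tm.nf_eq E (b := .o) Env.isId_nil (Tm.num n : Tm L [] _)
  rw [h]
  exact ((Tm.num_normal n).reps _ Env.isId_nil).reify

theorem List.map_eq_map_of_forall₂ {α β : Type} {R : α → α → Prop} {f : α → β} {l l' : List α}
    (h : List.Forall₂ R l l') (hf : ∀ a b, R a b → f a = f b) : l.map f = l'.map f := by
  induction h with
  | nil => rfl
  | cons h _ ih => rw [List.map_cons, List.map_cons, hf _ _ h, ih]

end Projections

section Evaluation

variable {L : Lang} {E : Rules L} (Ψ : ProofSchema L E)

/-- The normal forms of the characteristic term and the projection term of `ψ_j` at `n` match. -/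
def ProofSchema.MatchesAt (j : Fin (Ψ.K.m + 1)) (n : ℕ) : Prop :=
  ∀ (Ω : Config) (a : Tm L [] Ty.nat) (as : Sub L (Ψ.K.params j) []) (u : CST L Ψ.K [])
    (ξ : PT L Ψ.K []), a.nf E = Tm.num n → Ω.Fits (Ψ.K.endSeq j) →
    (((Ψ.K.endSeq j).unmarked Ω).map (Tr.den E ((Sub.cons a as).env E))).NoStrong →
    CST.Eval Ψ (.sym j Ω a as) u → PT.Eval Ψ (.sym j Ω a as) ξ →
    Matches E (((Ψ.K.endSeq j).unmarked Ω).map (Tr.den E ((Sub.cons a as).env E)))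
      u.clauses ξ.proofs

theorem Seq.sub_unmarked_den {Γ Θ : List Ty} (s : Seq L Θ) (τ : Sub L Θ Γ) (σ : Sub L Γ [])
    (c : Config) :
    (((s.map (Tr.sub τ)).unmarked c).map (Tr.den E (σ.env E)))
      = (s.unmarked c).map (Tr.den E ((τ.comp σ).env E)) := by
  rw [← Seq.nf_sub, ← Seq.nf_sub, ← Seq.map_unmarked]
  congr 1
  simp only [Seq.map, List.map_map]
  congr 1 <;> exact List.map_congr_left fun A _ => Fm.sub_sub A τ σ

/-- The projections of a proof of the schema match its characteristic clauses, provided that this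
holds for the symbols that its links refer to. -/
theorem Pf.matches_of_links {Γ : List Ty} (σ : Sub L Γ []) (π : Pf L Ψ.K Γ) :
    ∀ (c : Config), π.Valid E →
      π.Links (fun j a => ∀ n, (a.sub σ).nf E = Tm.num n → Ψ.MatchesAt j n) → c.Fits π.concl →
      ((π.concl.unmarked c).map (Tr.den E (σ.env E))).NoStrong →
      ∀ (u : CST L Ψ.K []) (ξ : PT L Ψ.K []), CST.Eval Ψ ((π.char c).map fun t => t.sub σ) u →
        PT.Eval Ψ ((π.proj c).map (Tr.sub σ)) ξ →
        Matches E ((π.concl.unmarked c).map (Tr.den E (σ.env E))) u.clauses ξ.proofs := by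
  induction π with
  | ax A =>
    intro c _ _ hc _ u ξ hu hξ
    obtain ⟨m, n⟩ := c
    simp only [Config.Fits, Pf.concl, List.length_cons, List.length_nil, zero_add,
      List.length_eq_one_iff] at hc
    obtain ⟨⟨b, rfl⟩, b', rfl⟩ := hc
    cases hu
    cases hξ
    have hproj : (Pf.ax (((A.map (Tr.sub σ).tm)).map fun t => t.nf E) : Pf L Ψ.K []).IsProj E
        ((((Pf.ax A : Pf L Ψ.K Γ).concl).unmarked ⟨[b], [b']⟩).map (Tr.den E (σ.env E)))
        (((⟨pick true [A] [b], pick true [A] [b']⟩ : Clause L Γ).map fun t => t.sub σ).map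
          fun t => t.nf E) := by
      have e : ((A.map (Tr.sub σ).tm).map fun t => t.nf E) = A.map (Tr.den E (σ.env E)).tm :=
        Atm.nf_sub E A σ
      have e' : ((A.map (fun t => t.sub σ)).map fun t => t.nf E) = A.map (Tr.den E (σ.env E)).tm :=
        Atm.nf_sub E A σ
      refine ⟨trivial, ?_, ?_⟩
      · rw [e]
        change ((Tr.den E (σ.env E)).fm A.toFm).Normal
        exact Fm.den_normal E _ _ (σ.env_normal E)
      · rw [e]
        cases b <;> cases b' <;>
          simp [Pf.concl, Seq.unmarked, Seq.map, Seq.comp, Seq.Same, Clause.toSeq, Clause.map, e',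
            (Tr.den_hom _).atom]
    constructor
    · intro φ hφ
      cases Finset.mem_singleton.1 hφ
      exact ⟨_, rfl, hproj⟩
    · intro C hC
      cases Set.mem_singleton_iff.1 hC
      exact ⟨_, Finset.mem_singleton_self _, hproj⟩
  | link j a as =>
    intro c _ hl hc hn u ξ hu hξ
    obtain ⟨n, hn'⟩ := Tm.exists_nf_num E (a.sub σ)
    have e : (((Pf.link j a as : Pf L Ψ.K Γ).concl.unmarked c).map (Tr.den E (σ.env E)))
        = ((Ψ.K.endSeq j).unmarked c).map
          (Tr.den E ((Sub.cons (a.sub σ) (as.comp σ)).env E)) := by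
      rw [← Sub.cons_comp, ← Seq.sub_unmarked_den]; rfl
    rw [e] at hn ⊢
    exact hl n hn' c (a.sub σ) (as.comp σ) u ξ hn' hc.of_map hn hu hξ
  | un r π ih =>
    intro c hv hl hc hn u ξ hu hξ
    obtain ⟨hv, hok⟩ := hv
    have hc' : (r.up c).Fits π.concl := URule.up_fits hok hc
    simp only [Pf.proj] at hξ
    by_cases hs : r.skip c = true
    · rw [if_pos hs] at hξ
      have hsame : (((Pf.un r π).concl.unmarked c).map (Tr.den E (σ.env E))).Same
          ((π.concl.unmarked (r.up c)).map (Tr.den E (σ.env E))) := by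
        by_cases he : ∃ s', r = .eqv s'
        · obtain ⟨s', rfl⟩ := he
          obtain ⟨h₁, h₂⟩ := hok
          have e₁ := List.map_eq_map_of_forall₂ h₁ (fun A B h => h.den_eq E (σ.env E))
          have e₂ := List.map_eq_map_of_forall₂ h₂ (fun A B h => h.den_eq E (σ.env E))
          rw [Seq.map_unmarked, Seq.map_unmarked]
          change (Seq.unmarked ⟨_, _⟩ c).Same (Seq.unmarked ⟨_, _⟩ c)
          simp only [Tr.den, Pf.concl, URule.concl, e₁, e₂]
          exact .refl _
        · exact (URule.unmarked_of_skip hok hc (fun s' h => he ⟨s', h⟩) hs).map _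
      exact (ih (r.up c) hv hl hc' (hn.of_same hsame) u ξ hu hξ).of_same hsame.symm
    · rw [if_neg hs] at hξ
      have hs : r.skip c = false := by simpa using hs
      have hw : r.Weak := URule.weak_of_noStrong hc hs _ (fun A => ⟨_, (Tr.den_hom _).all A⟩)
        (fun A => ⟨_, (Tr.den_hom _).ex A⟩) hn
      obtain ⟨hok', e⟩ := URule.unmarked_of_not_skip hok hc hw hs
      have hok'' := URule.ok_map (fun A t _ => Tr.den_inst E (σ.env E) A t) hw hok'
      have e' : ((Pf.un r π).concl.unmarked c).map (Tr.den E (σ.env E)) =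
          (r.map (Tr.den E (σ.env E))).concl
            ((π.concl.unmarked (r.up c)).map (Tr.den E (σ.env E))) := by
        rw [URule.concl_map (Tr.den_hom _), ← e]; rfl
      rw [e'] at hn ⊢
      cases hξ with
      | un _ hξ =>
        rw [PT.proofs, URule.nf_sub]
        refine (ih (r.up c) hv hl hc' (URule.noStrong_premise hok'' hw.map hn) u _ hu hξ).image ?_
        intro C φ hφ
        have hp : (r.map (Tr.den E (σ.env E))).Plain := URule.plain_den (σ.env_normal E) hw
        have hf : (∀ i, r.map (Tr.den E (σ.env E)) ≠ .frontL i) ∧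
            ∀ i, r.map (Tr.den E (σ.env E)) ≠ .frontR i := by
          cases r <;> simp_all [URule.map, URule.skip]
        have := URule.apply_spec hok'' hw.map hf hφ.valid hφ.concl
        exact ⟨this.1, URule.plain_apply hp hφ.plain, this.2⟩
  | bin r π₁ π₂ ih₁ ih₂ =>
    intro c hv hl hc hn u ξ hu hξ
    obtain ⟨hv₁, hv₂, hok⟩ := hv
    obtain ⟨hc₁, hc₂⟩ := BRule.up_fits hok hc
    simp only [Pf.proj] at hξ
    simp only [Pf.char] at hu
    by_cases hm : r.marked c = true
    · rw [if_pos hm] at hξ hu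
      have e : ((Pf.bin r π₁ π₂).concl.unmarked c).map (Tr.den E (σ.env E)) =
          ((π₁.concl.unmarked (r.upLeft π₁.concl c)).map (Tr.den E (σ.env E))).comp
            ((π₂.concl.unmarked (r.upRight π₁.concl c)).map (Tr.den E (σ.env E))) := by
        rw [← Seq.map_comp, ← BRule.unmarked_of_marked hok hc hm]; rfl
      rw [e] at hn ⊢
      cases hu with
      | plus hu₁ hu₂ =>
      cases hξ with
      | plus hξ₁ hξ₂ =>
      cases hξ₁ with
      | wk _ hξ₁ =>
      cases hξ₂ with
      | wk _ hξ₂ =>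
      simp only [CST.clauses, PT.proofs, Seq.nf_sub]
      refine Matches.union ?_ ?_
      · refine (ih₁ _ hv₁ hl.1 hc₁ hn.of_comp.1 _ _ hu₁ hξ₁).image ?_
        intro C φ hφ
        obtain ⟨hw, ec⟩ := Pf.weakenBy_spec
          ((π₂.concl.unmarked (r.upRight π₁.concl c)).map (Tr.den E (σ.env E))) hφ.valid
        refine ⟨hw, Pf.plain_weakenBy hφ.plain (Seq.den_normal E _ σ), ?_⟩
        rw [ec]
        have h := (Seq.Same.refl ((π₂.concl.unmarked (r.upRight π₁.concl c)).map
          (Tr.den E (σ.env E)))).comp hφ.concl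
        refine h.trans ⟨?_, ?_⟩
        · simp only [Seq.comp, ← List.append_assoc]
          exact List.perm_append_comm.append_right _
        · simp only [Seq.comp, ← List.append_assoc]
          exact List.perm_append_comm.append_right _
      · refine (ih₂ _ hv₂ hl.2 hc₂ hn.of_comp.2 _ _ hu₂ hξ₂).image ?_
        intro C φ hφ
        obtain ⟨hw, ec⟩ := Pf.weakenBy_spec
          ((π₁.concl.unmarked (r.upLeft π₁.concl c)).map (Tr.den E (σ.env E))) hφ.valid
        refine ⟨hw, Pf.plain_weakenBy hφ.plain (Seq.den_normal E _ σ), ?_⟩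
        rw [ec]
        refine ((Seq.Same.refl _).comp hφ.concl).trans ⟨?_, ?_⟩ <;>
        simp only [Seq.comp, List.append_assoc, List.Perm.refl]
    · rw [if_neg hm] at hξ hu
      have hm : r.marked c = false := by simpa using hm
      have hcut : ∀ A, r ≠ .cut A := by rintro A rfl; cases hm
      have hcut' : ∀ A, r.map (Tr.den E (σ.env E)) ≠ .cut A := by
        intro A; cases r <;> simp_all [BRule.map]
      obtain ⟨hok', e⟩ := BRule.unmarked_of_not_marked hok hc hm
      have hok'' := BRule.ok_map (T := Tr.den E (σ.env E)) hok'
      have e' : ((Pf.bin r π₁ π₂).concl.unmarked c).map (Tr.den E (σ.env E)) =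
          (r.map (Tr.den E (σ.env E))).concl
            ((π₁.concl.unmarked (r.upLeft π₁.concl c)).map (Tr.den E (σ.env E)))
            ((π₂.concl.unmarked (r.upRight π₁.concl c)).map (Tr.den E (σ.env E))) := by
        rw [BRule.concl_map (Tr.den_hom _), ← e]; rfl
      rw [e'] at hn ⊢
      obtain ⟨hn₁, hn₂⟩ := BRule.noStrong_premises hok'' hcut' hn
      cases hu with
      | times hu₁ hu₂ =>
      cases hξ with
      | times _ hξ₁ hξ₂ =>
      rw [CST.clauses, PT.proofs, BRule.nf_sub]
      refine (ih₁ _ hv₁ hl.1 hc₁ hn₁ _ _ hu₁ hξ₁).image₂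
        (ih₂ _ hv₂ hl.2 hc₂ hn₂ _ _ hu₂ hξ₂) ?_
      intro C₁ C₂ φ₁ φ₂ h₁ h₂
      have := BRule.apply_spec hok'' h₁.valid h₂.valid h₁.concl h₂.concl
      refine ⟨this.1, BRule.plain_apply (BRule.plain_den (σ.env_normal E) hcut) h₁.plain h₂.plain,
        ?_⟩
      rw [Clause.toSeq_comp]
      exact this.2

theorem Pf.Links.imp {K : ProofSyms L} {Γ : List Ty} {p q : Fin (K.m + 1) → Tm L Γ Ty.nat → Prop}
    (h : ∀ j a, p j a → q j a) {π : Pf L K Γ} (hp : π.Links p) : π.Links q := by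
  induction π with
  | ax A => trivial
  | link j a as => exact h _ _ hp
  | un r π ih => exact ih hp
  | bin r π₁ π₂ ih₁ ih₂ => exact ⟨ih₁ hp.1, ih₂ hp.2⟩

/-- Induction along the calls of proof links. -/
theorem ProofSyms.link_induction (K : ProofSyms L) {M : Fin (K.m + 1) → ℕ → Prop}
    (h : ∀ j n, (∀ j', j < j' → ∀ n', M j' n') → (∀ n', n' < n → M j n') → M j n)
    (j : Fin (K.m + 1)) (n : ℕ) : M j n := by
  induction j using (wellFounded_gt (α := Fin (K.m + 1))).induction generalizing n with
  | _ j IH =>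
    induction n using Nat.strong_induction_on with
    | _ n ih => exact h j n (fun j' hj => IH j' hj) ih

theorem ProofSchema.base_links_of {M : Fin (Ψ.K.m + 1) → ℕ → Prop} (j : Fin (Ψ.K.m + 1))
    (h : ∀ j', j < j' → ∀ n', M j' n') (σ : Sub L (Ψ.K.params j) []) :
    (Ψ.base j).Links fun j' a => ∀ n, (a.sub σ).nf E = Tm.num n → M j' n :=
  (Ψ.base_links j).imp fun j' _ hj n _ => h j' hj.1 n

theorem ProofSchema.step_links_of {M : Fin (Ψ.K.m + 1) → ℕ → Prop} (j : Fin (Ψ.K.m + 1)) (n : ℕ)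
    (h : ∀ j', j < j' → ∀ n', M j' n') (hn : M j n) (σ : Sub L (Ψ.K.params j) []) :
    (Ψ.step j).Links fun j' a =>
      ∀ k, (a.sub (Sub.cons (Tm.num n) σ)).nf E = Tm.num k → M j' k := by
  refine (Ψ.step_links j).imp fun j' a hj k hk => ?_
  rcases hj with ⟨rfl, rfl⟩ | ⟨hj, -⟩
  · have : (Tm.num n : Tm L [] _).nf E = Tm.num k := hk
    rw [Tm.nf_num] at this
    rw [← Tm.num_injective this]
    exact hn
  · exact h j' hj k

/-- The value of a tuple of arguments depends only on the normal form of the first one. -/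
theorem Sub.env_cons_of_nf {Γ : List Ty} {a : Tm L [] Ty.nat} {n : ℕ} (ha : a.nf E = Tm.num n)
    (as : Sub L Γ []) : (Sub.cons a as).env E = (Sub.cons (Tm.num n) as).env E := by
  have h : ∀ t : Tm L [] Ty.nat, (Sub.cons t as).env E
      = Env.cons (t.den (E.dint []) Env.nil) (as.env E) := fun t => Sub.den_cons _ _ _ _
  rw [h, h]
  congr 1
  have h₁ := Tm.nf_eq E (b := .o) Env.isId_nil a
  have h₂ := Tm.nf_eq E (b := .o) Env.isId_nil (Tm.num n : Tm L [] _)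
  rw [ha] at h₁
  rw [Tm.nf_num] at h₂
  exact Tm.num_injective (h₁.symm.trans h₂)

theorem ProofSchema.matchesAt (j : Fin (Ψ.K.m + 1)) (n : ℕ) : Ψ.MatchesAt j n := by
  refine Ψ.K.link_induction (M := Ψ.MatchesAt) ?_ j n
  intro j n IH ih Ω a as u ξ ha hΩ hn hu hξ
  rw [Sub.env_cons_of_nf ha] at hn ⊢
  cases n with
  | zero =>
    cases hu with
    | symSucc _ _ _ _ k _ h _ => cases (ha.symm.trans h : (Tm.num 0 : Tm L [] _) = Tm.num (k + 1))
    | symZero _ _ _ _ _ _ hu =>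
    cases hξ with
    | symSucc _ _ _ _ k _ h _ => cases (ha.symm.trans h : (Tm.num 0 : Tm L [] _) = Tm.num (k + 1))
    | symZero _ _ _ _ _ _ hξ =>
    have e : ((Ψ.base j).concl.unmarked Ω).map (Tr.den E (as.env E)) =
        ((Ψ.K.endSeq j).unmarked Ω).map (Tr.den E ((Sub.cons (Tm.num 0) as).env E)) := by
      rw [Ψ.base_concl, Seq.sub_unmarked_den, Sub.cons_comp]; rfl
    rw [← e] at hn ⊢
    refine Pf.matches_of_links Ψ as (Ψ.base j) Ω (Ψ.base_valid j)
      (Ψ.base_links_of j IH as) ?_ hn u ξ hu hξ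
    rw [Ψ.base_concl]; exact hΩ.map _
  | succ n =>
    cases hu with
    | symZero _ _ _ _ _ h _ => cases (ha.symm.trans h : (Tm.num (n + 1) : Tm L [] _) = Tm.num 0)
    | symSucc _ _ _ _ k _ h hu =>
    cases hξ with
    | symZero _ _ _ _ _ h _ => cases (ha.symm.trans h : (Tm.num (n + 1) : Tm L [] _) = Tm.num 0)
    | symSucc _ _ _ _ k' _ h' hξ =>
    have ek := Nat.succ.inj (Tm.num_injective (ha.symm.trans h))
    have ek' := Nat.succ.inj (Tm.num_injective (ha.symm.trans h'))
    subst ek; subst ek'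
    have e : ((Ψ.step j).concl.unmarked Ω).map
          (Tr.den E ((Sub.cons (Tm.num n) as : Sub L (Ty.nat :: Ψ.K.params j) []).env E)) =
        ((Ψ.K.endSeq j).unmarked Ω).map (Tr.den E ((Sub.cons (Tm.num (n + 1)) as).env E)) := by
      rw [Ψ.step_concl, Seq.sub_unmarked_den, Sub.cons_comp]; rfl
    rw [← e] at hn ⊢
    refine Pf.matches_of_links Ψ (Sub.cons (Tm.num n) as) (Ψ.step j) Ω (Ψ.step_valid j)
      (Ψ.step_links_of j n IH (ih n (Nat.lt_succ_self n)) as) ?_ hn u ξ hu hξ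
    rw [Ψ.step_concl]; exact hΩ.map _

theorem Pf.exists_proj_of_links {Γ : List Ty} (σ : Sub L Γ []) (π : Pf L Ψ.K Γ) :
    ∀ c : Config, π.Links (fun j a => ∀ n, (a.sub σ).nf E = Tm.num n →
      ∀ Ω a' as, a'.nf E = Tm.num n → ∃ ξ, PT.Eval Ψ (.sym j Ω a' as) ξ) →
      ∃ ξ, PT.Eval Ψ ((π.proj c).map (Tr.sub σ)) ξ := by
  induction π with
  | ax A => intro c _; exact ⟨_, .ax _⟩
  | link j a as =>
    intro c hl
    obtain ⟨n, hn⟩ := Tm.exists_nf_num E (a.sub σ)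
    exact hl n hn c (a.sub σ) (as.comp σ) hn
  | un r π ih =>
    intro c hl
    obtain ⟨ξ, h⟩ := ih (r.up c) hl
    rw [Pf.proj]
    split
    · exact ⟨ξ, h⟩
    · exact ⟨_, .un _ h⟩
  | bin r π₁ π₂ ih₁ ih₂ =>
    intro c hl
    obtain ⟨ξ₁, h₁⟩ := ih₁ (r.upLeft π₁.concl c) hl.1
    obtain ⟨ξ₂, h₂⟩ := ih₂ (r.upRight π₁.concl c) hl.2
    simp only [Pf.proj]
    split
    · exact ⟨_, .plus (.wk _ h₁) (.wk _ h₂)⟩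
    · exact ⟨_, .times _ h₁ h₂⟩

/-- The normal form of the projection term of `ψ_j` exists. -/
theorem ProofSchema.exists_proj (j : Fin (Ψ.K.m + 1)) (n : ℕ) :
    ∀ Ω a as, a.nf E = Tm.num n → ∃ ξ, PT.Eval Ψ (.sym j Ω a as) ξ := by
  refine Ψ.K.link_induction (M := fun j n =>
    ∀ Ω a as, a.nf E = Tm.num n → ∃ ξ, PT.Eval Ψ (.sym j Ω a as) ξ) ?_ j n
  intro j n IH ih Ω a as ha
  cases n with
  | zero =>
    obtain ⟨ξ, h⟩ := Pf.exists_proj_of_links Ψ as (Ψ.base j) Ω (Ψ.base_links_of j IH as)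
    exact ⟨ξ, .symZero _ _ _ _ _ ha h⟩
  | succ n =>
    obtain ⟨ξ, h⟩ := Pf.exists_proj_of_links Ψ (Sub.cons (Tm.num n) as) (Ψ.step j) Ω
      (Ψ.step_links_of j n IH (ih n (Nat.lt_succ_self n)) as)
    exact ⟨ξ, .symSucc _ _ _ _ _ _ ha h⟩

theorem ProofSchema.exists_projAt (h : Ψ.K.params 0 = []) (α : ℕ) : ∃ ξ, Ψ.ProjAt h α ξ :=
  Ψ.exists_proj 0 α _ _ _ (Tm.nf_num E α)

/-- The projection set of a schema with a skolemized end-sequent matches the characteristic clause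
set. -/
theorem ProofSchema.matches_at (h : Ψ.K.params 0 = []) (α : ℕ)
    (hs : ((Ψ.seqAt h α).map (Tr.nf E)).NoStrong) {c : CST L Ψ.K []} {ξ : PT L Ψ.K []}
    (hc : Ψ.CharAt h α c) (hξ : Ψ.ProjAt h α ξ) :
    Matches E ((Ψ.seqAt h α).map (Tr.nf E)) c.clauses ξ.proofs := by
  have e : ((Ψ.K.endSeq 0).unmarked Ψ.noConfig).map
      (Tr.den E ((Sub.cons (Tm.num α) (noArgs h)).env E)) = (Ψ.seqAt h α).map (Tr.nf E) := by
    rw [ProofSchema.seqAt, Seq.nf_sub]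
    congr 1
    simp only [Seq.unmarked, ProofSchema.noConfig, pick_replicate]
  have hm := Ψ.matchesAt 0 α Ψ.noConfig (Tm.num α) (noArgs h) c ξ (Tm.nf_num E α)
    (by simp [Config.Fits, ProofSchema.noConfig])
  rw [e] at hm
  exact hm hs hc hξ

end Evaluation

/-! ### Ground instances of projections -/

section GroundInstances

variable {L : Lang} (σ : PSub L)

theorem Tm.num?_num {Γ : List Ty} (n : ℕ) : (Tm.num n : Tm L Γ _).num? = some n := by
  induction n with
  | zero => rfl
  | succ n ih => simp [Tm.num, Tm.num?, ih]

theorem Tm.num?_ren {Γ : List Ty} {τ : Ty} (t : Tm L Γ τ) :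
    ∀ {Δ : List Ty} (r : Ren Γ Δ), (t.ren r).num? = t.num? := by
  induction t <;> intros <;> simp_all [Tm.ren, Tm.num?]

theorem Tm.name?_ren {Γ Δ : List Ty} {τ : Ty} (t : Tm L Γ τ) (r : Ren Γ Δ) :
    (t.ren r).name? = t.name? := by
  cases t <;> rfl

theorem Ren.empty_eq {Γ Δ : List Ty} (r : Ren Γ Δ) : (fun τ v => r τ (Ren.empty τ v)) = Ren.empty := by
  funext τ v; exact nomatch v

theorem Tm.psub_ren {Γ : List Ty} {τ : Ty} (t : Tm L Γ τ) :
    ∀ {Δ : List Ty} (r : Ren Γ Δ), (t.ren r).psub σ = (t.psub σ).ren r := by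
  induction t with
  | var v => intros; rfl
  | v2 x => intros; rfl
  | app u t ihu iht =>
    intro Δ r
    simp only [Tm.ren, Tm.psub, Tm.num?_ren, Tm.name?_ren, ihu, iht]
    split
    · rw [Tm.ren_ren, Ren.empty_eq]
    · rfl
  | lam t ih => intros; simp only [Tm.ren, Tm.psub, ih]
  | zero => intros; rfl
  | succ t ih => intros; simp only [Tm.ren, Tm.psub, ih]
  | con f as ih => intros; simp only [Tm.ren, Tm.psub, ih]
  | dfn d t as iht ih => intros; simp only [Tm.ren, Tm.psub, ih, iht]

theorem Tm.ren_empty_sub {Γ Δ : List Ty} {τ : Ty} (t : Tm L [] τ) (s : Sub L Γ Δ) :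
    (t.ren Ren.empty).sub s = t.ren Ren.empty := by
  rw [← Tm.sub_id (t.ren (Ren.empty (Γ := Δ))), Tm.ren_sub, Tm.ren_sub]
  congr 1; funext τ v; exact nomatch v

/-- In a context of individual variables, the normal terms of the form `u(t)` are the individual
variables `x(n)`, `n` a numeral. -/
theorem Tm.Normal.app_eq {Γ : List Ty} {ρ : Env L Γ Γ} (hρ : ρ.IsId) {u : Tm L Γ Ty.seq}
    {t : Tm L Γ Ty.nat} (h : (Tm.app u t).Normal) : ∃ x n, u = .v2 x ∧ t = Tm.num n := by
  have h₂ : t = Tm.num _ := Tm.Normal.reps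
    (fun d n e => Tm.defaultVal (.dfn d (Tm.num n) fun _ v => (e _ v).reify)) hρ h.2
  cases u with
  | var v => cases (hρ _ v).1
  | v2 x => exact ⟨x, _, rfl, h₂⟩
  | lam t => exact h.1.elim

/-- Normality is needed: by the substitution `s`, a term `x(t)` could become an individual variable
`x(n)` and be replaced only then. -/
theorem Tm.psub_sub {Γ : List Ty} {ρ : Env L Γ Γ} (hρ : ρ.IsId) {τ : Ty} {t : Tm L Γ τ}
    (ht : t.Normal) {Δ : List Ty} (s : Sub L Γ Δ) :
    (t.sub s).psub σ = (t.psub σ).sub fun τ v => (s τ v).psub σ := by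
  induction t with
  | var v => rfl
  | v2 x => rfl
  | app u t ihu iht =>
    obtain ⟨x, n, rfl, rfl⟩ := Tm.Normal.app_eq hρ ht
    simp only [Tm.sub, Tm.psub, Tm.num_sub, Tm.num?_num, Tm.name?, Tm.ren_empty_sub]
  | lam t ih => exact ht.elim
  | zero => rfl
  | succ t ih => simp only [Tm.sub, Tm.psub, ih hρ ht]
  | con f as ih => simp only [Tm.sub, Tm.psub, ih _ _ hρ (ht _ _)]
  | dfn d t as iht ih => exact ht.elim

theorem Sub.psub_lift {Γ Δ : List Ty} (s : Sub L Γ Δ) (υ : Ty) :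
    (fun τ v => (s.lift υ τ v).psub σ) = Sub.lift υ fun τ v => (s τ v).psub σ := by
  funext τ v
  cases v with
  | zero => rfl
  | succ v => exact Tm.psub_ren σ _ _

theorem Fm.psub_sub {Γ : List Ty} {A : Fm L Γ} : ∀ {ρ : Env L Γ Γ}, ρ.IsId → A.Normal →
    ∀ {Δ : List Ty} (s : Sub L Γ Δ),
      (A.sub s).psub σ = (A.psub σ).sub fun τ v => (s τ v).psub σ := by
  induction A with
  | pr p as => intro ρ hρ h Δ s; simp only [Fm.sub, Fm.psub, Tm.psub_sub σ hρ (h _ _)]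
  | dpr q t as => intro ρ hρ h; exact h.elim
  | neg A ih => intro ρ hρ h Δ s; simp only [Fm.sub, Fm.psub, ih hρ h]
  | and A B ihA ihB => intro ρ hρ h Δ s; simp only [Fm.sub, Fm.psub, ihA hρ h.1, ihB hρ h.2]
  | or A B ihA ihB => intro ρ hρ h Δ s; simp only [Fm.sub, Fm.psub, ihA hρ h.1, ihB hρ h.2]
  | imp A B ihA ihB => intro ρ hρ h Δ s; simp only [Fm.sub, Fm.psub, ihA hρ h.1, ihB hρ h.2]
  | all A ih => intro ρ hρ h Δ s; simp only [Fm.sub, Fm.psub, ih hρ.lift h, Sub.psub_lift]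
  | ex A ih => intro ρ hρ h Δ s; simp only [Fm.sub, Fm.psub, ih hρ.lift h, Sub.psub_lift]

theorem Fm.psub_inst {A : Fm L [Ty.ind]} (hA : A.Normal) (t : Tm L [] Ty.ind) :
    (A.inst t).psub σ = (A.psub σ).inst (t.psub σ) := by
  rw [Fm.inst, Fm.inst, Fm.psub_sub σ Env.isId_nil.lift hA]
  congr 1; funext τ v
  cases v with
  | zero => rfl
  | succ v => exact nomatch v

/-- Ground substitutions make normal terms of base sorts ground, because these contain second-order
variables only within individual variables `x(n)`. -/
theorem Tm.v2Free_psub {σ : PSub L} (hσ : σ.Ground) {Γ : List Ty} {ρ : Env L Γ Γ} (hρ : ρ.IsId)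
    {τ : Ty} {t : Tm L Γ τ} (ht : t.Normal) (hτ : τ ≠ Ty.seq) : (t.psub σ).V2Free := by
  induction t with
  | var v => trivial
  | v2 x => exact (hτ rfl).elim
  | app u t ihu iht =>
    obtain ⟨x, n, rfl, rfl⟩ := Tm.Normal.app_eq hρ ht
    simp only [Tm.psub, Tm.num?_num, Tm.name?]
    exact (hσ x n).1.ren _
  | lam t ih => exact ht.elim
  | zero => trivial
  | succ t ih => exact ih hρ ht (by simp)
  | con f as ih =>
    intro τ v
    refine ih τ v hρ (ht τ v) ?_
    obtain ⟨b, rfl⟩ := exists_base_of_var v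
    simp
  | dfn d t as iht ih => exact ht.elim

theorem Fm.v2Free_psub {σ : PSub L} (hσ : σ.Ground) {Γ : List Ty} {A : Fm L Γ} :
    ∀ {ρ : Env L Γ Γ}, ρ.IsId → A.Normal → (A.psub σ).V2Free := by
  induction A with
  | pr p as =>
    intro ρ hρ h τ v
    refine Tm.v2Free_psub hσ hρ (h τ v) ?_
    obtain ⟨b, rfl⟩ := exists_base_of_var v
    simp
  | dpr q t as => intro ρ hρ h; exact h.elim
  | neg A ih => intro ρ hρ h; exact ih hρ h
  | and A B ihA ihB => intro ρ hρ h; exact ⟨ihA hρ h.1, ihB hρ h.2⟩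
  | or A B ihA ihB => intro ρ hρ h; exact ⟨ihA hρ h.1, ihB hρ h.2⟩
  | imp A B ihA ihB => intro ρ hρ h; exact ⟨ihA hρ h.1, ihB hρ h.2⟩
  | all A ih => intro ρ hρ h; exact ih hρ.lift h
  | ex A ih => intro ρ hρ h; exact ih hρ.lift h

theorem Tm.psub_of_v2Free {Γ : List Ty} {τ : Ty} {t : Tm L Γ τ} (h : t.V2Free) :
    t.psub σ = t := by
  induction t with
  | var v => rfl
  | v2 x => rfl
  | app u t ihu iht =>
    have : u.name? = none := by
      cases u with
      | v2 x => exact h.1.elim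
      | _ => rfl
    simp only [Tm.psub, this, ihu h.1, iht h.2]
  | lam t ih => simp only [Tm.psub, ih h]
  | zero => rfl
  | succ t ih => simp only [Tm.psub, ih h]
  | con f as ih => simp only [Tm.psub, ih _ _ (h _ _)]
  | dfn d t as iht ih => simp only [Tm.psub, iht h.1, ih _ _ (h.2 _ _)]

theorem Fm.psub_of_v2Free {Γ : List Ty} {A : Fm L Γ} (h : A.V2Free) : A.psub σ = A := by
  induction A with
  | pr p as => simp only [Fm.psub, Tm.psub_of_v2Free σ (h _ _)]
  | dpr q t as => simp only [Fm.psub, Tm.psub_of_v2Free σ (h.2 _ _), Tm.psub_of_v2Free σ h.1]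
  | neg A ih => simp only [Fm.psub, ih h]
  | and A B ihA ihB => simp only [Fm.psub, ihA h.1, ihB h.2]
  | or A B ihA ihB => simp only [Fm.psub, ihA h.1, ihB h.2]
  | imp A B ihA ihB => simp only [Fm.psub, ihA h.1, ihB h.2]
  | all A ih => simp only [Fm.psub, ih h]
  | ex A ih => simp only [Fm.psub, ih h]

theorem Seq.psub_of_v2Free {Γ : List Ty} {s : Seq L Γ} (h : s.V2Free) :
    s.map (Tr.psub σ) = s := by
  obtain ⟨a, d⟩ := s
  simp only [Seq.map]
  congr 1
  · exact (List.map_congr_left fun A hA => Fm.psub_of_v2Free σ (h.1 A hA)).trans (List.map_id _)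
  · exact (List.map_congr_left fun A hA => Fm.psub_of_v2Free σ (h.2 A hA)).trans (List.map_id _)

theorem Clause.toSeq_map {Γ Δ : List Ty} {T : Tr L Γ Δ} (hT : T.Hom) (C : Clause L Γ) :
    (C.map T.tm).toSeq = C.toSeq.map T := by
  simp [Clause.toSeq, Clause.map, Seq.map, hT.atom]

variable {K : ProofSyms L}

theorem Pf.Plain.concl_map {Γ Δ : List Ty} {T : Tr L Γ Δ} (hT : T.Hom) {φ : Pf L K Γ}
    (h : φ.Plain) : (φ.map T).concl = φ.concl.map T := by
  induction φ with
  | ax A => simp [Pf.map, Pf.concl, Seq.map, hT.atom]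
  | link j a as => exact h.elim
  | un r π ih => simp only [Pf.map, Pf.concl, ih h.2, URule.concl_map hT]
  | bin r π₁ π₂ ih₁ ih₂ => simp only [Pf.map, Pf.concl, ih₁ h.2.1, ih₂ h.2.2, BRule.concl_map hT]

theorem Pf.Plain.valid_psub {E : Rules L} {φ : Pf L K []} (h : φ.Plain) (hv : φ.Valid E) :
    (φ.map (Tr.psub σ)).Valid E := by
  induction φ with
  | ax A => trivial
  | link j a as => trivial
  | un r π ih =>
    refine ⟨ih h.2 hv.1, ?_⟩
    rw [Pf.Plain.concl_map (Tr.psub_hom σ) h.2]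
    refine URule.ok_map ?_ h.1.weak hv.2
    rintro A t (rfl | rfl)
    · exact Fm.psub_inst σ h.1.1 t
    · exact Fm.psub_inst σ h.1.1 t
  | bin r π₁ π₂ ih₁ ih₂ =>
    refine ⟨ih₁ h.2.1 hv.1, ih₂ h.2.2 hv.2.1, ?_⟩
    rw [Pf.Plain.concl_map (Tr.psub_hom σ) h.2.1, Pf.Plain.concl_map (Tr.psub_hom σ) h.2.2]
    exact BRule.ok_map hv.2.2

theorem Pf.Plain.ground_psub {σ : PSub L} (hσ : σ.Ground) {φ : Pf L K []} (h : φ.Plain) :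
    (φ.map (Tr.psub σ)).Ground := by
  have h₁ : ∀ A : Fm L [], A.Normal → ((Tr.psub σ).fm A).V2Free :=
    fun A hA => Fm.v2Free_psub hσ Env.isId_nil hA
  have h₂ : ∀ A : Fm L [Ty.ind], A.Normal → ((Tr.psub σ : Tr L [] []).fmI A).V2Free :=
    fun A hA => Fm.v2Free_psub hσ Env.isId_nil.lift hA
  have h₃ : ∀ t : Tm L [] Ty.ind, t.Normal → ((Tr.psub σ).tm t).V2Free :=
    fun t ht => Tm.v2Free_psub hσ Env.isId_nil ht (by simp)
  induction φ with
  | ax A => exact h₁ A.toFm h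
  | link j a as => exact h.elim
  | un r π ih =>
    refine ⟨?_, ih h.2⟩
    have := h.1
    cases r <;> simp_all [URule.Plain, URule.map, URule.V2Free]
  | bin r π₁ π₂ ih₁ ih₂ =>
    refine ⟨?_, ih₁ h.2.1, ih₂ h.2.2⟩
    have := h.1
    cases r <;> simp_all [BRule.Plain, BRule.map, BRule.V2Free]

theorem Pf.Plain.atomicCuts_map {Γ Δ : List Ty} (T : Tr L Γ Δ) {φ : Pf L K Γ} (h : φ.Plain) :
    (φ.map T).AtomicCuts := by
  induction φ with
  | ax A => trivial
  | link j a as => trivial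
  | un r π ih => exact ih h.2
  | bin r π₁ π₂ ih₁ ih₂ =>
    refine ⟨?_, ih₁ h.2.1, ih₂ h.2.2⟩
    have := h.1
    cases r <;> simp_all [BRule.Plain, BRule.map]

theorem Pf.size_map {Γ Δ : List Ty} (T : Tr L Γ Δ) (φ : Pf L K Γ) : (φ.map T).size = φ.size := by
  induction φ with
  | ax A => rfl
  | link j a as => rfl
  | un r π ih => simp only [Pf.map, Pf.size, ih]; congr 1; cases r <;> rfl
  | bin r π₁ π₂ ih₁ ih₂ => simp only [Pf.map, Pf.size, ih₁, ih₂]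

end GroundInstances

/-! ### Numbers of symbols under substitution -/

section Symbols

variable {L : Lang}

theorem sumVar_mono : ∀ {Γ : List Ty} {f g : ∀ τ, Var Γ τ → ℕ}, (∀ τ v, f τ v ≤ g τ v) →
    sumVar Γ f ≤ sumVar Γ g
  | [], _, _, _ => le_rfl
  | _ :: _, _, _, h => Nat.add_le_add (h _ _) (sumVar_mono fun _ _ => h _ _)

theorem sumVar_mul : ∀ {Γ : List Ty} (f : ∀ τ, Var Γ τ → ℕ) (B : ℕ),
    (sumVar Γ fun τ v => f τ v * B) = sumVar Γ f * B
  | [], _, _ => by simp [sumVar]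
  | _ :: _, f, B => by
    simp only [sumVar, Nat.add_mul]
    rw [sumVar_mul fun υ v => f υ (Var.succ v)]

theorem le_sumVar : ∀ {Γ : List Ty} (f : ∀ τ, Var Γ τ → ℕ) {τ : Ty} (v : Var Γ τ),
    f τ v ≤ sumVar Γ f
  | _ :: _, _, _, .zero => Nat.le_add_right _ _
  | _ :: _, f, _, .succ v =>
    (le_sumVar (fun υ v => f υ (Var.succ v)) v).trans (Nat.le_add_left _ _)

theorem Tm.symbols_ren {Γ : List Ty} {τ : Ty} (t : Tm L Γ τ) :
    ∀ {Δ : List Ty} (r : Ren Γ Δ), (t.ren r).symbols = t.symbols := by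
  induction t <;> intros <;> simp_all [Tm.ren, Tm.symbols]

theorem Tm.symbols_pos {Γ : List Ty} {τ : Ty} (t : Tm L Γ τ) : 0 < t.symbols := by
  induction t <;> simp_all [Tm.symbols]

theorem Fm.symbols_pos {Γ : List Ty} (A : Fm L Γ) : 0 < A.symbols := by
  cases A <;> simp [Fm.symbols]

variable {σ : PSub L} {B : ℕ}

theorem Tm.symbols_psub_le (hB : 0 < B) (hσ : ∀ x n, (σ x n).symbols ≤ B) {Γ : List Ty} {τ : Ty}
    (t : Tm L Γ τ) : (t.psub σ).symbols ≤ t.symbols * B := by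
  induction t with
  | var v => simpa [Tm.psub, Tm.symbols] using Nat.succ_le_of_lt hB
  | v2 x => simpa [Tm.psub, Tm.symbols] using Nat.succ_le_of_lt hB
  | app u t ihu iht =>
    simp only [Tm.psub]
    split
    · rw [Tm.symbols_ren, Tm.symbols]
      refine (hσ _ _).trans (Nat.le_mul_of_pos_left _ ?_)
      have := u.symbols_pos
      omega
    · simp only [Tm.symbols, Nat.add_mul]; omega
  | lam t ih => simp only [Tm.psub, Tm.symbols, Nat.add_mul]; omega
  | zero => simpa [Tm.psub, Tm.symbols] using Nat.succ_le_of_lt hB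
  | succ t ih => simp only [Tm.psub, Tm.symbols, Nat.add_mul]; omega
  | con f as ih =>
    simp only [Tm.psub, Tm.symbols, Nat.add_mul, ← sumVar_mul]
    have := sumVar_mono ih
    omega
  | dfn d t as iht ih =>
    simp only [Tm.psub, Tm.symbols, Nat.add_mul, ← sumVar_mul]
    have := sumVar_mono ih
    omega

theorem Fm.symbols_psub_le (hB : 0 < B) (hσ : ∀ x n, (σ x n).symbols ≤ B) {Γ : List Ty}
    (A : Fm L Γ) : (A.psub σ).symbols ≤ A.symbols * B := by
  induction A with
  | pr p as =>
    simp only [Fm.psub, Fm.symbols, Nat.add_mul, ← sumVar_mul]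
    have := sumVar_mono fun τ v => Tm.symbols_psub_le hB hσ (as τ v)
    omega
  | dpr q t as =>
    simp only [Fm.psub, Fm.symbols, Nat.add_mul, ← sumVar_mul]
    have := sumVar_mono fun τ v => Tm.symbols_psub_le hB hσ (as τ v)
    have := Tm.symbols_psub_le hB hσ t
    omega
  | neg A ih => simp only [Fm.psub, Fm.symbols, Nat.add_mul]; omega
  | and A B ihA ihB => simp only [Fm.psub, Fm.symbols, Nat.add_mul]; omega
  | or A B ihA ihB => simp only [Fm.psub, Fm.symbols, Nat.add_mul]; omega
  | imp A B ihA ihB => simp only [Fm.psub, Fm.symbols, Nat.add_mul]; omega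
  | all A ih => simp only [Fm.psub, Fm.symbols, Nat.add_mul]; omega
  | ex A ih => simp only [Fm.psub, Fm.symbols, Nat.add_mul]; omega

theorem Seq.symbols_psub_le (hB : 0 < B) (hσ : ∀ x n, (σ x n).symbols ≤ B) {Γ : List Ty}
    (s : Seq L Γ) : (s.map (Tr.psub σ)).symbols ≤ s.symbols * B := by
  have key : ∀ l : List (Fm L Γ), ((l.map (Tr.psub σ).fm).map Fm.symbols).sum
      ≤ (l.map Fm.symbols).sum * B := by
    intro l
    induction l with
    | nil => simp
    | cons A l ih =>
      simp only [List.map_cons, List.sum_cons, Nat.add_mul]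
      exact Nat.add_le_add (Fm.symbols_psub_le hB hσ A) ih
  have h₁ := key s.ant
  have h₂ := key s.suc
  simp only [Seq.symbols, Seq.map, Nat.add_mul] at h₁ h₂ ⊢
  omega

theorem Pf.symbols_psub_le (hB : 0 < B) (hσ : ∀ x n, (σ x n).symbols ≤ B) {K : ProofSyms L}
    {φ : Pf L K []} (h : φ.Plain) : (φ.map (Tr.psub σ)).symbols ≤ φ.symbols * B := by
  induction φ with
  | ax A =>
    have e := Pf.Plain.concl_map (Tr.psub_hom σ) h
    change ((Pf.ax A : Pf L K []).map (Tr.psub σ)).concl.symbols ≤ _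
    rw [e]
    exact Seq.symbols_psub_le hB hσ _
  | link j a as => exact h.elim
  | un r π ih =>
    have e : (r.map (Tr.psub σ)).concl (π.map (Tr.psub σ)).concl
        = (r.concl π.concl).map (Tr.psub σ) := by
      rw [Pf.Plain.concl_map (Tr.psub_hom σ) h.2, URule.concl_map (Tr.psub_hom σ)]
    have ec : (r.map (Tr.psub σ)).cost = r.cost := by cases r <;> rfl
    simp only [Pf.map, Pf.symbols, e, ec, Nat.add_mul]
    refine Nat.add_le_add (ih h.2) ?_
    rw [Nat.mul_assoc]
    exact Nat.mul_le_mul_left _ (Seq.symbols_psub_le hB hσ _)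
  | bin r π₁ π₂ ih₁ ih₂ =>
    have e : (r.map (Tr.psub σ)).concl (π₁.map (Tr.psub σ)).concl (π₂.map (Tr.psub σ)).concl
        = (r.concl π₁.concl π₂.concl).map (Tr.psub σ) := by
      rw [Pf.Plain.concl_map (Tr.psub_hom σ) h.2.1, Pf.Plain.concl_map (Tr.psub_hom σ) h.2.2,
        BRule.concl_map (Tr.psub_hom σ)]
    simp only [Pf.map, Pf.symbols, e, Nat.add_mul]
    exact Nat.add_le_add (Nat.add_le_add (ih₁ h.2.1) (ih₂ h.2.2)) (Seq.symbols_psub_le hB hσ _)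

/-! #### Occurrences of individual variables -/

/-- The individual variable `x(n)` is replaced in the term by a substitution. -/
def Tm.HasVar (x : L.V) (n : ℕ) : ∀ {Γ : List Ty} {τ : Ty}, Tm L Γ τ → Prop
  | _, _, .var _ => False
  | _, _, .v2 _ => False
  | _, _, .app u t =>
      match u.name?, t.num? with
      | some y, some m => y = x ∧ m = n
      | _, _ => u.HasVar x n ∨ t.HasVar x n
  | _, _, .lam t => t.HasVar x n
  | _, _, .zero => False
  | _, _, .succ t => t.HasVar x n
  | _, _, .con _ as => ∃ τ v, (as τ v).HasVar x n
  | _, _, .dfn _ t as => t.HasVar x n ∨ ∃ τ v, (as τ v).HasVar x n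

/-- A substitution acts only through its values at the variables that occur. -/
theorem Tm.psub_congr {σ σ' : PSub L} {Γ : List Ty} {τ : Ty} {t : Tm L Γ τ}
    (h : ∀ x n, t.HasVar x n → σ x n = σ' x n) : t.psub σ = t.psub σ' := by
  induction t with
  | var v => rfl
  | v2 x => rfl
  | app u t ihu iht =>
    simp only [Tm.psub]
    simp only [Tm.HasVar] at h
    split
    · rename_i x n hx hn
      simp only [hx, hn] at h
      rw [h x n ⟨rfl, rfl⟩]
    · rename_i hxn
      have h' : ∀ x n, u.HasVar x n ∨ t.HasVar x n → σ x n = σ' x n := by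
        intro x n hh
        refine h x n ?_
        split
        · rename_i hx hn; exact (hxn _ _ hx hn).elim
        · exact hh
      rw [ihu fun x n hh => h' x n (.inl hh), iht fun x n hh => h' x n (.inr hh)]
  | lam t ih => simp only [Tm.psub, ih h]
  | zero => rfl
  | succ t ih => simp only [Tm.psub, ih h]
  | con f as ih => simp only [Tm.psub, ih _ _ fun x n hh => h x n ⟨_, _, hh⟩]
  | dfn d t as iht ih =>
    simp only [Tm.psub, ih _ _ fun x n hh => h x n (.inr ⟨_, _, hh⟩),
      iht fun x n hh => h x n (.inl hh)]

/-- The value at an occurring variable is a subterm of the instance. -/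
theorem Tm.HasVar.symbols_le {σ : PSub L} {x : L.V} {n : ℕ} {Γ : List Ty} {τ : Ty} {t : Tm L Γ τ}
    (h : t.HasVar x n) : (σ x n).symbols ≤ (t.psub σ).symbols := by
  induction t with
  | var v => exact h.elim
  | v2 x => exact h.elim
  | app u t ihu iht =>
    simp only [Tm.psub]
    simp only [Tm.HasVar] at h
    split
    · rename_i y m hx hn
      simp only [hx, hn] at h
      obtain ⟨rfl, rfl⟩ := h
      rw [Tm.symbols_ren]
    · rename_i hxn
      have h' : u.HasVar x n ∨ t.HasVar x n := by
        split at h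
        · rename_i hx hn; exact (hxn _ _ hx hn).elim
        · exact h
      simp only [Tm.symbols]
      rcases h' with h' | h'
      · have := ihu h'; omega
      · have := iht h'; omega
  | lam t ih => exact (ih h).trans (Nat.le_succ _)
  | zero => exact h.elim
  | succ t ih => exact (ih h).trans (Nat.le_succ _)
  | con f as ih =>
    obtain ⟨τ, v, h⟩ := h
    exact ((ih τ v h).trans (le_sumVar (fun τ v => ((as τ v).psub σ).symbols) v)).trans
      (Nat.le_succ _)
  | dfn d t as iht ih =>
    rcases h with h | ⟨τ, v, h⟩
    · have := iht h
      simp only [Tm.psub, Tm.symbols]; omega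
    · have := (ih τ v h).trans (le_sumVar (fun τ v => ((as τ v).psub σ).symbols) v)
      simp only [Tm.psub, Tm.symbols]; omega

/-- The individual variable `x(n)` is replaced in the atom by a substitution. -/
def Atm.HasVar {Γ : List Ty} (x : L.V) (n : ℕ) (A : Atm L Γ) : Prop :=
  ∃ τ v, (A.as τ v).HasVar x n

/-- The individual variable `x(n)` is replaced in the clause by a substitution. -/
def Clause.HasVar {Γ : List Ty} (x : L.V) (n : ℕ) (C : Clause L Γ) : Prop :=
  ∃ A, (A ∈ C.ant ∨ A ∈ C.suc) ∧ A.HasVar x n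

theorem Clause.psub_congr {σ σ' : PSub L} {Γ : List Ty} {C : Clause L Γ}
    (h : ∀ x n, C.HasVar x n → σ x n = σ' x n) :
    (C.map fun u => u.psub σ) = C.map fun u => u.psub σ' := by
  have key : ∀ A, (A ∈ C.ant ∨ A ∈ C.suc) → (A.map fun u => u.psub σ) = A.map fun u => u.psub σ' := by
    intro A hA
    simp only [Atm.map]
    congr 1; funext τ v
    exact Tm.psub_congr fun x n hh => h x n ⟨A, hA, τ, v, hh⟩
  simp only [Clause.map]
  congr 1
  · exact List.map_congr_left fun A hA => key A (.inl hA)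
  · exact List.map_congr_left fun A hA => key A (.inr hA)

theorem Seq.symbols_of_mem {Γ : List Ty} {s : Seq L Γ} {A : Fm L Γ} (h : A ∈ s.ant ∨ A ∈ s.suc) :
    A.symbols ≤ s.symbols := by
  simp only [Seq.symbols]
  rcases h with h | h
  · have := List.single_le_sum (l := s.ant.map Fm.symbols) (by simp) _ (List.mem_map_of_mem h)
    omega
  · have := List.single_le_sum (l := s.suc.map Fm.symbols) (by simp) _ (List.mem_map_of_mem h)
    omega

theorem Clause.HasVar.symbols_le {σ : PSub L} {x : L.V} {n : ℕ} {Γ : List Ty} {C : Clause L Γ}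
    (h : C.HasVar x n) : (σ x n).symbols ≤ (C.map fun u => u.psub σ).toSeq.symbols := by
  obtain ⟨A, hA, τ, v, h⟩ := h
  have h₁ : (σ x n).symbols ≤ (A.map fun u => u.psub σ).toFm.symbols :=
    (h.symbols_le.trans (le_sumVar (fun τ v => ((A.as τ v).psub σ).symbols) v)).trans
      (Nat.le_succ _)
  refine h₁.trans (Seq.symbols_of_mem ?_)
  simp only [Clause.toSeq, Clause.map]
  rcases hA with hA | hA
  · exact .inl (List.mem_map_of_mem (List.mem_map_of_mem hA))
  · exact .inr (List.mem_map_of_mem (List.mem_map_of_mem hA))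

end Symbols

/-! ### Contractions -/

section Contractions

variable {L : Lang} {E : Rules L} {K : ProofSyms L} {Γ : List Ty}

theorem Pf.contrL_spec : ∀ (n : ℕ) {π : Pf L K Γ} {A : Fm L Γ} {l : List (Fm L Γ)}, π.Valid E →
    π.concl.ant.Perm (List.replicate n A ++ l) → (π.contrL A n).Valid E ∧
      ∃ l', (π.contrL A n).concl = ⟨A :: l', π.concl.suc⟩ ∧ l'.Perm l
  | 0, π, A, l, hv, h => ⟨⟨hv, trivial⟩, π.concl.ant, rfl, h⟩
  | 1, π, A, l, hv, h => Pf.frontAnt_spec h hv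
  | n + 2, π, A, l, hv, h => by
    obtain ⟨hv', l', e, hp⟩ := Pf.frontAnt2_spec (l := List.replicate n A ++ l) h hv
    have hc : (Pf.un (.cL A) (π.frontAnt2 A)).concl = ⟨A :: l', π.concl.suc⟩ := by
      simp only [Pf.concl, URule.concl, e, List.tail_cons]
    obtain ⟨hv'', l'', e'', hp''⟩ := Pf.contrL_spec (n + 1) (π := .un (.cL A) (π.frontAnt2 A))
      (A := A) (l := l) ⟨hv', l', by rw [e]⟩ (by rw [hc]; exact hp.cons A)
    refine ⟨hv'', l'', ?_, hp''⟩
    rw [hc] at e''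
    exact e''

theorem Pf.contrR_spec : ∀ (n : ℕ) {π : Pf L K Γ} {A : Fm L Γ} {l : List (Fm L Γ)}, π.Valid E →
    π.concl.suc.Perm (List.replicate n A ++ l) → (π.contrR A n).Valid E ∧
      ∃ l', (π.contrR A n).concl = ⟨π.concl.ant, A :: l'⟩ ∧ l'.Perm l
  | 0, π, A, l, hv, h => ⟨⟨hv, trivial⟩, π.concl.suc, rfl, h⟩
  | 1, π, A, l, hv, h => Pf.frontSuc_spec h hv
  | n + 2, π, A, l, hv, h => by
    obtain ⟨hv', l', e, hp⟩ := Pf.frontSuc2_spec (l := List.replicate n A ++ l) h hv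
    have hc : (Pf.un (.cR A) (π.frontSuc2 A)).concl = ⟨π.concl.ant, A :: l'⟩ := by
      simp only [Pf.concl, URule.concl, e, List.tail_cons]
    obtain ⟨hv'', l'', e'', hp''⟩ := Pf.contrR_spec (n + 1) (π := .un (.cR A) (π.frontSuc2 A))
      (A := A) (l := l) ⟨hv', l', by rw [e]⟩ (by rw [hc]; exact hp.cons A)
    refine ⟨hv'', l'', ?_, hp''⟩
    rw [hc] at e''
    exact e''

theorem Pf.size_contrL : ∀ (n : ℕ) (π : Pf L K Γ) (A : Fm L Γ),
    (π.contrL A n).size ≤ π.size + n + 1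
  | 0, π, A => le_rfl
  | 1, π, A => by simp [Pf.contrL, Pf.frontAnt, Pf.size, URule.cost]; omega
  | n + 2, π, A => by
    have := Pf.size_contrL (n + 1) (.un (.cL A) (π.frontAnt2 A)) A
    simp only [Pf.contrL, Pf.frontAnt2, Pf.frontAnt, Pf.size, URule.cost] at this ⊢
    omega

theorem Pf.size_contrR : ∀ (n : ℕ) (π : Pf L K Γ) (A : Fm L Γ),
    (π.contrR A n).size ≤ π.size + n + 1
  | 0, π, A => le_rfl
  | 1, π, A => by simp [Pf.contrR, Pf.frontSuc, Pf.size, URule.cost]; omega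
  | n + 2, π, A => by
    have := Pf.size_contrR (n + 1) (.un (.cR A) (π.frontSuc2 A)) A
    simp only [Pf.contrR, Pf.frontSuc2, Pf.frontSuc, Pf.size, URule.cost] at this ⊢
    omega

theorem Pf.atomicCuts_contrL : ∀ (n : ℕ) {π : Pf L K Γ} (A : Fm L Γ), π.AtomicCuts →
    (π.contrL A n).AtomicCuts
  | 0, _, _, h => h
  | 1, _, _, h => h
  | n + 2, π, A, h => Pf.atomicCuts_contrL (n + 1) (π := .un (.cL A) (π.frontAnt2 A)) A h

theorem Pf.atomicCuts_contrR : ∀ (n : ℕ) {π : Pf L K Γ} (A : Fm L Γ), π.AtomicCuts →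
    (π.contrR A n).AtomicCuts
  | 0, _, _, h => h
  | 1, _, _, h => h
  | n + 2, π, A, h => Pf.atomicCuts_contrR (n + 1) (π := .un (.cR A) (π.frontSuc2 A)) A h

theorem Pf.ground_contrL : ∀ (n : ℕ) {π : Pf L K []} {A : Fm L []}, A.V2Free → π.Ground →
    (π.contrL A n).Ground
  | 0, _, _, hA, h => ⟨hA, h⟩
  | 1, _, _, _, h => ⟨trivial, h⟩
  | n + 2, π, A, hA, h => Pf.ground_contrL (n + 1) (π := .un (.cL A) (π.frontAnt2 A)) hA
      ⟨hA, trivial, trivial, h⟩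

theorem Pf.ground_contrR : ∀ (n : ℕ) {π : Pf L K []} {A : Fm L []}, A.V2Free → π.Ground →
    (π.contrR A n).Ground
  | 0, _, _, hA, h => ⟨hA, h⟩
  | 1, _, _, _, h => ⟨trivial, h⟩
  | n + 2, π, A, hA, h => Pf.ground_contrR (n + 1) (π := .un (.cR A) (π.frontSuc2 A)) hA
      ⟨hA, trivial, trivial, h⟩

theorem Seq.Same.symbols_eq {s s' : Seq L Γ} (h : s.Same s') : s.symbols = s'.symbols := by
  simp only [Seq.symbols, (h.1.map Fm.symbols).sum_eq, (h.2.map Fm.symbols).sum_eq]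

theorem Pf.symbols_contrL : ∀ (n : ℕ) {π : Pf L K Γ} {A : Fm L Γ} {l : List (Fm L Γ)}, π.Valid E →
    π.concl.ant.Perm (List.replicate n A ++ l) →
      (π.contrL A n).symbols ≤ π.symbols + (n + 1) * (π.concl.symbols + A.symbols)
  | 0, π, A, l, hv, h => by
    simp only [Pf.contrL, Pf.symbols, URule.cost, URule.concl, Seq.symbols, List.map_cons,
      List.sum_cons]
    omega
  | 1, π, A, l, hv, h => by simp [Pf.contrL, Pf.frontAnt, Pf.symbols, URule.cost]
  | n + 2, π, A, l, hv, h => by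
    obtain ⟨hv', l', e, hp⟩ := Pf.frontAnt2_spec (l := List.replicate n A ++ l) h hv
    have hc : (Pf.un (.cL A) (π.frontAnt2 A)).concl = ⟨A :: l', π.concl.suc⟩ := by
      simp only [Pf.concl, URule.concl, e, List.tail_cons]
    have ih := Pf.symbols_contrL (n + 1) (π := .un (.cL A) (π.frontAnt2 A))
      (A := A) (l := l) ⟨hv', l', by rw [e]⟩ (by rw [hc]; exact hp.cons A)
    have hle : (Pf.un (.cL A) (π.frontAnt2 A)).concl.symbols ≤ π.concl.symbols := by
      have h₁ : π.concl.Same ⟨A :: A :: l', π.concl.suc⟩ :=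
        ⟨h.trans ((hp.symm.cons A).cons A), .refl _⟩
      rw [hc, h₁.symbols_eq]
      simp only [Seq.symbols, List.map_cons, List.sum_cons]
      omega
    have hs : (Pf.un (.cL A) (π.frontAnt2 A)).symbols
        = π.symbols + (Pf.un (.cL A) (π.frontAnt2 A)).concl.symbols := by
      simp [Pf.frontAnt2, Pf.frontAnt, Pf.symbols, URule.cost, Pf.concl]
    rw [Pf.contrL]
    have hm := Nat.mul_le_mul_left (n + 1 + 1) (Nat.add_le_add_right hle A.symbols)
    have : (n + 2 + 1) * (π.concl.symbols + A.symbols)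
        = (n + 1 + 1) * (π.concl.symbols + A.symbols) + (π.concl.symbols + A.symbols) := by ring
    omega

theorem Pf.symbols_contrR : ∀ (n : ℕ) {π : Pf L K Γ} {A : Fm L Γ} {l : List (Fm L Γ)}, π.Valid E →
    π.concl.suc.Perm (List.replicate n A ++ l) →
      (π.contrR A n).symbols ≤ π.symbols + (n + 1) * (π.concl.symbols + A.symbols)
  | 0, π, A, l, hv, h => by
    simp only [Pf.contrR, Pf.symbols, URule.cost, URule.concl, Seq.symbols, List.map_cons,
      List.sum_cons]
    omega
  | 1, π, A, l, hv, h => by simp [Pf.contrR, Pf.frontSuc, Pf.symbols, URule.cost]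
  | n + 2, π, A, l, hv, h => by
    obtain ⟨hv', l', e, hp⟩ := Pf.frontSuc2_spec (l := List.replicate n A ++ l) h hv
    have hc : (Pf.un (.cR A) (π.frontSuc2 A)).concl = ⟨π.concl.ant, A :: l'⟩ := by
      simp only [Pf.concl, URule.concl, e, List.tail_cons]
    have ih := Pf.symbols_contrR (n + 1) (π := .un (.cR A) (π.frontSuc2 A))
      (A := A) (l := l) ⟨hv', l', by rw [e]⟩ (by rw [hc]; exact hp.cons A)
    have hle : (Pf.un (.cR A) (π.frontSuc2 A)).concl.symbols ≤ π.concl.symbols := by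
      have h₁ : π.concl.Same ⟨π.concl.ant, A :: A :: l'⟩ :=
        ⟨.refl _, h.trans ((hp.symm.cons A).cons A)⟩
      rw [hc, h₁.symbols_eq]
      simp only [Seq.symbols, List.map_cons, List.sum_cons]
      omega
    have hs : (Pf.un (.cR A) (π.frontSuc2 A)).symbols
        = π.symbols + (Pf.un (.cR A) (π.frontSuc2 A)).concl.symbols := by
      simp [Pf.frontSuc2, Pf.frontSuc, Pf.symbols, URule.cost, Pf.concl]
    rw [Pf.contrR]
    have hm := Nat.mul_le_mul_left (n + 1 + 1) (Nat.add_le_add_right hle A.symbols)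
    have : (n + 2 + 1) * (π.concl.symbols + A.symbols)
        = (n + 1 + 1) * (π.concl.symbols + A.symbols) + (π.concl.symbols + A.symbols) := by ring
    omega

/-- A cut after the contraction of the cut formulas. -/
theorem Pf.cut_contr_spec {π₁ π₂ : Pf L K Γ} {A : Fm L Γ} {n₁ n₂ : ℕ} {l₁ l₂ : List (Fm L Γ)}
    (hv₁ : π₁.Valid E) (hv₂ : π₂.Valid E) (h₁ : π₁.concl.suc.Perm (List.replicate n₁ A ++ l₁))
    (h₂ : π₂.concl.ant.Perm (List.replicate n₂ A ++ l₂)) :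
    (Pf.bin (.cut A) (π₁.contrR A n₁) (π₂.contrL A n₂)).Valid E ∧
    (Pf.bin (.cut A) (π₁.contrR A n₁) (π₂.contrL A n₂)).concl.Same
      ⟨π₁.concl.ant ++ l₂, l₁ ++ π₂.concl.suc⟩ := by
  obtain ⟨hv₁', l₁', e₁, hp₁⟩ := Pf.contrR_spec n₁ hv₁ h₁
  obtain ⟨hv₂', l₂', e₂, hp₂⟩ := Pf.contrL_spec n₂ hv₂ h₂
  refine ⟨⟨hv₁', hv₂', ⟨l₁', by rw [e₁]⟩, l₂', by rw [e₂]⟩, ?_⟩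
  simp only [Pf.concl, e₁, e₂, BRule.concl, List.tail_cons]
  exact ⟨hp₂.append_left _, hp₁.append_right _⟩

theorem Seq.symbols_le_of_replicate {s : Seq L Γ} {A : Fm L Γ} {n : ℕ} {l : List (Fm L Γ)}
    (h : s.ant.Perm (List.replicate n A ++ l) ∨ s.suc.Perm (List.replicate n A ++ l)) :
    n ≤ s.symbols ∧ (l.map Fm.symbols).sum ≤ ((List.replicate n A ++ l).map Fm.symbols).sum := by
  have hn : n ≤ ((List.replicate n A).map Fm.symbols).sum := by
    simp only [List.map_replicate, List.sum_replicate, smul_eq_mul]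
    exact Nat.le_mul_of_pos_right _ A.symbols_pos
  rw [List.map_append, List.sum_append]
  refine ⟨?_, Nat.le_add_left _ _⟩
  simp only [Seq.symbols]
  rcases h with h | h <;>
  · have := (h.map Fm.symbols).sum_eq
    rw [List.map_append, List.sum_append] at this
    omega

/-- The number of symbols that a resolution step adds, in terms of the end-sequents of the
premises. -/
theorem Pf.symbols_cut_contr {π₁ π₂ : Pf L K Γ} {A : Fm L Γ} {n₁ n₂ : ℕ} {l₁ l₂ : List (Fm L Γ)}
    (hv₁ : π₁.Valid E) (hv₂ : π₂.Valid E) (h₁ : π₁.concl.suc.Perm (List.replicate n₁ A ++ l₁))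
    (h₂ : π₂.concl.ant.Perm (List.replicate n₂ A ++ l₂)) :
    (Pf.bin (.cut A) (π₁.contrR A n₁) (π₂.contrL A n₂)).concl.symbols
        ≤ π₁.concl.symbols + π₂.concl.symbols ∧
      (Pf.bin (.cut A) (π₁.contrR A n₁) (π₂.contrL A n₂)).symbols
        ≤ π₁.symbols + π₂.symbols
          + (π₁.concl.symbols + 1) * (π₁.concl.symbols + A.symbols)
          + (π₂.concl.symbols + 1) * (π₂.concl.symbols + A.symbols)
          + (π₁.concl.symbols + π₂.concl.symbols) := by
  obtain ⟨hn₁, hl₁⟩ := Seq.symbols_le_of_replicate (.inr h₁)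
  obtain ⟨hn₂, hl₂⟩ := Seq.symbols_le_of_replicate (.inl h₂)
  have hc : (Pf.bin (.cut A) (π₁.contrR A n₁) (π₂.contrL A n₂)).concl.symbols
      ≤ π₁.concl.symbols + π₂.concl.symbols := by
    rw [(Pf.cut_contr_spec hv₁ hv₂ h₁ h₂).2.symbols_eq]
    have e₁ := (h₁.map Fm.symbols).sum_eq
    have e₂ := (h₂.map Fm.symbols).sum_eq
    simp only [Seq.symbols, List.map_append, List.sum_append] at *
    omega
  refine ⟨hc, ?_⟩
  have k₁ := Pf.symbols_contrR n₁ hv₁ h₁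
  have k₂ := Pf.symbols_contrL n₂ hv₂ h₂
  have m₁ := Nat.mul_le_mul_right (π₁.concl.symbols + A.symbols) (Nat.add_le_add_right hn₁ 1)
  have m₂ := Nat.mul_le_mul_right (π₂.concl.symbols + A.symbols) (Nat.add_le_add_right hn₂ 1)
  have e : (Pf.bin (.cut A) (π₁.contrR A n₁) (π₂.contrL A n₂)).symbols
      = (π₁.contrR A n₁).symbols + (π₂.contrL A n₂).symbols
        + (Pf.bin (.cut A) (π₁.contrR A n₁) (π₂.contrL A n₂)).concl.symbols := rfl
  omega

end Contractions

/-! ### The derivation obtained from a resolution refutation -/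

section Skeletons

variable {L : Lang} {E : Rules L} {K : ProofSyms L}

/-- `n` copies of a sequent. -/
def Seq.copies {Γ : List Ty} (S : Seq L Γ) (n : ℕ) : Seq L Γ :=
  ⟨(List.replicate n S.ant).flatten, (List.replicate n S.suc).flatten⟩

theorem Seq.copies_add {Γ : List Ty} (S : Seq L Γ) (m n : ℕ) :
    S.copies (m + n) = (S.copies m).comp (S.copies n) := by
  simp only [Seq.copies, Seq.comp, List.replicate_add, List.flatten_append]

theorem RTree.leaves_length_le (t : RTree L) : t.leaves.length ≤ t.size := by
  induction t with
  | leaf C => simp [RTree.leaves, RTree.size]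
  | res t₁ t₂ P ih₁ ih₂ => simp only [RTree.leaves, RTree.size, List.length_append]; omega

theorem RTree.leaves_length_pos (t : RTree L) : 0 < t.leaves.length := by
  induction t with
  | leaf C => simp [RTree.leaves]
  | res t₁ t₂ P ih₁ ih₂ => simp only [RTree.leaves, List.length_append]; omega

theorem RTree.size_le_symbols (t : RTree L) : t.size ≤ t.symbols := by
  induction t with
  | leaf C => simp [RTree.size, RTree.symbols, Seq.symbols]
  | res t₁ t₂ P ih₁ ih₂ => simp only [RTree.size, RTree.symbols]; omega

open Classical in
theorem perm_count_filter {α : Type} (a : α) (l : List α) :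
    l.Perm (List.replicate (l.count a) a ++ l.filter (· ≠ a)) := by
  have := List.filter_append_perm (fun x => decide (x = a)) l
  rw [← List.filter_eq]
  refine this.symm.trans ?_
  simp

open Classical in
/-- The occurrences of the resolved atom in the end-sequents of the premises. -/
theorem Clause.perm_suc {S : Seq L []} {C : Clause L []} {s : Seq L []} (P : Atm L [])
    (h : s.Same (S.comp C.toSeq)) : s.suc.Perm (List.replicate (C.suc.count P) P.toFm ++
      (S.suc ++ (C.suc.filter (· ≠ P)).map Atm.toFm)) := by
  have h₁ := (perm_count_filter P C.suc).map Atm.toFm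
  rw [List.map_append, List.map_replicate] at h₁
  refine h.2.trans ((h₁.append_left S.suc).trans ?_)
  rw [← List.append_assoc, ← List.append_assoc]
  exact List.perm_append_comm.append_right _

open Classical in
theorem Clause.perm_ant {S : Seq L []} {C : Clause L []} {s : Seq L []} (P : Atm L [])
    (h : s.Same (S.comp C.toSeq)) : s.ant.Perm (List.replicate (C.ant.count P) P.toFm ++
      (S.ant ++ (C.ant.filter (· ≠ P)).map Atm.toFm)) := by
  have h₁ := (perm_count_filter P C.ant).map Atm.toFm
  rw [List.map_append, List.map_replicate] at h₁
  refine h.1.trans ((h₁.append_left S.ant).trans ?_)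
  rw [← List.append_assoc, ← List.append_assoc]
  exact List.perm_append_comm.append_right _

variable {S : Seq L []} {CL : Set (Clause L [])} {PR : Finset (Pf L K [])}

theorem Pf.concl_psub_same {φ : Pf L K []} (hp : φ.Plain) (hS : S.V2Free) {C D : Clause L []}
    (hφ : φ.concl.Same (S.comp C.toSeq)) {σ : PSub L} (hD : D.Same (C.map fun u => u.psub σ)) :
    (φ.map (Tr.psub σ)).concl.Same (S.comp D.toSeq) := by
  rw [Pf.Plain.concl_map (Tr.psub_hom σ) hp]
  refine (hφ.map _).trans ?_
  rw [Seq.map_comp, Seq.psub_of_v2Free σ hS, ← Clause.toSeq_map (Tr.psub_hom σ)]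
  exact (Seq.Same.refl S).comp ⟨(hD.1.map _).symm, (hD.2.map _).symm⟩

/-- The derivation obtained from a resolution deduction is a ground derivation with atomic cuts of
the end-clause, extended by a copy of `S` for each leaf. -/
theorem Skeleton.spec (hPR : ∀ φ ∈ PR, φ.Valid E ∧ φ.Plain) (hS : S.V2Free) {t : RTree L}
    {π : Pf L K []} (h : Skeleton S CL PR t π) (hg : t.PivotsGround) :
    π.Valid E ∧ π.Ground ∧ π.AtomicCuts ∧
      π.concl.Same ((S.copies t.leaves.length).comp t.es.toSeq) := by
  induction h with
  | leaf D C σ φ hC hφ hs hσ hD =>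
    obtain ⟨hv, hp⟩ := hPR φ hφ
    refine ⟨hp.valid_psub σ hv, hp.ground_psub hσ, hp.atomicCuts_map _, ?_⟩
    have := Pf.concl_psub_same hp hS hs hD
    simpa [RTree.leaves, RTree.es, Seq.copies] using this
  | res t₁ t₂ P π₁ π₂ _ _ ih₁ ih₂ =>
    obtain ⟨hP, hg₁, hg₂⟩ := hg
    obtain ⟨hv₁, hgr₁, ha₁, hc₁⟩ := ih₁ hg₁
    obtain ⟨hv₂, hgr₂, ha₂, hc₂⟩ := ih₂ hg₂
    obtain ⟨hv, hc⟩ := Pf.cut_contr_spec hv₁ hv₂ (Clause.perm_suc P hc₁) (Clause.perm_ant P hc₂)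
    refine ⟨hv, ⟨hP, Pf.ground_contrR _ hP hgr₁, Pf.ground_contrL _ hP hgr₂⟩,
      ⟨?_, Pf.atomicCuts_contrR _ _ ha₁, Pf.atomicCuts_contrL _ _ ha₂⟩, hc.trans ?_⟩
    · intro A hA; cases hA; exact ⟨P, rfl⟩
    · rw [RTree.leaves, List.length_append, Seq.copies_add]
      simp only [RTree.es, Clause.toSeq, Seq.comp, List.map_append]
      exact ⟨append_append_perm hc₁.1 (.refl _), append_append_perm (.refl _) hc₂.2⟩

/-! #### Contracting the copies of the end-sequent -/

theorem flatten_replicate_cons {α : Type} (n : ℕ) (a : α) (l : List α) :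
    (List.replicate n (a :: l)).flatten.Perm (List.replicate n a ++ (List.replicate n l).flatten) := by
  induction n with
  | zero => exact .refl _
  | succ n ih =>
    simp only [List.replicate_succ, List.flatten_cons, List.cons_append]
    refine List.Perm.cons a ((ih.append_left l).trans ?_)
    rw [← List.append_assoc, ← List.append_assoc]
    exact List.perm_append_comm.append_right _

theorem perm_replicate_step {α : Type} {n : ℕ} {a : α} {l d m : List α}
    (h : m.Perm (d ++ (List.replicate n (a :: l)).flatten)) :
    m.Perm (List.replicate n a ++ (d ++ (List.replicate n l).flatten)) := by
  refine h.trans (((flatten_replicate_cons n a l).append_left d).trans ?_)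
  rw [← List.append_assoc, ← List.append_assoc]
  exact List.perm_append_comm.append_right _

/-- The properties of a derivation that are preserved by contractions. -/
def Pf.GroundAtomic (E : Rules L) (π : Pf L K []) : Prop := π.Valid E ∧ π.Ground ∧ π.AtomicCuts

/-- The copies of the formulas of a list are contracted one formula after the other; `d` collects
the formulas whose copies have been contracted already. -/
theorem Pf.foldl_contrL_spec {n : ℕ} : ∀ (l d : List (Fm L [])) (π : Pf L K []),
    π.GroundAtomic E → (∀ A ∈ l, A.V2Free) →
    π.concl.ant.Perm (d ++ (List.replicate n l).flatten) →
    (l.foldl (fun ρ A => ρ.contrL A n) π).GroundAtomic E ∧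
    (l.foldl (fun ρ A => ρ.contrL A n) π).concl.suc = π.concl.suc ∧
    (l.foldl (fun ρ A => ρ.contrL A n) π).concl.ant.Perm (d ++ l) ∧
    (l.foldl (fun ρ A => ρ.contrL A n) π).size ≤ π.size + l.length * (n + 1)
  | [], d, π, hπ, _, h => ⟨hπ, rfl, by simpa using h, by simp⟩
  | A :: l, d, π, hπ, hl, h => by
    rw [List.forall_mem_cons] at hl
    obtain ⟨hv, l', e, hp⟩ := Pf.contrL_spec n hπ.1 (perm_replicate_step h)
    obtain ⟨h₁, h₂, h₃, h₄⟩ := Pf.foldl_contrL_spec l (A :: d) (π.contrL A n)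
      ⟨hv, Pf.ground_contrL n hl.1 hπ.2.1, Pf.atomicCuts_contrL n A hπ.2.2⟩ hl.2
      (by rw [e]; exact hp.cons A)
    refine ⟨h₁, h₂.trans (by rw [e]), h₃.trans List.perm_middle.symm, h₄.trans ?_⟩
    have := Pf.size_contrL n π A
    simp only [List.length_cons, Nat.add_mul]
    omega

theorem Pf.foldl_contrR_spec {n : ℕ} : ∀ (l d : List (Fm L [])) (π : Pf L K []),
    π.GroundAtomic E → (∀ A ∈ l, A.V2Free) →
    π.concl.suc.Perm (d ++ (List.replicate n l).flatten) →
    (l.foldl (fun ρ A => ρ.contrR A n) π).GroundAtomic E ∧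
    (l.foldl (fun ρ A => ρ.contrR A n) π).concl.ant = π.concl.ant ∧
    (l.foldl (fun ρ A => ρ.contrR A n) π).concl.suc.Perm (d ++ l) ∧
    (l.foldl (fun ρ A => ρ.contrR A n) π).size ≤ π.size + l.length * (n + 1)
  | [], d, π, hπ, _, h => ⟨hπ, rfl, by simpa using h, by simp⟩
  | A :: l, d, π, hπ, hl, h => by
    rw [List.forall_mem_cons] at hl
    obtain ⟨hv, l', e, hp⟩ := Pf.contrR_spec n hπ.1 (perm_replicate_step h)
    obtain ⟨h₁, h₂, h₃, h₄⟩ := Pf.foldl_contrR_spec l (A :: d) (π.contrR A n)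
      ⟨hv, Pf.ground_contrR n hl.1 hπ.2.1, Pf.atomicCuts_contrR n A hπ.2.2⟩ hl.2
      (by rw [e]; exact hp.cons A)
    refine ⟨h₁, h₂.trans (by rw [e]), h₃.trans List.perm_middle.symm, h₄.trans ?_⟩
    have := Pf.size_contrR n π A
    simp only [List.length_cons, Nat.add_mul]
    omega

theorem Pf.contractAll_spec {n : ℕ} {π : Pf L K []} (hπ : π.GroundAtomic E) (hS : S.V2Free)
    (h : π.concl.Same (S.copies n)) :
    (π.contractAll S n).GroundAtomic E ∧ (π.contractAll S n).concl.Same S ∧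
      (π.contractAll S n).size ≤ π.size + (S.ant.length + S.suc.length) * (n + 1) := by
  obtain ⟨h₁, h₂, h₃, h₄⟩ := Pf.foldl_contrL_spec S.ant [] π hπ hS.1 h.1
  obtain ⟨k₁, k₂, k₃, k₄⟩ := Pf.foldl_contrR_spec S.suc [] _ h₁ hS.2 (by rw [h₂]; exact h.2)
  refine ⟨k₁, ⟨?_, k₃⟩, ?_⟩
  · rw [Pf.contractAll, k₂]; exact h₃
  · rw [Nat.add_mul, Pf.contractAll]; omega

/-- A bound for one contraction step: the end-sequent does not grow. -/
theorem Pf.symbols_contrL_le {n M : ℕ} (hn : 0 < n) {π : Pf L K []} {A : Fm L []}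
    {l : List (Fm L [])} (hπ : π.Valid E) (h : π.concl.ant.Perm (List.replicate n A ++ l))
    (hM : π.concl.symbols ≤ M) : (π.contrL A n).concl.symbols ≤ M ∧
      (π.contrL A n).symbols ≤ π.symbols + (n + 1) * (2 * M) := by
  obtain ⟨n, rfl⟩ : ∃ m, n = m + 1 := ⟨n - 1, by omega⟩
  obtain ⟨-, l', e, hp⟩ := Pf.contrL_spec (n + 1) hπ h
  have hs := (h.map Fm.symbols).sum_eq
  have hA : A.symbols ≤ M := by
    refine le_trans ?_ hM
    simp only [Seq.symbols, hs, List.replicate_succ, List.cons_append, List.map_cons, List.sum_cons]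
    omega
  constructor
  · refine le_trans ?_ hM
    rw [e]
    simp only [Seq.symbols, hs, List.replicate_succ, List.cons_append, List.map_cons,
      List.sum_cons, List.map_append, List.sum_append, (hp.map Fm.symbols).sum_eq]
    omega
  · refine (Pf.symbols_contrL (n + 1) hπ h).trans ?_
    gcongr
    omega

theorem Pf.symbols_contrR_le {n M : ℕ} (hn : 0 < n) {π : Pf L K []} {A : Fm L []}
    {l : List (Fm L [])} (hπ : π.Valid E) (h : π.concl.suc.Perm (List.replicate n A ++ l))
    (hM : π.concl.symbols ≤ M) : (π.contrR A n).concl.symbols ≤ M ∧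
      (π.contrR A n).symbols ≤ π.symbols + (n + 1) * (2 * M) := by
  obtain ⟨n, rfl⟩ : ∃ m, n = m + 1 := ⟨n - 1, by omega⟩
  obtain ⟨-, l', e, hp⟩ := Pf.contrR_spec (n + 1) hπ h
  have hs := (h.map Fm.symbols).sum_eq
  have hA : A.symbols ≤ M := by
    refine le_trans ?_ hM
    simp only [Seq.symbols, hs, List.replicate_succ, List.cons_append, List.map_cons, List.sum_cons]
    omega
  constructor
  · refine le_trans ?_ hM
    rw [e]
    simp only [Seq.symbols, hs, List.replicate_succ, List.cons_append, List.map_cons,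
      List.sum_cons, List.map_append, List.sum_append, (hp.map Fm.symbols).sum_eq]
    omega
  · refine (Pf.symbols_contrR (n + 1) hπ h).trans ?_
    gcongr
    omega

theorem Pf.symbols_foldl_contrL {n M : ℕ} (hn : 0 < n) :
    ∀ (l d : List (Fm L [])) (π : Pf L K []), π.Valid E →
    π.concl.ant.Perm (d ++ (List.replicate n l).flatten) → π.concl.symbols ≤ M →
    (l.foldl (fun ρ A => ρ.contrL A n) π).concl.symbols ≤ M ∧
    (l.foldl (fun ρ A => ρ.contrL A n) π).symbols ≤ π.symbols + l.length * ((n + 1) * (2 * M))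
  | [], d, π, _, _, hM => ⟨hM, by simp⟩
  | A :: l, d, π, hπ, h, hM => by
    obtain ⟨hv, l', e, hp⟩ := Pf.contrL_spec n hπ (perm_replicate_step h)
    obtain ⟨h₁, h₂⟩ := Pf.symbols_contrL_le hn hπ (perm_replicate_step h) hM
    obtain ⟨h₃, h₄⟩ := Pf.symbols_foldl_contrL hn l (A :: d) (π.contrL A n) hv
      (by rw [e]; exact hp.cons A) h₁
    refine ⟨h₃, h₄.trans ?_⟩
    rw [List.length_cons, Nat.add_mul l.length 1 ((n + 1) * (2 * M)), one_mul]
    omega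

theorem Pf.symbols_foldl_contrR {n M : ℕ} (hn : 0 < n) :
    ∀ (l d : List (Fm L [])) (π : Pf L K []), π.Valid E →
    π.concl.suc.Perm (d ++ (List.replicate n l).flatten) → π.concl.symbols ≤ M →
    (l.foldl (fun ρ A => ρ.contrR A n) π).concl.symbols ≤ M ∧
    (l.foldl (fun ρ A => ρ.contrR A n) π).symbols ≤ π.symbols + l.length * ((n + 1) * (2 * M))
  | [], d, π, _, _, hM => ⟨hM, by simp⟩
  | A :: l, d, π, hπ, h, hM => by
    obtain ⟨hv, l', e, hp⟩ := Pf.contrR_spec n hπ (perm_replicate_step h)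
    obtain ⟨h₁, h₂⟩ := Pf.symbols_contrR_le hn hπ (perm_replicate_step h) hM
    obtain ⟨h₃, h₄⟩ := Pf.symbols_foldl_contrR hn l (A :: d) (π.contrR A n) hv
      (by rw [e]; exact hp.cons A) h₁
    refine ⟨h₃, h₄.trans ?_⟩
    rw [List.length_cons, Nat.add_mul l.length 1 ((n + 1) * (2 * M)), one_mul]
    omega

theorem Seq.length_le_symbols {Γ : List Ty} (s : Seq L Γ) :
    s.ant.length + s.suc.length ≤ s.symbols := by
  have key : ∀ l : List (Fm L Γ), l.length ≤ (l.map Fm.symbols).sum := by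
    intro l
    induction l with
    | nil => simp
    | cons A l ih =>
      have := A.symbols_pos
      simp only [List.length_cons, List.map_cons, List.sum_cons]
      omega
  have h₁ := key s.ant
  have h₂ := key s.suc
  simp only [Seq.symbols]
  omega

/-- None of the contractions enlarges the end-sequent, since at least one copy is present. -/
theorem Pf.symbols_contractAll {n M : ℕ} (hn : 0 < n) {π : Pf L K []} (hπ : π.GroundAtomic E)
    (hS : S.V2Free) (h : π.concl.Same (S.copies n)) (hM : π.concl.symbols ≤ M) :
    (π.contractAll S n).symbols ≤ π.symbols + M * ((n + 1) * (2 * M)) := by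
  obtain ⟨h₁, h₂, -, -⟩ := Pf.foldl_contrL_spec S.ant [] π hπ hS.1 h.1
  obtain ⟨k₁, k₂⟩ := Pf.symbols_foldl_contrL hn S.ant [] π hπ.1 h.1 hM
  obtain ⟨-, k₄⟩ := Pf.symbols_foldl_contrR hn S.suc [] _ h₁.1 (by rw [h₂]; exact h.2) k₁
  have hlen : S.ant.length + S.suc.length ≤ M := by
    refine le_trans ?_ ((Seq.length_le_symbols _).trans hM)
    obtain ⟨m, rfl⟩ : ∃ m, n = m + 1 := ⟨n - 1, by omega⟩
    rw [h.1.length_eq, h.2.length_eq]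
    simp only [Seq.copies, List.replicate_succ, List.flatten_cons, List.length_append]
    omega
  have := Nat.mul_le_mul_right ((n + 1) * (2 * M)) hlen
  rw [Nat.add_mul] at this
  rw [Pf.contractAll]
  omega

end Skeletons

/-! ### Bounds for the derivation obtained from a refutation -/

section Bounds

variable {L : Lang} {E : Rules L} {K : ProofSyms L}

theorem Pf.size_pos {Γ : List Ty} (φ : Pf L K Γ) : 0 < φ.size := by
  induction φ with
  | un r π ih => exact Nat.add_pos_left ih _
  | _ => simp [Pf.size]

/-- In a projection each inference creates at most two formula occurrences of the end-sequent. -/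
theorem Pf.Plain.length_concl_le {Γ : List Ty} {φ : Pf L K Γ} (hp : φ.Plain) (hv : φ.Valid E) :
    φ.concl.ant.length + φ.concl.suc.length ≤ 2 * φ.size := by
  induction φ with
  | ax A => simp [Pf.concl, Pf.size]
  | link j a as => exact hp.elim
  | un r π ih =>
    have := ih hp.2 hv.1
    have hr := hp.1
    have hok := hv.2
    cases r with
    | allR | exL | eqv => exact hr.elim
    | frontL i =>
      have := (toFront_perm hok).length_eq
      simp only [Pf.concl, URule.concl, Pf.size, URule.cost]; omega
    | frontR i =>
      have := (toFront_perm hok).length_eq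
      simp only [Pf.concl, URule.concl, Pf.size, URule.cost]; omega
    | _ =>
      simp only [Pf.concl, URule.concl, Pf.size, URule.cost, List.length_cons, List.length_tail]
      omega
  | bin r π₁ π₂ ih₁ ih₂ =>
    have := ih₁ hp.2.1 hv.1
    have := ih₂ hp.2.2 hv.2.1
    cases r <;>
    · simp only [Pf.concl, BRule.concl, Pf.size, List.length_cons, List.length_append,
        List.length_tail]
      omega

theorem Pf.symbols_concl_le {Γ : List Ty} {φ : Pf L K Γ} (hv : φ.Valid E) :
    φ.concl.symbols ≤ φ.symbols := by
  induction φ with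
  | ax A => exact le_rfl
  | link j a as => exact le_rfl
  | un r π ih =>
    have h := ih hv.1
    have hok := hv.2
    cases r with
    | frontL i =>
      have e : Seq.Same (URule.concl (.frontL i) π.concl) π.concl := ⟨toFront_perm hok, .refl _⟩
      simpa only [Pf.concl, Pf.symbols, e.symbols_eq, URule.cost, zero_mul, add_zero] using h
    | frontR i =>
      have e : Seq.Same (URule.concl (.frontR i) π.concl) π.concl := ⟨.refl _, toFront_perm hok⟩
      simpa only [Pf.concl, Pf.symbols, e.symbols_eq, URule.cost, zero_mul, add_zero] using h
    | _ => simp only [Pf.concl, Pf.symbols, URule.cost, one_mul]; omega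
  | bin r π₁ π₂ ih₁ ih₂ => simp only [Pf.concl, Pf.symbols]; omega

variable {S : Seq L []} {CL : Set (Clause L [])} {PR : Finset (Pf L K [])}

theorem Skeleton.nonempty {t : RTree L} {π : Pf L K []} (h : Skeleton S CL PR t π) :
    PR.Nonempty := by
  induction h with
  | leaf D C σ φ hC hφ => exact ⟨φ, hφ⟩
  | res t₁ t₂ P π₁ π₂ _ _ ih₁ ih₂ => exact ih₁

/-- The number of formula occurrences in the end-sequent. -/
theorem Skeleton.length_le {N : ℕ} (hPR : ∀ φ ∈ PR, φ.Valid E ∧ φ.Plain)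
    (hN : ∀ φ ∈ PR, φ.size ≤ N) {t : RTree L} {π : Pf L K []} (h : Skeleton S CL PR t π) :
    t.leaves.length * (S.ant.length + S.suc.length) + (t.es.ant.length + t.es.suc.length)
      ≤ 2 * N * t.size := by
  induction h with
  | leaf D C σ φ hC hφ hs hσ hD =>
    have h₁ := (hPR φ hφ).2.length_concl_le (hPR φ hφ).1
    have h₂ := hN φ hφ
    rw [hs.1.length_eq, hs.2.length_eq] at h₁
    simp only [RTree.leaves, RTree.es, RTree.size, hD.1.length_eq, hD.2.length_eq, Clause.map,
      Clause.toSeq, Seq.comp, List.length_append, List.length_map, List.length_singleton] at h₁ ⊢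
    omega
  | res t₁ t₂ P π₁ π₂ _ _ ih₁ ih₂ =>
    classical
    have h₁ := List.length_filter_le (fun A => decide (A ≠ P)) t₂.es.ant
    have h₂ := List.length_filter_le (fun A => decide (A ≠ P)) t₁.es.suc
    simp only [RTree.leaves, RTree.es, RTree.size, List.length_append, Nat.add_mul, Nat.mul_add]
      at *
    omega

/-- A resolution step contracts at most all occurrences of the two end-clauses and adds one
cut. -/
theorem Skeleton.size_le {N M : ℕ} (hPR : ∀ φ ∈ PR, φ.Valid E ∧ φ.Plain)
    (hN : ∀ φ ∈ PR, φ.size ≤ N) {t : RTree L} {π : Pf L K []} (h : Skeleton S CL PR t π)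
    (hM : t.size ≤ M) : π.size ≤ (N + 4 * N * M + 3) * t.size := by
  induction h with
  | leaf D C σ φ hC hφ hs hσ hD =>
    have := hN φ hφ
    simp only [Pf.size_map, RTree.size]
    omega
  | res t₁ t₂ P π₁ π₂ h₁ h₂ ih₁ ih₂ =>
    classical
    simp only [RTree.size] at hM
    have ih₁ := ih₁ (by omega)
    have ih₂ := ih₂ (by omega)
    have l₁ := h₁.length_le hPR hN
    have l₂ := h₂.length_le hPR hN
    have m₁ : 2 * N * t₁.size ≤ 2 * N * M := Nat.mul_le_mul_left _ (by omega)
    have m₂ : 2 * N * t₂.size ≤ 2 * N * M := Nat.mul_le_mul_left _ (by omega)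
    have c₁ : t₁.es.suc.count P ≤ _ := List.count_le_length
    have c₂ : t₂.es.ant.count P ≤ _ := List.count_le_length
    have s₁ := Pf.size_contrR (t₁.es.suc.count P) π₁ P.toFm
    have s₂ := Pf.size_contrL (t₂.es.ant.count P) π₂ P.toFm
    have e : 4 * N * M = 2 * N * M + 2 * N * M := by ring
    simp only [Pf.size, RTree.size, Nat.mul_add, mul_one]
    omega

/-- The contractions of the copies of `S` are paid for by the occurrences of `S` in the
projections. -/
theorem Skeleton.size_contractAll_le {N : ℕ} (hPR : ∀ φ ∈ PR, φ.Valid E ∧ φ.Plain)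
    (hN : ∀ φ ∈ PR, φ.size ≤ N) (hS : S.V2Free) {t : RTree L} {π : Pf L K []}
    (h : Skeleton S CL PR t π) (hg : t.PivotsGround) (ht : t.es = ⟨[], []⟩) :
    (π.contractAll S t.leaves.length).GroundAtomic E ∧
      (π.contractAll S t.leaves.length).concl.Same S ∧
      (π.contractAll S t.leaves.length).size ≤ 4 * (t.size * N) ^ 2 + 8 * (t.size * N) := by
  obtain ⟨hv, hgr, ha, hc⟩ := Skeleton.spec hPR hS h hg
  have hc' : π.concl.Same (S.copies t.leaves.length) := by
    rw [ht] at hc; simpa [Clause.toSeq, Seq.comp] using hc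
  obtain ⟨h₁, h₂, h₃⟩ := Pf.contractAll_spec ⟨hv, hgr, ha⟩ hS hc'
  refine ⟨h₁, h₂, h₃.trans ?_⟩
  have h₄ := h.size_le hPR hN le_rfl
  have h₅ := h.length_le hPR hN
  have hk := t.leaves_length_pos
  obtain ⟨φ, hφ⟩ := h.nonempty
  have hN1 : 1 ≤ N := φ.size_pos.trans_le (hN φ hφ)
  have hM1 : 1 ≤ t.size := hk.trans_le t.leaves_length_le
  generalize t.size = M at *
  generalize t.leaves.length = k at *
  generalize S.ant.length + S.suc.length = s at *
  have a₁ : s * (k + 1) ≤ 2 * (k * s) := by nlinarith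
  have a₂ : M ≤ M * N := Nat.le_mul_of_pos_right _ hN1
  have a₃ : (M * N) * M ≤ (M * N) * (M * N) := Nat.mul_le_mul_left _ a₂
  nlinarith

end Bounds

/-! #### Choosing small ground instances -/

section Instances

variable {L : Lang} {E : Rules L} {K : ProofSyms L}

open Classical in
/-- The number of symbols of some closed ground normal term, if there is one. -/
noncomputable def Lang.groundSymbols (L : Lang) : ℕ :=
  if h : ∃ t : Tm L [] Ty.ind, t.V2Free ∧ t.Normal then h.choose.symbols else 0

theorem Lang.exists_ground {t : Tm L [] Ty.ind} (ht : t.V2Free ∧ t.Normal) :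
    ∃ u : Tm L [] Ty.ind, (u.V2Free ∧ u.Normal) ∧ u.symbols = L.groundSymbols := by
  have h : ∃ t : Tm L [] Ty.ind, t.V2Free ∧ t.Normal := ⟨t, ht⟩
  exact ⟨h.choose, h.choose_spec, by rw [Lang.groundSymbols, dif_pos h]⟩

/-- A ground substitution may be changed on the variables that do not occur in the clause, so that
its values become small relative to the instance of the clause. -/
theorem Clause.exists_small_psub (C : Clause L []) {σ : PSub L} (hσ : σ.Ground) :
    ∃ σ' : PSub L, σ'.Ground ∧ (C.map fun u => u.psub σ') = (C.map fun u => u.psub σ) ∧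
      ∀ x n, (σ' x n).symbols
        ≤ L.groundSymbols + (C.map fun u => u.psub σ).toSeq.symbols := by
  classical
  choose g hg hgs using fun x n => Lang.exists_ground (hσ x n)
  refine ⟨fun x n => if C.HasVar x n then σ x n else g x n, ?_, ?_, ?_⟩
  · intro x n
    dsimp only
    split
    · exact hσ x n
    · exact hg x n
  · exact Clause.psub_congr fun x n h => if_pos h
  · intro x n
    dsimp only
    split
    · rename_i h
      exact h.symbols_le.trans (Nat.le_add_left _ _)
    · rw [hgs]
      exact Nat.le_add_right _ _

variable {S : Seq L []} {CL : Set (Clause L [])} {ξ : PT L K []}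

/-- A leaf of the refutation can be replaced by a small instance of a projection. -/
theorem Matches.exists_leaf (h : Matches E S CL ξ.proofs) {D C : Clause L []} (hC : C ∈ CL)
    {σ : PSub L} (hσ : σ.Ground) (hD : D.Same (C.map fun u => u.psub σ)) :
    ∃ π, Skeleton S CL ξ.proofs (.leaf D) π ∧
      π.symbols ≤ ξ.symbols * (L.groundSymbols + D.toSeq.symbols) := by
  obtain ⟨σ', hg, e, hs⟩ := C.exists_small_psub hσ
  obtain ⟨φ, hφ, hp⟩ := h.proof C hC
  have hD' : D.toSeq.Same (C.map fun u => u.psub σ).toSeq := ⟨hD.1.map _, hD.2.map _⟩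
  refine ⟨_, .leaf D C σ' φ hC hφ hp.concl hg (by rw [e]; exact hD), ?_⟩
  rw [hD'.symbols_eq]
  refine (Pf.symbols_psub_le (Nat.add_pos_right _ (Nat.succ_pos _)) hs hp.plain).trans ?_
  exact Nat.mul_le_mul_right _
    (Finset.single_le_sum (f := Pf.symbols) (fun _ _ => Nat.zero_le _) hφ)

theorem RTree.symbols_le_of_mem_leaves {t : RTree L} {D : Clause L []} (hD : D ∈ t.leaves) :
    D.toSeq.symbols ≤ t.symbols := by
  induction t with
  | leaf C => rw [List.mem_singleton.1 hD]; exact le_rfl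
  | res t₁ t₂ P ih₁ ih₂ =>
    simp only [RTree.symbols]
    rcases List.mem_append.1 hD with h | h
    · have := ih₁ h; omega
    · have := ih₂ h; omega

variable {PR : Finset (Pf L K [])}

/-- If the leaves can be replaced by proofs with at most `N` symbols, then there is a derivation in
which the end-sequents grow at most linearly with the refutation. -/
theorem Skeleton.exists_symbols_le {N M : ℕ} (hPR : ∀ φ ∈ PR, φ.Valid E ∧ φ.Plain)
    (hS : S.V2Free) {t : RTree L} (hg : t.PivotsGround) (hM : t.symbols ≤ M)
    (ht : ∀ D ∈ t.leaves, ∃ π, Skeleton S CL PR (.leaf D) π ∧ π.symbols ≤ N) :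
    ∃ π, Skeleton S CL PR t π ∧ π.concl.symbols ≤ N * t.symbols ∧
      π.symbols ≤ (N + (2 * ((N * M + 1) * (N * M + M)) + 2 * (N * M))) * t.symbols := by
  induction t with
  | leaf D =>
    obtain ⟨π, hπ, hN⟩ := ht D (List.mem_singleton.2 rfl)
    have hv := (Skeleton.spec hPR hS hπ trivial).1
    have h1 : 1 ≤ (RTree.leaf D).symbols := Nat.succ_pos _
    exact ⟨π, hπ, ((Pf.symbols_concl_le hv).trans hN).trans (Nat.le_mul_of_pos_right _ h1),
      (hN.trans (Nat.le_add_right _ _)).trans (Nat.le_mul_of_pos_right _ h1)⟩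
  | res t₁ t₂ P ih₁ ih₂ =>
    classical
    simp only [RTree.symbols] at hM
    obtain ⟨π₁, hπ₁, hc₁, hs₁⟩ := ih₁ hg.2.1 (by omega)
      fun D hD => ht D (List.mem_append_left _ hD)
    obtain ⟨π₂, hπ₂, hc₂, hs₂⟩ := ih₂ hg.2.2 (by omega)
      fun D hD => ht D (List.mem_append_right _ hD)
    obtain ⟨hv₁, -, -, hq₁⟩ := Skeleton.spec hPR hS hπ₁ hg.2.1
    obtain ⟨hv₂, -, -, hq₂⟩ := Skeleton.spec hPR hS hπ₂ hg.2.2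
    obtain ⟨h₁, h₂⟩ := Pf.symbols_cut_contr hv₁ hv₂ (Clause.perm_suc P hq₁)
      (Clause.perm_ant P hq₂)
    refine ⟨_, .res t₁ t₂ P π₁ π₂ hπ₁ hπ₂, h₁.trans ?_, h₂.trans ?_⟩
    · simp only [RTree.symbols, Nat.mul_add]; omega
    · have b₁ : π₁.concl.symbols ≤ N * M := hc₁.trans (Nat.mul_le_mul_left _ (by omega))
      have b₂ : π₂.concl.symbols ≤ N * M := hc₂.trans (Nat.mul_le_mul_left _ (by omega))
      have d₁ := Nat.mul_le_mul (Nat.add_le_add_right b₁ 1)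
        (Nat.add_le_add b₁ (show P.toFm.symbols ≤ M by omega))
      have d₂ := Nat.mul_le_mul (Nat.add_le_add_right b₂ 1)
        (Nat.add_le_add b₂ (show P.toFm.symbols ≤ M by omega))
      have hB : 2 * ((N * M + 1) * (N * M + M)) + 2 * (N * M)
          ≤ N + (2 * ((N * M + 1) * (N * M + M)) + 2 * (N * M)) := Nat.le_add_left _ _
      generalize N + (2 * ((N * M + 1) * (N * M + M)) + 2 * (N * M)) = B at hs₁ hs₂ hB ⊢
      have e : B * (t₁.symbols + t₂.symbols + P.toFm.symbols + 1)
          = B * t₁.symbols + B * t₂.symbols + B * P.toFm.symbols + B := by ring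
      rw [RTree.symbols, e]
      omega

/-- The polynomial that bounds the symbolic size of an output; the language enters only through the
size of a ground term. -/
noncomputable def symbolBound (L : Lang) : Polynomial ℕ :=
  letI X : Polynomial ℕ := .X
  letI N : Polynomial ℕ := X * (.C L.groundSymbols + X)
  (N + (2 * ((N * X + 1) * (N * X + X)) + 2 * (N * X))) * X
    + N * X * ((X + 1) * (2 * (N * X)))

theorem exists_symbols_contractAll_le (hm : Matches E S CL ξ.proofs) (hS : S.V2Free)
    {t : RTree L} (ht : t.IsGroundRefutation CL) :
    ∃ π, Skeleton S CL ξ.proofs t π ∧ (π.contractAll S t.leaves.length).symbols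
      ≤ (symbolBound L).eval (t.symbols * ξ.symbols) := by
  obtain ⟨hes, hg, hl⟩ := ht
  have hPR : ∀ φ ∈ ξ.proofs, φ.Valid E ∧ φ.Plain := fun φ hφ =>
    let ⟨_, _, h⟩ := hm.clause φ hφ; ⟨h.valid, h.plain⟩
  have hleaf : ∀ D ∈ t.leaves, ∃ π, Skeleton S CL ξ.proofs (.leaf D) π ∧
      π.symbols ≤ ξ.symbols * (L.groundSymbols + t.symbols) := by
    intro D hD
    obtain ⟨C, hC, σ, hσ, hs⟩ := hl D hD
    obtain ⟨π, hπ, hb⟩ := hm.exists_leaf hC hσ hs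
    exact ⟨π, hπ, hb.trans (Nat.mul_le_mul_left _
      (Nat.add_le_add_left (RTree.symbols_le_of_mem_leaves hD) _))⟩
  obtain ⟨π, hπ, hc, hs⟩ := Skeleton.exists_symbols_le hPR hS hg le_rfl hleaf
  refine ⟨π, hπ, ?_⟩
  obtain ⟨hv, hgr, ha, hq⟩ := Skeleton.spec hPR hS hπ hg
  have hq' : π.concl.Same (S.copies t.leaves.length) := by
    rw [hes] at hq; simpa [Clause.toSeq, Seq.comp] using hq
  refine (Pf.symbols_contractAll t.leaves_length_pos ⟨hv, hgr, ha⟩ hS hq' hc).trans ?_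
  refine (Nat.add_le_add_right hs _).trans ?_
  have hk : t.leaves.length ≤ t.symbols := t.leaves_length_le.trans t.size_le_symbols
  obtain ⟨φ, hφ⟩ := hπ.nonempty
  have hφ1 : 1 ≤ φ.symbols := (Nat.succ_pos _).trans_le (Pf.symbols_concl_le (hPR φ hφ).1)
  have hξ : 1 ≤ ξ.symbols := hφ1.trans
    (Finset.single_le_sum (f := Pf.symbols) (fun _ _ => Nat.zero_le _) hφ)
  have ht : 1 ≤ t.symbols := t.leaves_length_pos.trans_le hk
  have hX : t.symbols ≤ t.symbols * ξ.symbols := Nat.le_mul_of_pos_right _ hξ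
  have hY : ξ.symbols ≤ t.symbols * ξ.symbols := Nat.le_mul_of_pos_left _ ht
  simp only [symbolBound, Polynomial.eval_add, Polynomial.eval_mul, Polynomial.eval_X,
    Polynomial.eval_C, Polynomial.eval_ofNat, Polynomial.eval_one]
  generalize t.symbols * ξ.symbols = X at *
  have hN := Nat.mul_le_mul hY (Nat.add_le_add_left hX L.groundSymbols)
  generalize ξ.symbols * (L.groundSymbols + t.symbols) = N at *
  generalize X * (L.groundSymbols + X) = N' at *
  have hNM := Nat.mul_le_mul hN hX
  have hk' := hk.trans hX
  gcongr

end Instances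

/-! ### The end-sequent of the schema -/

section EndSequent

variable {L : Lang} {E : Rules L} (Ψ : ProofSchema L E)

theorem ProofSchema.nf_seqAt_v2Free (h : Ψ.K.params 0 = []) (α : ℕ)
    (hS : (Ψ.K.endSeq 0).V2Free) : ((Ψ.seqAt h α).map (Tr.nf E)).V2Free := by
  have hρ : ∀ τ v, Val.All Tm.V2Free ((Sub.cons (Tm.num α) (noArgs h)).env E τ v) := by
    intro τ v
    refine Tm.den_v2Free E _ _ ?_ fun τ v => nomatch v
    cases v with
    | zero => exact Tm.num_v2Free α
    | succ v => rw [h] at v; cases v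
  rw [ProofSchema.seqAt, Seq.nf_sub]
  constructor <;>
  · intro A hA
    obtain ⟨B, hB, rfl⟩ := List.mem_map.1 hA
    first
      | exact B.den_v2Free E _ (hS.1 B hB) hρ
      | exact B.den_v2Free E _ (hS.2 B hB) hρ

theorem Fm.nf_eqE (A : Fm L []) : (A.nf E).EqE E A := by
  rw [Fm.nf_eq E Env.isId_nil]
  exact .symm _ _ (.rel _ _ (A.red_den_id E Env.isId_nil))

/-- A derivation of the normal form of a sequent can be extended by one equality inference to a
derivation of the sequent. -/
theorem Pf.exists_eqv {K : ProofSyms L} {π : Pf L K []} (hv : π.Valid E) {s : Seq L []}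
    (h : π.concl.Same (s.map (Tr.nf E))) :
    ∃ s' : Seq L [], s'.Same s ∧ (Pf.un (.eqv s') π).Valid E := by
  obtain ⟨a, ea, ha⟩ := (congrFun₂ (List.eq_map_comp_perm _) _ _).mpr h.1
  obtain ⟨d, ed, hd⟩ := (congrFun₂ (List.eq_map_comp_perm _) _ _).mpr h.2
  refine ⟨⟨a, d⟩, ⟨ha, hd⟩, hv, ?_⟩
  simp only [URule.OK, ea, ed]
  exact ⟨List.forall₂_map_left_iff.2 (List.forall₂_same.2 fun A _ => A.nf_eqE),
    List.forall₂_map_left_iff.2 (List.forall₂_same.2 fun A _ => A.nf_eqE)⟩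

end EndSequent

end Ceres

theorem mainTheorem1 :
    ∃ p : Polynomial ℕ, ∀ L : Lang, ∃ q : Polynomial ℕ,
      ∀ (E : Rules L) (Ψ : ProofSchema L E) (h : Ψ.K.params 0 = [])
        (R : ResSchema L) (s : ResSubst L R),
        (Ψ.K.endSeq 0).V2Free →
        (∀ α, ((Ψ.seqAt h α).map (Tr.nf E)).NoStrong) →
        s.Refutes Ψ h →
        ∀ α : ℕ,
          (∃ c ξ t π, Output Ψ h s α c ξ t π ∧ π.symbols ≤ q.eval (t.symbols * ξ.symbols)) ∧
          ∀ c ξ t π, Output Ψ h s α c ξ t π →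
            π.Valid E ∧ π.Ground ∧ π.AtomicCuts ∧
            π.concl.Same ((Ψ.seqAt h α).map (Tr.nf E)) ∧
            (∃ S : Ceres.Seq L [], S.Same (Ψ.seqAt h α) ∧ (Pf.un (.eqv S) π).Valid E) ∧
            π.size ≤ p.eval (t.size * ξ.size) := by
  refine ⟨4 * .X ^ 2 + 8 * .X, fun L => ⟨symbolBound L, fun E Ψ h R s hS hn hr α => ⟨?_, ?_⟩⟩⟩
  · obtain ⟨c, t, hc, ht, hg⟩ := hr α
    obtain ⟨ξ, hξ⟩ := Ψ.exists_projAt h α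
    have hm := Ψ.matches_at h α (hn α) hc hξ
    obtain ⟨π, hπ, hb⟩ := exists_symbols_contractAll_le hm (Ψ.nf_seqAt_v2Free h α hS) hg
    exact ⟨c, ξ, t, _, ⟨hc, hξ, ht, hg, π, hπ, rfl⟩, hb⟩
  · rintro c ξ t _ ⟨hc, hξ, ht, hg, π, hπ, rfl⟩
    have hm := Ψ.matches_at h α (hn α) hc hξ
    have hPR : ∀ φ ∈ ξ.proofs, φ.Valid E ∧ φ.Plain := fun φ hφ =>
      let ⟨_, _, h⟩ := hm.clause φ hφ; ⟨h.valid, h.plain⟩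
    obtain ⟨⟨hv, hgr, ha⟩, hs, hb⟩ := Skeleton.size_contractAll_le hPR
      (fun φ hφ => Finset.single_le_sum (f := Pf.size) (fun _ _ => Nat.zero_le _) hφ)
      (Ψ.nf_seqAt_v2Free h α hS) hπ hg.2.1 hg.1
    refine ⟨hv, hgr, ha, hs, Pf.exists_eqv hv hs, ?_⟩
    simpa [PT.size] using hb
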